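/- Let $k$ be a field of characteristic $0$. All dg Lie algebras are over $k$ and graded in non-negative degrees, with differential of degree $+1$; such a $\mathfrak g$ is nilpotent if its lower central series $\mathfrak g\supseteq[\mathfrak g,\mathfrak g]\supseteq[\mathfrak g,[\mathfrak g,\mathfrak g]]\supseteq\cdots$ reaches $0$. Put $$\mathrm{MC}(\mathfrak g)=\{x\in\mathfrak g^1\mid dx+\tfrac12[x,x]=0\}.$$ *Contents.* Let $\Omega_n$ be the commutative dg algebra $k[t_0,\dots,t_n,dt_0,\dots,dt_n]/(\sum t_i-1,\sum dt_i)$ of polynomial differential forms on the $n$-simplex; a monotone map $u:[m]\to[n]$ induces $\Omega_n\to\Omega_m$, $t_i\mapsto\sum_{u(j)=i}t_j$. The contents of a nilpotent $\mathfrak g$ is the simplicial set $\Sigma(\mathfrak g)$ with $\Sigma(\mathfrak g)_n=\mathrm{MC}(\Omega_n\otimes\mathfrak g)$. *Deligne groupoid.* For $y\in\mathfrak g^0$, let $\rho(y)$ be the affine vector field $\rho(y)(x)=dy+[x,y]$ and let $\exp(y)$ act on $\mathrm{MC}(\mathfrak g)$ by the exponential (time-one flow) of $\rho(y)$. With the product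 $\exp(y)\exp(y')=\exp(\mathrm{BCH}(y,y'))$, where $\mathrm{BCH}(y,y')=\log(e^ye^{y'})$, this is a right action $x\mapsto x\cdot\gamma$ of the group $G=\exp(\mathfrak g^0)$. The Deligne groupoid $\mathcal C(\mathfrak g)$ has object set $\mathrm{MC}(\mathfrak g)$ and morphisms $\mathrm{Hom}(x,x')=\{\gamma\in G\mid x\cdot\gamma=x'\}$; the composite of $\gamma:x\to x'$ followed by $\delta:x'\to x''$ is $\gamma\delta$. Let $N\mathcal C(\mathfrak g)$ be its nerve. *Acyclic fibrations.* An acyclic fibration of simplicial sets is a map with the right lifting property with respect to all boundary inclusions $\partial\Delta^n\to\Delta^n$, $n\ge0$. The Poincaré (fundamental) groupoid of a simplicial set $X$ is the groupoid generated by its vertices and edges subject to the relations given by degenerate edges and $2$-simplices; it is the value at $X$ of the left adjoint of the nerve functor from groupoids to simplicial sets. **Proposition.** (1) Let $\mathfrak g$ be a nilpotent dg Lie algebra. Then $\Sigma(\mathfrak g)$ is a Kan simplicial set. There is a unique map of simplicial sets $\tau=\tau_{\mathfrak g}:\Sigma(\mathfrak g)\to N\mathcal C(\mathfrak g)$ with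 the following property: whenever an $n$-simplex $z\in\mathrm{MC}(\Omega_n\otimes\mathfrak g)$ has the form $z=(1\otimes x)\cdot\gamma$ with $x\in\mathrm{MC}(\mathfrak g)$ and $\gamma\in\exp((\Omega_n\otimes\mathfrak g)^0)$, and $\gamma_i\in\exp(\mathfrak g^0)$ is the value of $\gamma$ at the $i$-th vertex, then $\tau(z)$ is the $n$-simplex with vertices $x\cdot\gamma_0,\dots,x\cdot\gamma_n$ whose edge from $i$ to $j$ $(i\le j)$ is $\gamma_i^{-1}\gamma_j$. The map $\tau$ is an acyclic fibration, and the functor from the Poincaré groupoid of $\Sigma(\mathfrak g)$ to $\mathcal C(\mathfrak g)$ corresponding to $\tau$ is an isomorphism of groupoids. (2) Let $f:\mathfrak g\to\mathfrak h$ be a surjective morphism of nilpotent dg Lie algebras. Then $N\mathcal C(f)\circ\tau_{\mathfrak g}=\tau_{\mathfrak h}\circ\Sigma(f)$, and the induced map $$\Sigma(\mathfrak g)\longrightarrow N\mathcal C(\mathfrak g)\times_{N\mathcal C(\mathfrak h)}\Sigma(\mathfrak h)$$ is an acyclic fibration. -/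

import Mathlib

set_option linter.unusedSectionVars false

universe u

open scoped TensorProduct
noncomputable section

namespace BCH

variable (k : Type*) {L : Type*} [Field k] [LieRing L] [LieAlgebra k L]

/-- If `f` is the sequence of coefficients of a power series `Z = ∑ f m sᵐ` over `L`, then
`adPow f l` is the sequence of coefficients of `(ad Z)ˡ (s dZ/ds)`. -/
def adPow (f : ℕ → L) : ℕ → ℕ → L
  | 0, m => m • f m
  | l + 1, m => ∑ p ∈ Finset.HasAntidiagonal.antidiagonal m, ⁅f p.1, adPow f l p.2⁆

/-- The coefficient of `sᵐ` in `exp(-s ad y)(s x) + s y`. -/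
def rhs (x y : L) (m : ℕ) : L :=
  if m = 0 then 0 else
    ((-1) ^ (m - 1) * ((m - 1).factorial : k)⁻¹) • (fun v : L => ⁅y, v⁆)^[m - 1] x +
      if m = 1 then y else 0

def step (x y : L) (m : ℕ) (f : ℕ → L) : L :=
  (m : k)⁻¹ • (rhs k x y m -
    ∑ l ∈ Finset.range m, ((-1) ^ (l + 1) * ((l + 2).factorial : k)⁻¹) • adPow f (l + 1) m)

def term (x y : L) (m : ℕ) : L :=
  step k x y m (fun i => if _h : i < m then term x y i else 0)
termination_by m

variable {k}

lemma adPow_zero_of_le {f : ℕ → L} (hf : f 0 = 0) : ∀ l m, m ≤ l → adPow f l m = 0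
  | 0, m, h => by simp [adPow, Nat.le_zero.1 h]
  | l + 1, m, h => by
    rw [adPow]
    refine Finset.sum_eq_zero fun p hp => ?_
    rw [Finset.HasAntidiagonal.mem_antidiagonal] at hp
    rcases Nat.eq_zero_or_pos p.1 with h0 | h0
    · simp [h0, hf]
    · rw [adPow_zero_of_le hf l p.2 (by omega), lie_zero]

lemma adPow_congr {f g : ℕ → L} (hf : f 0 = 0) (hg : g 0 = 0) :
    ∀ l m, (∀ i < m, f i = g i) → adPow f (l + 1) m = adPow g (l + 1) m := by
  intro l
  induction l with
  | zero =>
    intro m h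
    simp only [adPow]
    refine Finset.sum_congr rfl fun p hp => ?_
    rw [Finset.HasAntidiagonal.mem_antidiagonal] at hp
    rcases Nat.eq_zero_or_pos p.1 with h0 | h0
    · simp [h0, hf, hg]
    rcases Nat.eq_zero_or_pos p.2 with h1 | h1
    · simp [h1]
    rw [h _ (by omega), h _ (by omega)]
  | succ l ih =>
    intro m h
    rw [adPow, adPow]
    refine Finset.sum_congr rfl fun p hp => ?_
    rw [Finset.HasAntidiagonal.mem_antidiagonal] at hp
    rcases Nat.eq_zero_or_pos p.1 with h0 | h0
    · simp [h0, hf, hg]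
    rcases Nat.eq_zero_or_pos p.2 with h1 | h1
    · rw [adPow_zero_of_le hf _ _ (by omega), adPow_zero_of_le hg _ _ (by omega)]; simp
    rw [h _ (by omega), ih _ fun i hi => h i (by omega)]

lemma term_zero (x y : L) : term k x y 0 = 0 := by
  rw [term, step]; simp

variable (k) in
/-- The defining recursion. -/
lemma term_rec [CharZero k] (x y : L) (m K : ℕ) (hK : m ≤ K) :
    ∑ l ∈ Finset.range (K + 1), ((-1) ^ l * ((l + 1).factorial : k)⁻¹) • adPow (term k x y) l m =
      rhs k x y m := by
  have h0 := term_zero (k := k) x y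
  rw [← Finset.sum_subset (Finset.range_mono (Nat.add_le_add_right hK 1))]
  swap
  · intro l _ hl
    rw [adPow_zero_of_le h0 _ _ (by simp at hl; omega), smul_zero]
  rw [Finset.sum_range_succ']
  rcases Nat.eq_zero_or_pos m with rfl | hm
  · simp [adPow, rhs]
  have key : (m : k) • term k x y m = rhs k x y m -
      ∑ l ∈ Finset.range m, ((-1) ^ (l + 1) * ((l + 2).factorial : k)⁻¹) •
        adPow (term k x y) (l + 1) m := by
    rw [term, step, smul_smul, mul_inv_cancel₀ (Nat.cast_ne_zero.2 hm.ne'), one_smul]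
    congr 1
    refine Finset.sum_congr rfl fun l _ => ?_
    rw [adPow_congr (by simp [h0]) h0]
    intro i hi
    simp [hi]
  rw [Nat.cast_smul_eq_nsmul] at key
  simp only [adPow, key]
  simp

lemma adPow_map {L' : Type*} [LieRing L'] [LieAlgebra k L'] (φ : L →ₗ⁅k⁆ L') (f : ℕ → L) (l : ℕ) :
    ∀ m, φ (adPow f l m) = adPow (fun i => φ (f i)) l m := by
  induction l with
  | zero => intro m; simp [adPow]
  | succ l ih => intro m; simp [adPow, ih]

lemma term_map {L' : Type*} [LieRing L'] [LieAlgebra k L'] (φ : L →ₗ⁅k⁆ L') (x y : L) (m : ℕ) :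
    φ (term k x y m) = term k (φ x) (φ y) m := by
  induction m using Nat.strong_induction_on with
  | _ m ih =>
    rw [term, term, step, step]
    simp only [map_smul, map_sub, map_sum, adPow_map]
    have hr : φ (rhs k x y m) = rhs k (φ x) (φ y) m := by
      have hi : ∀ n, φ ((fun v : L => ⁅y, v⁆)^[n] x) = (fun v : L' => ⁅φ y, v⁆)^[n] (φ x) := by
        intro n
        induction n with
        | zero => rfl
        | succ n ih => rw [Function.iterate_succ_apply', Function.iterate_succ_apply', ← ih,
            LieHom.map_lie]
      unfold rhs
      split_ifs <;> simp [hi]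
    have hf : (fun i => φ (if _h : i < m then term k x y i else 0)) =
        fun i => if _h : i < m then term k (φ x) (φ y) i else 0 := by
      funext i
      by_cases h : i < m
      · simp [h, ih i h]
      · simp [h]
    rw [hr, hf]

/-- Filtered Lie algebras. -/
lemma term_mem (F : ℕ → Submodule k L)
    (hF : ∀ i j u v, u ∈ F i → v ∈ F j → ⁅u, v⁆ ∈ F (i + j)) {x y : L}
    (hx : x ∈ F 1) (hy : y ∈ F 1) (m : ℕ) : term k x y m ∈ F m := by
  induction m using Nat.strong_induction_on with
  | _ m ih =>
    rw [term, step]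
    have hp : ∀ (f : ℕ → L), (∀ i, f i ∈ F i) → ∀ l m, adPow f l m ∈ F m := by
      intro f hf l
      induction l with
      | zero => intro m; exact nsmul_mem (hf m) m
      | succ l ihl =>
        intro m
        refine sum_mem fun p hp => ?_
        rw [Finset.HasAntidiagonal.mem_antidiagonal] at hp
        exact hp ▸ hF _ _ _ _ (hf _) (ihl _)
    refine (F m).smul_mem _ (sub_mem ?_ (sum_mem fun l _ => (F m).smul_mem _ (hp _ ?_ _ _)))
    · have hi : ∀ n, (fun v : L => ⁅y, v⁆)^[n] x ∈ F (n + 1) := by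
        intro n
        induction n with
        | zero => exact hx
        | succ n ih =>
          rw [Function.iterate_succ_apply', add_comm]
          exact hF _ _ _ _ hy ih
      unfold rhs
      split_ifs with h h'
      · exact zero_mem _
      · exact add_mem ((F m).smul_mem _ (by have := hi (m-1); rwa [Nat.sub_add_cancel (by omega)] at this)) (h' ▸ hy)
      · exact add_mem ((F m).smul_mem _ (by have := hi (m-1); rwa [Nat.sub_add_cancel (by omega)] at this)) (zero_mem _)
    · intro i
      split_ifs with h
      · exact ih i h
      · exact zero_mem _

lemma lie_mem_lcs (i : ℕ) : ∀ (j : ℕ) (u v : L),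
    u ∈ LieModule.lowerCentralSeries k L L i → v ∈ LieModule.lowerCentralSeries k L L j →
      ⁅u, v⁆ ∈ LieModule.lowerCentralSeries k L L (i + j + 1) := by
  have hb : ∀ (n : ℕ) (a b : L), b ∈ LieModule.lowerCentralSeries k L L n →
      ⁅a, b⁆ ∈ LieModule.lowerCentralSeries k L L (n + 1) := by
    intro n a b h
    rw [LieModule.lowerCentralSeries_succ]
    exact LieSubmodule.lie_mem_lie (LieSubmodule.mem_top a) h
  induction i with
  | zero => intro j u v _ hv; simpa using hb j u v hv
  | succ i ih =>
    intro j u v hu hv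
    rw [LieModule.lowerCentralSeries_succ, ← LieSubmodule.mem_toSubmodule,
      LieSubmodule.lieIdeal_oper_eq_linear_span'] at hu
    induction hu using Submodule.span_induction with
    | mem w hw =>
      obtain ⟨a, -, b, hbm, rfl⟩ := hw
      rw [lie_lie]
      refine sub_mem ?_ ?_
      · have := hb _ a _ (ih j b v hbm hv)
        rwa [show i + 1 + j + 1 = i + j + 1 + 1 by ring]
      · have := ih (j+1) b _ hbm (hb _ a v hv)
        rwa [show i + 1 + j + 1 = i + (j + 1) + 1 by ring]
    | zero => simp
    | add a b _ _ ha hb => rw [add_lie]; exact add_mem ha hb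
    | smul c a _ ha => rw [smul_lie]; exact (LieModule.lowerCentralSeries k L L _).smul_mem _ ha

lemma exists_term_eq_zero [LieRing.IsNilpotent L] :
    ∃ N, ∀ (x y : L) (m : ℕ), N ≤ m → term k x y m = 0 := by
  obtain ⟨N, hN⟩ := LieModule.IsNilpotent.nilpotent k L L
  refine ⟨N + 1, fun x y m hm => ?_⟩
  have := term_mem (k := k) (fun i => (LieModule.lowerCentralSeries k L L (i - 1)).toSubmodule)
    (fun i j u v hu hv => ?_) (x := x) (y := y) (by simp) (by simp) m
  · rw [LieSubmodule.mem_toSubmodule] at this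
    have h2 := LieModule.antitone_lowerCentralSeries k L L (show N ≤ m - 1 by omega) this
    rw [hN] at h2
    simpa using h2
  · have := lie_mem_lcs (k := k) _ _ u v hu hv
    exact LieModule.antitone_lowerCentralSeries k L L (by omega) this

end BCH

section NilpotentExp

variable (k : Type*) [Field k] {A : Type*} [Ring A] [Algebra k A]

/-- The exponential `∑ aⁱ / i!` of a nilpotent element `a` of an associative algebra. -/
def nilExp (a : A) : A :=
  ∑ i ∈ Finset.range (nilpotencyClass a), ((i.factorial : k)⁻¹) • a ^ i

variable [CharZero k]

lemma nilExp_eq [Module ℚ A] (a : A) : nilExp k a = IsNilpotent.exp a := by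
  unfold nilExp IsNilpotent.exp
  refine Finset.sum_congr rfl fun i _ => ?_
  rw [← Rat.cast_smul_eq_qsmul k]
  simp

lemma nilExp_eq_sum {a : A} {N : ℕ} (h : a ^ N = 0) :
    nilExp k a = ∑ i ∈ Finset.range N, ((i.factorial : k)⁻¹) • a ^ i := by
  let _ : Module ℚ A := Module.compHom A (algebraMap ℚ k)
  rw [nilExp_eq, IsNilpotent.exp_eq_sum h]
  refine Finset.sum_congr rfl fun i _ => ?_
  rw [← Rat.cast_smul_eq_qsmul k]
  simp

lemma nilExp_zero : nilExp k (0 : A) = 1 := by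
  rw [nilExp_eq_sum k (pow_one 0)]; simp

lemma nilExp_mul_neg {a : A} (h : IsNilpotent a) : nilExp k a * nilExp k (-a) = 1 := by
  let _ : Module ℚ A := Module.compHom A (algebraMap ℚ k)
  rw [nilExp_eq, nilExp_eq, IsNilpotent.exp_mul_exp_neg_self h]

lemma nilExp_neg_mul {a : A} (h : IsNilpotent a) : nilExp k (-a) * nilExp k a = 1 := by
  let _ : Module ℚ A := Module.compHom A (algebraMap ℚ k)
  rw [nilExp_eq, nilExp_eq, IsNilpotent.exp_neg_mul_exp_self h]

lemma map_nilExp {B : Type*} [Ring B] [Algebra k B] (f : A →+* B) {a : A} (h : IsNilpotent a) :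
    f (nilExp k a) = nilExp k (f a) := by
  let _ : Module ℚ A := Module.compHom A (algebraMap ℚ k)
  let _ : Module ℚ B := Module.compHom B (algebraMap ℚ k)
  rw [nilExp_eq, nilExp_eq, IsNilpotent.map_exp h]

/-- `exp(-b) a exp(b) = exp(-ad b) a`. -/
lemma nilExp_conj {b : A} (hb : IsNilpotent b) (a : A) :
    ∃ M, ∀ N, M ≤ N → nilExp k (-b) * a * nilExp k b =
      ∑ n ∈ Finset.range N, ((-1) ^ n * (n.factorial : k)⁻¹) • (fun v : A => ⁅b, v⁆)^[n] a := by
  let _ : Module ℚ A := Module.compHom A (algebraMap ℚ k)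
  let _ : Module ℚ (Module.End k A) := Module.compHom (Module.End k A) (algebraMap ℚ k)
  have hl : IsNilpotent (LinearMap.mulLeft k (-b)) :=
    (LinearMap.isNilpotent_mulLeft_iff k (-b)).2 hb.neg
  have hr : IsNilpotent (LinearMap.mulRight k b) :=
    (LinearMap.isNilpotent_mulRight_iff k b).2 hb
  have hc : Commute (LinearMap.mulLeft k (-b)) (LinearMap.mulRight k b) :=
    LinearMap.commute_mulLeft_right (R := k) _ _
  obtain ⟨M, hM⟩ := hc.isNilpotent_add hl hr
  refine ⟨M, fun N hN => ?_⟩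
  have h1 := IsNilpotent.exp_add_of_commute hc hl hr
  have h2 : ∀ c : A, IsNilpotent c → ∀ v,
      IsNilpotent.exp (LinearMap.mulLeft k c) v = nilExp k c * v := by
    rintro c ⟨m, hm⟩ v
    have : LinearMap.mulLeft k c ^ m = 0 := by rw [LinearMap.pow_mulLeft, hm]; simp
    rw [← nilExp_eq k, nilExp_eq_sum k this, nilExp_eq_sum k hm]
    simp [LinearMap.pow_mulLeft, Finset.sum_mul]
  have h3 : ∀ c : A, IsNilpotent c → ∀ v,
      IsNilpotent.exp (LinearMap.mulRight k c) v = v * nilExp k c := by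
    rintro c ⟨m, hm⟩ v
    have : LinearMap.mulRight k c ^ m = 0 := by rw [LinearMap.pow_mulRight, hm]; simp
    rw [← nilExp_eq k, nilExp_eq_sum k this, nilExp_eq_sum k hm]
    simp [LinearMap.pow_mulRight, Finset.mul_sum]
  have h4 := LinearMap.congr_fun h1 a
  rw [Module.End.mul_apply, h3 b hb, h2 _ hb.neg, ← nilExp_eq k,
    nilExp_eq_sum k (pow_eq_zero_of_le hN hM)] at h4
  rw [mul_assoc, ← h4, LinearMap.sum_apply]
  refine Finset.sum_congr rfl fun n _ => ?_
  have h5 : ∀ n, ((LinearMap.mulLeft k (-b) + LinearMap.mulRight k b) ^ n) a =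
      ((-1 : k) ^ n) • (fun v : A => ⁅b, v⁆)^[n] a := by
    intro n
    induction n with
    | zero => simp
    | succ n ih =>
      rw [pow_succ', Module.End.mul_apply, ih, Function.iterate_succ_apply', Ring.lie_def]
      simp only [LinearMap.add_apply, LinearMap.mulLeft_apply, LinearMap.mulRight_apply,
        mul_smul_comm, smul_mul_assoc, pow_succ, neg_mul]
      module
  rw [LinearMap.smul_apply, h5, smul_smul, mul_comm]

/-- The derivative of a power. -/
lemma derivation_pow (D : A →ₗ[k] A) (hD : ∀ a b, D (a * b) = D a * b + a * D b) (z : A) (n : ℕ) :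
    D (z ^ n) = ∑ l ∈ Finset.range n, (((-1) ^ l * (n.choose (l + 1) : k))) •
      (z ^ (n - 1 - l) * (fun v : A => ⁅z, v⁆)^[l] (D z)) := by
  induction n with
  | zero =>
    have := hD 1 1
    simp at this
    simp [this]
  | succ n ih =>
    set w := D z
    set u : ℕ → A := fun l => (fun v : A => ⁅z, v⁆)^[l] w with hu
    have hus : ∀ l, u l * z = z * u l - u (l + 1) := by
      intro l
      simp only [hu, Function.iterate_succ_apply', Ring.lie_def]
      abel
    have e1 : D (z ^ n) * z = ∑ l ∈ Finset.range n, ((-1) ^ l * (n.choose (l + 1) : k)) •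
          (z ^ (n - l) * u l) +
        ∑ l ∈ Finset.range n, ((-1) ^ (l + 1) * (n.choose (l + 1) : k)) •
          (z ^ (n - (l + 1)) * u (l + 1)) := by
      rw [ih, Finset.sum_mul, ← Finset.sum_add_distrib]
      refine Finset.sum_congr rfl fun l hl => ?_
      rw [Finset.mem_range] at hl
      change _ • (z ^ (n - 1 - l) * u l) * z = _
      rw [smul_mul_assoc, mul_assoc, hus, mul_sub, ← mul_assoc, ← pow_succ,
        show n - 1 - l + 1 = n - l by omega, show n - 1 - l = n - (l + 1) by omega, smul_sub,
        pow_succ (-1 : k) l]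
      simp [sub_eq_add_neg]
    have e2 : ∑ l ∈ Finset.range (n + 1), ((-1) ^ l * (n.choose l : k)) • (z ^ (n - l) * u l) =
        ∑ l ∈ Finset.range n, ((-1) ^ (l + 1) * (n.choose (l + 1) : k)) •
          (z ^ (n - (l + 1)) * u (l + 1)) + z ^ n * w := by
      rw [Finset.sum_range_succ']
      simp [hu]
    have e3 : ∑ l ∈ Finset.range (n + 1), ((-1) ^ l * (n.choose (l + 1) : k)) •
        (z ^ (n - l) * u l) = ∑ l ∈ Finset.range n, ((-1) ^ l * (n.choose (l + 1) : k)) •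
          (z ^ (n - l) * u l) := by
      rw [Finset.sum_range_succ]
      simp
    rw [pow_succ, hD, e1, add_assoc, ← e2, ← e3, ← Finset.sum_add_distrib]
    refine Finset.sum_congr rfl fun l hl => ?_
    rw [← add_smul, ← mul_add, Nat.choose_succ_succ, Nat.cast_add, add_comm (n.choose l : k)]
    rfl

/-- The logarithmic derivative of the exponential map. -/
lemma derivation_nilExp (D : A →ₗ[k] A) (hD : ∀ a b, D (a * b) = D a * b + a * D b) {z : A}
    (hz : IsNilpotent z) :
    ∃ M, ∀ N, M ≤ N → D (nilExp k z) = nilExp k z *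
      ∑ l ∈ Finset.range N, ((-1) ^ l * ((l + 1).factorial : k)⁻¹) •
        (fun v : A => ⁅z, v⁆)^[l] (D z) := by
  have had : ∃ m, ∀ l, m ≤ l → (fun v : A => ⁅z, v⁆)^[l] (D z) = 0 := by
    obtain ⟨m, hm⟩ := (LinearMap.commute_mulLeft_right (R := k) z z).isNilpotent_sub
      ((LinearMap.isNilpotent_mulLeft_iff k z).2 hz) ((LinearMap.isNilpotent_mulRight_iff k z).2 hz)
    refine ⟨m, fun l hl => ?_⟩
    have h2 := LinearMap.congr_fun (pow_eq_zero_of_le hl hm) (D z)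
    rw [Module.End.pow_apply] at h2
    exact h2
  obtain ⟨m, hm⟩ := had
  obtain ⟨n, hn⟩ := hz
  refine ⟨n + m, fun N hN => ?_⟩
  set u : ℕ → A := fun l => (fun v : A => ⁅z, v⁆)^[l] (D z) with hu
  set g : ℕ → ℕ → A := fun l p =>
    ((-1) ^ l * ((l + 1).factorial : k)⁻¹ * (p.factorial : k)⁻¹) • (z ^ p * u l) with hg
  have h1 : D (nilExp k z) = ∑ q ∈ Finset.range N, ∑ l ∈ Finset.range (q + 1), g l (q - l) := by
    rw [nilExp_eq_sum k (pow_eq_zero_of_le (show n ≤ N + 1 by omega) hn), map_sum,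
      Finset.sum_range_succ']
    have h0 : D (((Nat.factorial 0 : k)⁻¹) • z ^ 0) = 0 := by
      rw [map_smul, derivation_pow k D hD]; simp
    rw [h0, add_zero]
    refine Finset.sum_congr rfl fun q _ => ?_
    rw [map_smul, derivation_pow k D hD, Finset.smul_sum]
    refine Finset.sum_congr rfl fun l hl => ?_
    rw [smul_smul]
    simp only [hg, Nat.add_sub_cancel]
    congr 1
    have hl' : l ≤ q := by simp at hl; omega
    have hf := Nat.choose_mul_factorial_mul_factorial (show l + 1 ≤ q + 1 by omega)
    rw [Nat.add_sub_add_right] at hf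
    have hf' : ((q + 1).choose (l + 1) : k) * ((l + 1).factorial : k) * ((q - l).factorial : k) =
        ((q + 1).factorial : k) := by exact_mod_cast hf
    have a1 : ((l + 1).factorial : k) ≠ 0 := Nat.cast_ne_zero.2 (Nat.factorial_ne_zero _)
    have a2 : ((q - l).factorial : k) ≠ 0 := Nat.cast_ne_zero.2 (Nat.factorial_ne_zero _)
    have a3 : ((q + 1).factorial : k) ≠ 0 := Nat.cast_ne_zero.2 (Nat.factorial_ne_zero _)
    field_simp
    linear_combination hf'
  rw [h1, Finset.sum_range_diag_flip, Finset.mul_sum]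
  refine Finset.sum_congr rfl fun l hl => ?_
  rcases le_or_gt m l with h | h
  · have : u l = 0 := hm l h
    change _ = _ * (_ • u l)
    simp [hg, this]
  · rw [nilExp_eq_sum k (pow_eq_zero_of_le (show n ≤ N - l by omega) hn), Finset.sum_mul]
    refine Finset.sum_congr rfl fun p _ => ?_
    simp only [hg]
    rw [smul_mul_assoc, mul_smul_comm, smul_smul, mul_comm]

end NilpotentExp

namespace BCH

open Polynomial

section

attribute [local instance 100] LieRing.ofAssociativeRing

variable {k : Type*} [Field k] [CharZero k] {A : Type*} [Ring A] [Algebra k A]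

variable (k A) in
/-- The Euler operator `X d/dX`. -/
def euler : A[X] →ₗ[k] A[X] where
  toFun p := X * derivative p
  map_add' p q := by rw [derivative_add, mul_add]
  map_smul' c p := by rw [derivative_smul, mul_smul_comm]; rfl

lemma euler_mul (p q : A[X]) : euler k A (p * q) = euler k A p * q + p * euler k A q := by
  simp only [euler, LinearMap.coe_mk, AddHom.coe_mk, derivative_mul, mul_add, ← mul_assoc]
  rw [X_mul (p := p)]

lemma coeff_euler (p : A[X]) (m : ℕ) : (euler k A p).coeff m = m • p.coeff m := by
  simp only [euler, LinearMap.coe_mk, AddHom.coe_mk]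
  cases m with
  | zero => simp
  | succ m => rw [coeff_X_mul, coeff_derivative, nsmul_eq_mul, ← Nat.cast_succ,
      (Nat.cast_commute (m + 1) _).eq]

lemma euler_unique {P Q φ : A[X]} (hφ : φ.coeff 0 = 0) (h0 : P.coeff 0 = Q.coeff 0)
    (hP : euler k A P = P * φ) (hQ : euler k A Q = Q * φ) : P = Q := by
  ext m
  induction m using Nat.strong_induction_on with
  | _ m ih =>
    rcases Nat.eq_zero_or_pos m with rfl | hm
    · exact h0
    have h : m • P.coeff m = m • Q.coeff m := by
      rw [← coeff_euler (k := k), ← coeff_euler (k := k), hP, hQ, coeff_mul, coeff_mul]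
      refine Finset.sum_congr rfl fun p hp => ?_
      rw [Finset.HasAntidiagonal.mem_antidiagonal] at hp
      rcases Nat.eq_zero_or_pos p.2 with h2 | h2
      · rw [h2, hφ, mul_zero, mul_zero]
      · rw [ih _ (by omega)]
    rw [← Nat.cast_smul_eq_nsmul k, ← Nat.cast_smul_eq_nsmul k] at h
    exact smul_right_injective A (Nat.cast_ne_zero (R := k).2 hm.ne') h

lemma coeff_iterate_lie (Z : A[X]) (l : ℕ) : ∀ m,
    ((fun v : A[X] => ⁅Z, v⁆)^[l] (euler k A Z)).coeff m = adPow (fun i => Z.coeff i) l m := by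
  induction l with
  | zero => intro m; rw [adPow]; exact coeff_euler Z m
  | succ l ih =>
    intro m
    rw [Function.iterate_succ_apply', adPow]
    set V := (fun v : A[X] => ⁅Z, v⁆)^[l] (euler k A Z)
    have hs : ∑ p ∈ Finset.HasAntidiagonal.antidiagonal m, V.coeff p.1 * Z.coeff p.2 =
        ∑ p ∈ Finset.HasAntidiagonal.antidiagonal m, V.coeff p.2 * Z.coeff p.1 :=
      (Finset.Nat.sum_antidiagonal_swap
        (f := fun p : ℕ × ℕ => V.coeff p.1 * Z.coeff p.2)).symm
    rw [Ring.lie_def, coeff_sub, coeff_mul, coeff_mul, hs, ← Finset.sum_sub_distrib]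
    refine Finset.sum_congr rfl fun p _ => ?_
    rw [ih, Ring.lie_def]

lemma coeff_zero_nilExp {Z : A[X]} (hZ : IsNilpotent Z) (h0 : Z.coeff 0 = 0) :
    (nilExp k Z).coeff 0 = 1 := by
  have := map_nilExp k (constantCoeff (R := A)) hZ
  rw [constantCoeff_apply, constantCoeff_apply, h0, nilExp_zero] at this
  exact this

/-- The Baker-Campbell-Hausdorff theorem in a nilpotent associative algebra. -/
theorem nilExp_sum_term {M : Submodule k A} {N : ℕ} (hM : M ^ N = ⊥) {a b : A} (ha : a ∈ M)
    (hb : b ∈ M) :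
    nilExp k (∑ m ∈ Finset.range N, term k a b m) = nilExp k a * nilExp k b := by
  have hMge : ∀ m, N ≤ m → ∀ v ∈ M ^ m, v = 0 := by
    intro m hm v hv
    rw [← Nat.add_sub_cancel' hm, pow_add, hM, Submodule.bot_mul] at hv
    simpa using hv
  have ht : ∀ m, term k a b m ∈ M ^ m := by
    refine term_mem (fun m => M ^ m) (fun i j u v hu hv => ?_) (by simpa using ha)
      (by simpa using hb)
    rw [Ring.lie_def]
    refine sub_mem ?_ ?_
    · rw [pow_add]; exact Submodule.mul_mem_mul hu hv
    · rw [add_comm, pow_add]; exact Submodule.mul_mem_mul hv hu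
  set Z : A[X] := ∑ m ∈ Finset.range N, monomial m (term k a b m) with hZ
  have hZc : ∀ m, Z.coeff m = term k a b m := by
    intro m
    rw [hZ, finsetSum_coeff]
    simp only [coeff_monomial, Finset.sum_ite_eq', Finset.mem_range]
    split_ifs with h
    · rfl
    · exact (hMge m (not_lt.1 h) _ (ht m)).symm
  have hZn : IsNilpotent Z := by
    have key : ∀ n m, (Z ^ n).coeff m ∈ M ^ m ∧ (m < n → (Z ^ n).coeff m = 0) := by
      intro n
      induction n with
      | zero =>
        intro m
        refine ⟨?_, by simp⟩
        rw [pow_zero, coeff_one]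
        split_ifs with h
        · subst h; rw [pow_zero]; exact Submodule.one_le.1 le_rfl
        · exact zero_mem _
      | succ n ih =>
        intro m
        rw [pow_succ, coeff_mul]
        refine ⟨sum_mem fun p hp => ?_, fun hm => Finset.sum_eq_zero fun p hp => ?_⟩
        · rw [Finset.HasAntidiagonal.mem_antidiagonal] at hp
          rw [← hp, pow_add, hZc]
          exact Submodule.mul_mem_mul (ih _).1 (ht _)
        · rw [Finset.HasAntidiagonal.mem_antidiagonal] at hp
          rcases Nat.eq_zero_or_pos p.2 with h2 | h2
          · rw [h2, hZc, term_zero, mul_zero]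
          · rw [(ih p.1).2 (by omega), zero_mul]
    refine ⟨N, ?_⟩
    ext m
    rw [coeff_zero]
    rcases lt_or_ge m N with h | h
    · exact (key N m).2 h
    · exact hMge m h _ (key N m).1
  have hmon : ∀ c ∈ M, IsNilpotent (monomial 1 c : A[X]) := by
    intro c hc
    refine ⟨N, ?_⟩
    rw [monomial_pow, hMge N le_rfl _ (Submodule.pow_mem_pow M hc N)]
    simp
  have hmonE : ∀ c : A, euler k A (monomial 1 c) = monomial 1 c := by
    intro c
    ext m
    rw [coeff_euler, coeff_monomial]
    split_ifs with h
    · rw [← h, one_smul]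
    · simp
  -- the logarithmic derivatives
  obtain ⟨M1, h1⟩ := derivation_nilExp k (euler k A) euler_mul hZn
  obtain ⟨M2, h2⟩ := derivation_nilExp k (euler k A) euler_mul (hmon a ha)
  obtain ⟨M3, h3⟩ := derivation_nilExp k (euler k A) euler_mul (hmon b hb)
  obtain ⟨M4, h4⟩ := nilExp_conj k (hmon b hb) (monomial 1 a : A[X])
  have hsimp : ∀ (c : A) (K : ℕ), ∑ l ∈ Finset.range (K + 1), ((-1) ^ l *
      ((l + 1).factorial : k)⁻¹) • (fun v : A[X] => ⁅(monomial 1 c : A[X]), v⁆)^[l]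
        (euler k A (monomial 1 c)) = monomial 1 c := by
    intro c K
    rw [Finset.sum_range_succ', Finset.sum_eq_zero]
    · simp [hmonE]
    · intro l _
      rw [Function.iterate_succ_apply, hmonE, lie_self]
      have : ∀ n, (fun v : A[X] => ⁅(monomial 1 c : A[X]), v⁆)^[n] 0 = 0 := by
        intro n
        induction n with
        | zero => rfl
        | succ n ih => rw [Function.iterate_succ_apply, lie_zero, ih]
      rw [this, smul_zero]
  have ea := h2 (M2 + 1) (by omega)
  rw [hsimp] at ea
  have eb := h3 (M3 + 1) (by omega)
  rw [hsimp] at eb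
  set φ : A[X] := nilExp k (-monomial 1 b) * monomial 1 a * nilExp k (monomial 1 b) +
    monomial 1 b with hφ
  have hφc : ∀ m, φ.coeff m = rhs k a b m := by
    intro m
    have hit : ∀ n, (fun v : A[X] => ⁅(monomial 1 b : A[X]), v⁆)^[n] (monomial 1 a) =
        monomial (n + 1) ((fun v : A => ⁅b, v⁆)^[n] a) := by
      intro n
      induction n with
      | zero => rfl
      | succ n ih =>
        rw [Function.iterate_succ_apply', Function.iterate_succ_apply', ih, Ring.lie_def,
          monomial_mul_monomial, monomial_mul_monomial, Ring.lie_def, add_comm 1, monomial_sub]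
    rw [hφ, coeff_add, h4 (M4 + m) (by omega), finsetSum_coeff, coeff_monomial]
    simp only [coeff_smul, hit, coeff_monomial]
    rcases Nat.eq_zero_or_pos m with rfl | hm
    · simp [rhs]
    rw [rhs, if_neg hm.ne', Finset.sum_eq_single (m - 1)]
    · rw [if_pos (by omega)]
      congr 1
      simp only [eq_comm]
    · intro n _ hn
      rw [if_neg (by omega), smul_zero]
    · intro h
      simp at h; omega
  have hE1 : euler k A (nilExp k Z) = nilExp k Z * φ := by
    ext m
    rw [h1 (M1 + m + 1) (by omega), coeff_mul, coeff_mul]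
    refine Finset.sum_congr rfl fun p hp => ?_
    rw [Finset.HasAntidiagonal.mem_antidiagonal] at hp
    rw [hφc, ← term_rec k a b p.2 (M1 + m) (by omega), finsetSum_coeff]
    congr 1
    refine Finset.sum_congr rfl fun l _ => ?_
    rw [coeff_smul, coeff_iterate_lie]
    simp only [hZc]
  have hE2 : euler k A (nilExp k (monomial 1 a) * nilExp k (monomial 1 b)) =
      nilExp k (monomial 1 a) * nilExp k (monomial 1 b) * φ := by
    rw [euler_mul, ea, eb, hφ, mul_add]
    congr 1
    · have := nilExp_mul_neg k (hmon b hb)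
      simp only [mul_assoc]
      rw [← mul_assoc (nilExp k (monomial 1 b)) (nilExp k (-monomial 1 b)), this, one_mul]
    · rw [mul_assoc]
  have hφ0 : φ.coeff 0 = 0 := by rw [hφc]; simp [rhs]
  have hfin := euler_unique (k := k) hφ0 (by
    rw [mul_coeff_zero, coeff_zero_nilExp hZn (by rw [hZc, term_zero]),
      coeff_zero_nilExp (hmon a ha) (by simp [coeff_monomial]),
      coeff_zero_nilExp (hmon b hb) (by simp [coeff_monomial]), one_mul]) hE1 hE2
  let ev : A[X] →+* A := eval₂RingHom' (RingHom.id A) 1 (fun c => Commute.one_right c)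
  have hev : ∀ (m : ℕ) (c : A), ev (monomial m c) = c := by
    intro m c
    change eval₂ _ _ _ = _
    simp
  have := congrArg ev hfin
  rw [map_mul, map_nilExp k ev hZn, map_nilExp k ev (hmon a ha), map_nilExp k ev (hmon b hb),
    hev, hev, hZ, map_sum] at this
  simpa only [hev] using this

end

end BCH

namespace BCH

open Polynomial

section Representations

variable {k : Type*} [Field k] [CharZero k] {V : Type*} [AddCommGroup V] [Module k V]

/-- On endomorphisms lowering a finite filtration, the exponential is injective. -/
lemma nilExp_injective {F : ℕ → Submodule k V} (hF : Antitone F) (h0 : F 0 = ⊤) {N : ℕ}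
    (hN : F N = ⊥) {a b : Module.End k V} (ha : ∀ i, ∀ v ∈ F i, a v ∈ F (i + 1))
    (hb : ∀ i, ∀ v ∈ F i, b v ∈ F (i + 1)) (h : nilExp k a = nilExp k b) : a = b := by
  have hpow : ∀ {c : Module.End k V}, (∀ i, ∀ v ∈ F i, c v ∈ F (i + 1)) →
      ∀ n i, ∀ v ∈ F i, (c ^ n) v ∈ F (i + n) := by
    intro c hc n
    induction n with
    | zero => intro i v hv; simpa using hv
    | succ n ih => intro i v hv; rw [pow_succ', Module.End.mul_apply]; exact hc _ _ (ih i v hv)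
  have hz : ∀ {c : Module.End k V}, (∀ i, ∀ v ∈ F i, c v ∈ F (i + 1)) → c ^ N = 0 := by
    intro c hc
    ext v
    have := hpow hc N 0 v (by rw [h0]; trivial)
    rw [zero_add, hN] at this
    simpa using this
  have key : ∀ n j, ∀ v ∈ F j, (a - b) v ∈ F (j + n) := by
    intro n
    induction n with
    | zero =>
      intro j v hv
      exact sub_mem (hF (Nat.le_succ _) (ha j v hv)) (hF (Nat.le_succ _) (hb j v hv))
    | succ n ih =>
      have h1 : ∀ i j, ∀ v ∈ F j, (a ^ i - b ^ i) v ∈ F (j + n) := by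
        intro i
        induction i with
        | zero => intro j v _; simp
        | succ i ihi =>
          intro j v hv
          have : a ^ (i + 1) - b ^ (i + 1) = a ^ i * (a - b) + (a ^ i - b ^ i) * b := by
            rw [pow_succ, pow_succ]; noncomm_ring
          rw [this]
          refine add_mem ?_ ?_
          · exact hF (by omega) (hpow ha i _ _ (ih j v hv))
          · exact hF (by omega) (ihi _ _ (hb j v hv))
      have h2 : ∀ i j, ∀ v ∈ F j, (a ^ (i + 2) - b ^ (i + 2)) v ∈ F (j + (n + 1)) := by
        intro i j v hv
        have : a ^ (i + 2) - b ^ (i + 2) = a ^ (i + 1) * (a - b) +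
            (a ^ (i + 1) - b ^ (i + 1)) * b := by
          rw [show i + 2 = i + 1 + 1 from rfl, pow_succ a (i + 1), pow_succ b (i + 1)]
          noncomm_ring
        rw [this]
        refine add_mem ?_ ?_
        · exact hF (by omega) (hpow ha (i + 1) _ _ (ih j v hv))
        · exact hF (by omega) (h1 (i + 1) _ _ (hb j v hv))
      intro j v hv
      have h3 : (∑ i ∈ Finset.range (N + 2), ((i.factorial : k)⁻¹) • (a ^ i - b ^ i)) = 0 := by
        simp only [smul_sub, Finset.sum_sub_distrib]
        rw [← nilExp_eq_sum k (pow_eq_zero_of_le (by omega) (hz ha)),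
          ← nilExp_eq_sum k (pow_eq_zero_of_le (by omega) (hz hb)), h, sub_self]
      rw [Finset.sum_range_succ', Finset.sum_range_succ'] at h3
      have h4 : (a - b) v = - ∑ i ∈ Finset.range N, (((i + 2).factorial : k)⁻¹) •
          (a ^ (i + 2) - b ^ (i + 2)) v := by
        have := LinearMap.congr_fun h3 v
        simp only [zero_add, Nat.factorial_one, Nat.cast_one, inv_one, one_smul, pow_one, pow_zero,
          sub_self, smul_zero, add_zero, LinearMap.add_apply, LinearMap.sum_apply,
          LinearMap.smul_apply, LinearMap.zero_apply] at this
        rw [eq_neg_iff_add_eq_zero, add_comm]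
        exact this
      rw [h4]
      exact neg_mem (sum_mem fun i _ => (F _).smul_mem _ (h2 i j v hv))
  ext v
  have := key N 0 v (by rw [h0]; trivial)
  rw [zero_add, hN] at this
  simpa [sub_eq_zero] using this

variable (k) in
/-- The Baker-Campbell-Hausdorff series `log(exp x exp y)` in a Lie algebra; the sum is finite
when the Lie algebra is nilpotent. -/
def bch {L : Type*} [LieRing L] [LieAlgebra k L] (x y : L) : L := ∑ᶠ m, term k x y m

variable {L : Type*} [LieRing L] [LieAlgebra k L]

lemma exists_bch_eq [LieRing.IsNilpotent L] :
    ∃ N, ∀ K, N ≤ K → ∀ x y : L, bch k x y = ∑ m ∈ Finset.range K, term k x y m := by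
  obtain ⟨N, hN⟩ := exists_term_eq_zero (k := k) (L := L)
  refine ⟨N, fun K hK x y => finsum_eq_sum_of_support_subset _ fun m hm => ?_⟩
  by_contra h
  refine hm (hN x y m ?_)
  simp at h
  omega

lemma bch_map {L' : Type*} [LieRing L'] [LieAlgebra k L'] [LieRing.IsNilpotent L]
    [LieRing.IsNilpotent L'] (φ : L →ₗ⁅k⁆ L') (x y : L) :
    φ (bch k x y) = bch k (φ x) (φ y) := by
  obtain ⟨N, hN⟩ := exists_bch_eq (k := k) (L := L)
  obtain ⟨N', hN'⟩ := exists_bch_eq (k := k) (L := L')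
  rw [hN (N + N') (by omega), hN' (N + N') (by omega), map_sum]
  exact Finset.sum_congr rfl fun m _ => term_map φ x y m

lemma bch_zero_zero [LieRing.IsNilpotent L] : bch k (0 : L) 0 = 0 := by
  have := bch_map (k := k) (0 : L →ₗ⁅k⁆ L) 0 0
  simpa using this.symm

section

attribute [local instance 100] LieRing.ofAssociativeRing

/-- In a representation lowering a finite filtration, `exp (bch x y) = exp x exp y`. -/
theorem nilExp_bch [LieRing.IsNilpotent L] (ρ : L →ₗ[k] Module.End k V)
    (hρ : ∀ x y, ρ ⁅x, y⁆ = ρ x * ρ y - ρ y * ρ x) {F : ℕ → Submodule k V} (h0 : F 0 = ⊤) {N : ℕ}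
    (hN : F N = ⊥) (hF : ∀ x i, ∀ v ∈ F i, ρ x v ∈ F (i + 1)) (x y : L) :
    nilExp k (ρ (bch k x y)) = nilExp k (ρ x) * nilExp k (ρ y) := by
  let ρ' : L →ₗ⁅k⁆ Module.End k V :=
    { ρ with map_lie' := fun {x y} => by rw [Ring.lie_def]; exact hρ x y }
  have hM : ∀ n, ∀ T ∈ LinearMap.range ρ ^ n, ∀ i, ∀ v ∈ F i, T v ∈ F (i + n) := by
    intro n
    induction n with
    | zero =>
      intro T hT i v hv
      rw [pow_zero] at hT
      obtain ⟨c, rfl⟩ := Submodule.mem_one.1 hT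
      exact (F i).smul_mem c hv
    | succ n ih =>
      intro T hT
      rw [pow_succ'] at hT
      induction hT using Submodule.mul_induction_on' with
      | mem_mul_mem S hS T hT =>
        obtain ⟨y, rfl⟩ := hS
        intro i v hv
        exact hF y _ _ (ih T hT i v hv)
      | add S _ T _ hS hT => intro i v hv; exact add_mem (hS i v hv) (hT i v hv)
  have hbot : ∀ K, N ≤ K → LinearMap.range ρ ^ K = ⊥ := by
    have : LinearMap.range ρ ^ N = ⊥ := by
      rw [eq_bot_iff]
      intro T hT
      rw [Submodule.mem_bot]
      ext v
      have := hM N T hT 0 v (by rw [h0]; trivial)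
      rw [zero_add, hN] at this
      simpa using this
    intro K hK
    rw [← Nat.add_sub_cancel' hK, pow_add, this, Submodule.bot_mul]
  obtain ⟨N', hN'⟩ := exists_bch_eq (k := k) (L := L)
  rw [← nilExp_sum_term (hbot (N + N') (by omega)) (LinearMap.mem_range_self ρ x)
    (LinearMap.mem_range_self ρ y), hN' (N + N') (by omega), map_sum]
  congr 1
  exact Finset.sum_congr rfl fun m _ => term_map ρ' x y m

end

/-- The action of a Lie algebra on `k × V` by affine vector fields, given by a linear action and a
cocycle. -/
def affine (ρ : L →ₗ[k] Module.End k V) (c : L →ₗ[k] V) : L →ₗ[k] Module.End k (k × V) where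
  toFun x := LinearMap.inr k k V ∘ₗ LinearMap.coprod (LinearMap.toSpanSingleton k V (c x)) (ρ x)
  map_add' x y := by ext <;> simp
  map_smul' a x := by ext <;> simp

lemma affine_apply (ρ : L →ₗ[k] Module.End k V) (c : L →ₗ[k] V) (x : L) (p : k × V) :
    affine ρ c x p = (0, p.1 • c x + ρ x p.2) := by
  simp [affine]

/-- The filtration on `k × V` induced by a filtration of `V`. -/
def affineFiltration (F : ℕ → Submodule k V) : ℕ → Submodule k (k × V)
  | 0 => ⊤
  | n + 1 => Submodule.prod ⊥ (F n)

lemma affine_lie {ρ : L →ₗ[k] Module.End k V} {c : L →ₗ[k] V}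
    (hρ : ∀ x y, ρ ⁅x, y⁆ = ρ x * ρ y - ρ y * ρ x)
    (hc : ∀ x y, c ⁅x, y⁆ = ρ x (c y) - ρ y (c x)) (x y : L) :
    affine ρ c ⁅x, y⁆ = affine ρ c x * affine ρ c y - affine ρ c y * affine ρ c x := by
  refine LinearMap.ext fun p => ?_
  simp only [LinearMap.sub_apply, Module.End.mul_apply, affine_apply, hρ, hc, Prod.mk_sub_mk]
  simp only [map_add, map_smul, zero_smul, zero_add, sub_zero, Prod.mk.injEq, true_and]
  module

lemma affine_mem {ρ : L →ₗ[k] Module.End k V} {c : L →ₗ[k] V} {F : ℕ → Submodule k V}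
    (h0 : F 0 = ⊤) (hF : ∀ x i, ∀ v ∈ F i, ρ x v ∈ F (i + 1)) (x : L) (i : ℕ) (p : k × V)
    (hp : p ∈ affineFiltration F i) : affine ρ c x p ∈ affineFiltration F (i + 1) := by
  rw [affine_apply]
  cases i with
  | zero => simp [affineFiltration, h0]
  | succ i =>
    obtain ⟨h1, h2⟩ := hp
    have h1' : p.1 = 0 := by simpa using h1
    refine ⟨by simp, ?_⟩
    change p.1 • c x + ρ x p.2 ∈ F (i + 1)
    rw [h1', zero_smul, zero_add]
    exact hF x i _ h2

/-- The exponential of a cocycle representation is multiplicative for `bch`. -/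
theorem nilExp_affine_bch [LieRing.IsNilpotent L] {ρ : L →ₗ[k] Module.End k V} {c : L →ₗ[k] V}
    (hρ : ∀ x y, ρ ⁅x, y⁆ = ρ x * ρ y - ρ y * ρ x)
    (hc : ∀ x y, c ⁅x, y⁆ = ρ x (c y) - ρ y (c x)) {F : ℕ → Submodule k V} (h0 : F 0 = ⊤) {N : ℕ}
    (hN : F N = ⊥) (hF : ∀ x i, ∀ v ∈ F i, ρ x v ∈ F (i + 1)) (x y : L) :
    nilExp k (affine ρ c (bch k x y)) = nilExp k (affine ρ c x) * nilExp k (affine ρ c y) :=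
  nilExp_bch _ (affine_lie hρ hc) (F := affineFiltration F) rfl (N := N + 1)
    (by rw [affineFiltration, hN]; exact Submodule.prod_bot) (affine_mem h0 hF) x y

lemma affine_isNilpotent {ρ : L →ₗ[k] Module.End k V} {c : L →ₗ[k] V} {F : ℕ → Submodule k V}
    (h0 : F 0 = ⊤) {N : ℕ} (hN : F N = ⊥) (hF : ∀ x i, ∀ v ∈ F i, ρ x v ∈ F (i + 1)) (x : L) :
    IsNilpotent (affine ρ c x) := by
  refine ⟨N + 1, LinearMap.ext fun p => ?_⟩
  have : ∀ n, ((affine ρ c x) ^ n) p ∈ affineFiltration F n := by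
    intro n
    induction n with
    | zero => trivial
    | succ n ih => rw [pow_succ', Module.End.mul_apply]; exact affine_mem h0 hF x n _ ih
  have h := this (N + 1)
  rw [affineFiltration, hN, Submodule.prod_bot] at h
  simpa using h

end Representations

section Group

open scoped TensorProduct

variable (k : Type*) [Field k] (L : Type*) [LieRing L] [LieAlgebra k L]

/-- Evaluation `L[t] → L` at a scalar. -/
def evalAt (a : k) : k[X] ⊗[k] L →ₗ⁅k⁆ L :=
  { TensorProduct.lift (LinearMap.lsmul k L ∘ₗ (aeval a : k[X] →ₐ[k] k).toLinearMap) with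
    map_lie' := by
      intro x y
      change TensorProduct.lift _ _ = ⁅TensorProduct.lift _ _, TensorProduct.lift _ _⁆
      induction x using TensorProduct.induction_on with
      | zero => simp
      | add x x' hx hx' => simp only [add_lie, map_add, hx, hx']
      | tmul p x =>
        induction y using TensorProduct.induction_on with
        | zero => simp
        | add x x' hx hx' => simp only [lie_add, map_add, hx, hx']
        | tmul q y =>
          simp [mul_smul]
          exact smul_comm _ _ _ }

@[simp] lemma evalAt_tmul (a : k) (p : k[X]) (x : L) :
    evalAt k L a (p ⊗ₜ x) = p.eval a • x := by
  change TensorProduct.lift _ _ = _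
  simp

/-- The derivation `d/dt` of `L[t]`. -/
def ddt : k[X] ⊗[k] L →ₗ[k] k[X] ⊗[k] L := LinearMap.rTensor L Polynomial.derivative

variable {k L}

/-- The adjoint representation. -/
def adLin (k : Type*) [Field k] (L : Type*) [LieRing L] [LieAlgebra k L] :
    L →ₗ[k] Module.End k L :=
  LinearMap.mk₂ k (fun x y => ⁅x, y⁆) add_lie smul_lie lie_add lie_smul

lemma adLin_apply {k : Type*} [Field k] {L : Type*} [LieRing L] [LieAlgebra k L] (x y : L) :
    adLin k L x y = ⁅x, y⁆ := rfl

lemma adLin_lie {k : Type*} [Field k] {L : Type*} [LieRing L] [LieAlgebra k L] (x y : L) :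
    adLin k L ⁅x, y⁆ = adLin k L x * adLin k L y - adLin k L y * adLin k L x := by
  refine LinearMap.ext fun v => ?_
  simp [adLin_apply]

lemma adLin_tmul (p q : k[X]) (x y : L) : adLin k (k[X] ⊗[k] L) (p ⊗ₜ x) (q ⊗ₜ y) =
    (p * q) ⊗ₜ ⁅x, y⁆ := rfl

lemma ddt_adLin (x y : k[X] ⊗[k] L) : ddt k L (adLin k _ x y) =
    adLin k _ x (ddt k L y) + adLin k _ (ddt k L x) y := by
  induction x using TensorProduct.induction_on with
  | zero => simp only [map_zero, LinearMap.zero_apply, add_zero]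
  | add x x' hx hx' => simp only [map_add, LinearMap.add_apply, hx, hx']; abel
  | tmul p x =>
    induction y using TensorProduct.induction_on with
    | zero => simp only [map_zero, add_zero]
    | add x x' hx hx' => simp only [map_add, hx, hx']; abel
    | tmul q y =>
      simp only [ddt, adLin_tmul, LinearMap.rTensor_tmul, derivative_mul,
        TensorProduct.add_tmul, add_comm]

variable [CharZero k]

lemma evalAt_eq_of_ddt_eq {P Q : k[X] ⊗[k] L} (h : ddt k L P = ddt k L Q)
    (h0 : evalAt k L 0 P = evalAt k L 0 Q) : evalAt k L 1 P = evalAt k L 1 Q := by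
  let I : k[X] →ₗ[k] k := Polynomial.lsum fun n => ((n + 1 : k)⁻¹) • LinearMap.id
  have hI : ∀ p : k[X], I (derivative p) = p.eval 1 - p.eval 0 := by
    intro p
    induction p using Polynomial.induction_on' with
    | add p q hp hq => simp only [map_add, hp, hq, eval_add]; ring
    | monomial n a =>
      cases n with
      | zero => simp
      | succ n =>
        rw [derivative_monomial]
        have : ((n : k) + 1) ≠ 0 := Nat.cast_add_one_ne_zero n
        simp [I, lsum_apply]
        field_simp
  let J : k[X] ⊗[k] L →ₗ[k] L :=
    TensorProduct.lift (LinearMap.lsmul k L ∘ₗ I)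
  have hJ : ∀ z, J (ddt k L z) = evalAt k L 1 z - evalAt k L 0 z := by
    intro z
    induction z using TensorProduct.induction_on with
    | zero => simp
    | add x y hx hy => simp only [map_add, hx, hy]; abel
    | tmul p x => simp [J, ddt, hI]
  have h1 := hJ P
  rw [h, hJ Q, h0] at h1
  exact (sub_left_injective h1).symm

/-- The action of `L[t]` on `k × L[t]` by infinitesimal gauge transformations. -/
abbrev gaugeField : k[X] ⊗[k] L →ₗ[k] Module.End k (k × (k[X] ⊗[k] L)) :=
  affine (adLin k (k[X] ⊗[k] L)) (ddt k L)

lemma lcs_lowers (L' : Type*) [LieRing L'] [LieAlgebra k L'] (x : L') (i : ℕ) :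
    ∀ v ∈ (LieModule.lowerCentralSeries k L' L' i).toSubmodule,
      adLin k L' x v ∈
        (LieModule.lowerCentralSeries k L' L' (i + 1)).toSubmodule := by
  intro v hv
  rw [LieModule.lowerCentralSeries_succ]
  exact LieSubmodule.lie_mem_lie (LieSubmodule.mem_top x) hv

variable [LieRing.IsNilpotent L]

lemma gaugeField_bch (x y : k[X] ⊗[k] L) :
    nilExp k (gaugeField (bch k x y)) = nilExp k (gaugeField x) * nilExp k (gaugeField y) := by
  obtain ⟨N, hN⟩ := LieModule.IsNilpotent.nilpotent k (k[X] ⊗[k] L) (k[X] ⊗[k] L)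
  refine nilExp_affine_bch (F := fun n => (LieModule.lowerCentralSeries k (k[X] ⊗[k] L)
    (k[X] ⊗[k] L) n).toSubmodule) (N := N) ?_ ?_ ?_ ?_ ?_ x y
  · exact adLin_lie
  · intro x y
    rw [← adLin_apply (k := k) x y, ddt_adLin, adLin_apply (ddt k L x), ← lie_skew, ← sub_eq_add_neg,
      adLin_apply y]
  · simp
  · simp [hN]
  · exact fun x i => lcs_lowers _ x i

lemma eval_eq_of_gauge_eq {P Q : k[X] ⊗[k] L} (h : nilExp k (gaugeField P) = nilExp k (gaugeField Q))
    (h0 : evalAt k L 0 P = evalAt k L 0 Q) : evalAt k L 1 P = evalAt k L 1 Q := by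
  obtain ⟨N, hN⟩ := LieModule.IsNilpotent.nilpotent k (k[X] ⊗[k] L) (k[X] ⊗[k] L)
  set G : ℕ → Submodule k (k[X] ⊗[k] L) := fun n => (LieModule.lowerCentralSeries k (k[X] ⊗[k] L)
    (k[X] ⊗[k] L) n).toSubmodule with hG
  have hG0 : G 0 = ⊤ := by simp [hG]
  have hlow : ∀ (x : k[X] ⊗[k] L) i, ∀ v ∈ affineFiltration G i,
      gaugeField x v ∈ affineFiltration G (i + 1) :=
    fun x i v hv => affine_mem (F := G) hG0 (fun x i => lcs_lowers _ x i) x i v hv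
  have := nilExp_injective (F := affineFiltration G) (antitone_nat_of_succ_le fun n => ?_) rfl
    (N := N + 1) ?_ (hlow P) (hlow Q) h
  · refine evalAt_eq_of_ddt_eq ?_ h0
    have h1 := congrArg Prod.snd (LinearMap.congr_fun this (1, 0))
    simpa [gaugeField, affine_apply] using h1
  · cases n with
    | zero => exact le_top
    | succ n =>
      exact Submodule.prod_mono le_rfl (LieModule.antitone_lowerCentralSeries _ _ _ (Nat.le_succ n))
  · simp [affineFiltration, hG, hN, Submodule.prod_bot]

lemma evalAt_one_X (x : L) : evalAt k L 1 ((X : k[X]) ⊗ₜ x) = x := by simp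

lemma evalAt_zero_X (x : L) : evalAt k L 0 ((X : k[X]) ⊗ₜ x) = 0 := by simp

variable (k)

theorem bch_assoc (x y z : L) : bch k (bch k x y) z = bch k x (bch k y z) := by
  have := eval_eq_of_gauge_eq (k := k) (L := L)
    (P := bch k (bch k (X ⊗ₜ x) (X ⊗ₜ y)) (X ⊗ₜ z))
    (Q := bch k (X ⊗ₜ x) (bch k (X ⊗ₜ y) (X ⊗ₜ z)))
    (by simp only [gaugeField_bch, mul_assoc])
    (by simp only [bch_map, evalAt_zero_X, bch_zero_zero])
  simpa only [bch_map, evalAt_one_X] using this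

theorem bch_zero_left (x : L) : bch k 0 x = x := by
  have := eval_eq_of_gauge_eq (k := k) (L := L) (P := bch k 0 (X ⊗ₜ x)) (Q := X ⊗ₜ x)
    (by rw [gaugeField_bch, map_zero, nilExp_zero, one_mul])
    (by simp only [bch_map, evalAt_zero_X, map_zero, bch_zero_zero])
  simpa only [bch_map, evalAt_one_X, map_zero] using this

theorem bch_neg_left (x : L) : bch k (-x) x = 0 := by
  obtain ⟨N, hN⟩ := LieModule.IsNilpotent.nilpotent k (k[X] ⊗[k] L) (k[X] ⊗[k] L)
  have hn : IsNilpotent (gaugeField ((X : k[X]) ⊗ₜ[k] x)) :=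
    affine_isNilpotent (F := fun n => (LieModule.lowerCentralSeries k (k[X] ⊗[k] L)
      (k[X] ⊗[k] L) n).toSubmodule) (N := N) (by simp) (by simp [hN])
      (fun x i => lcs_lowers _ x i) _
  have := eval_eq_of_gauge_eq (k := k) (L := L) (P := bch k (-(X ⊗ₜ x)) (X ⊗ₜ x)) (Q := 0)
    (by rw [gaugeField_bch, map_neg, nilExp_neg_mul k hn, map_zero, nilExp_zero])
    (by simp only [bch_map, evalAt_zero_X, map_zero, map_neg, neg_zero, bch_zero_zero])
  simpa only [bch_map, evalAt_one_X, map_zero, map_neg] using this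

end Group

end BCH

/-- The group `exp(L)` of a nilpotent Lie algebra `L` over a field `k` of characteristic zero. Its
elements are the formal exponentials `exp x`, `x ∈ L`, and `exp x * exp y = exp (bch x y)`, where
`bch x y = log (exp x exp y)` is the Baker-Campbell-Hausdorff series. -/
@[ext]
structure ExpGroup (k L : Type*) where
  /-- The formal exponential of an element of `L`. -/
  exp ::
  /-- The logarithm. -/
  log : L

namespace ExpGroup

variable {k : Type*} [Field k] [CharZero k] {L : Type*} [LieRing L] [LieAlgebra k L]
  [LieRing.IsNilpotent L]

instance : Group (ExpGroup k L) :=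
  letI : Mul (ExpGroup k L) := ⟨fun g h => exp (BCH.bch k g.log h.log)⟩
  letI : One (ExpGroup k L) := ⟨exp 0⟩
  letI : Inv (ExpGroup k L) := ⟨fun g => exp (-g.log)⟩
  Group.ofLeftAxioms (fun a b c => ExpGroup.ext (BCH.bch_assoc k a.log b.log c.log))
    (fun a => ExpGroup.ext (BCH.bch_zero_left k a.log))
    (fun a => ExpGroup.ext (BCH.bch_neg_left k a.log))

lemma log_mul (g h : ExpGroup k L) : (g * h).log = BCH.bch k g.log h.log := rfl
lemma log_one : (1 : ExpGroup k L).log = 0 := rfl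
lemma log_inv (g : ExpGroup k L) : g⁻¹.log = -g.log := rfl

/-- The group homomorphism `exp(L) → exp(L')` induced by a Lie algebra homomorphism. -/
def map {L' : Type*} [LieRing L'] [LieAlgebra k L'] [LieRing.IsNilpotent L'] (φ : L →ₗ⁅k⁆ L') :
    ExpGroup k L →* ExpGroup k L' where
  toFun g := exp (φ g.log)
  map_one' := ExpGroup.ext (map_zero φ)
  map_mul' g h := ExpGroup.ext (BCH.bch_map φ g.log h.log)

lemma log_map {L' : Type*} [LieRing L'] [LieAlgebra k L'] [LieRing.IsNilpotent L']
    (φ : L →ₗ⁅k⁆ L') (g : ExpGroup k L) : (map φ g).log = φ g.log := rfl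

end ExpGroup


section InternalGrading

variable {k : Type*} [Field k] {V : Type*} [AddCommGroup V] [Module k V]

/-- The linear endomorphism of a graded vector space acting on the component of degree `i` as
multiplication by the scalar `c i`. -/
def gradedScale {deg : ℕ → Submodule k V} (h : DirectSum.IsInternal deg) (c : ℕ → k) : V →ₗ[k] V :=
  DirectSum.toModule k ℕ V (fun i => c i • (deg i).subtype) ∘ₗ
    (LinearEquiv.ofBijective (DirectSum.coeLinearMap deg) h).symm.toLinearMap

lemma gradedScale_of_mem {deg : ℕ → Submodule k V} (h : DirectSum.IsInternal deg) (c : ℕ → k)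
    {i : ℕ} {x : V} (hx : x ∈ deg i) : gradedScale h c x = c i • x := by
  have : (LinearEquiv.ofBijective (DirectSum.coeLinearMap deg) h).symm x =
      DirectSum.lof k ℕ (fun i => deg i) i ⟨x, hx⟩ := by
    rw [LinearEquiv.symm_apply_eq]
    exact (DirectSum.coeLinearMap_lof deg i ⟨x, hx⟩).symm
  simp [gradedScale, this]

lemma internal_induction {deg : ℕ → Submodule k V} (h : DirectSum.IsInternal deg) {p : V → Prop}
    (hom : ∀ i, ∀ x ∈ deg i, p x) (zero : p 0) (add : ∀ x y, p x → p y → p (x + y)) (x : V) :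
    p x := by
  have hx : x ∈ ⨆ i, deg i := by rw [h.submodule_iSup_eq_top]; trivial
  exact Submodule.iSup_induction deg (motive := p) hx hom zero add

/-- A criterion for a family of subspaces to be a grading. -/
lemma isInternal_of_eigen [CharZero k] {deg : ℕ → Submodule k V} (T : V →ₗ[k] V)
    (hT : ∀ i, ∀ x ∈ deg i, T x = (2 : k) ^ i • x) (htop : ⨆ i, deg i = ⊤) :
    DirectSum.IsInternal deg := by
  refine DirectSum.isInternal_submodule_of_iSupIndep_of_iSup_eq_top ?_ htop
  have hinj : Function.Injective fun i : ℕ => (2 : k) ^ i := by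
    intro i j hij
    have : ((2 ^ i : ℕ) : k) = ((2 ^ j : ℕ) : k) := by push_cast; exact hij
    exact Nat.pow_right_injective le_rfl (Nat.cast_injective this)
  refine ((Module.End.eigenspaces_iSupIndep T).comp hinj).mono fun i x hx => ?_
  exact Module.End.mem_eigenspace_iff.2 (hT i x hx)

end InternalGrading

/-- A commutative dg algebra over `k`, graded in non-negative degrees, with differential of
degree `1`. -/
structure CDGA (k : Type u) [Field k] where
  carrier : Type u
  [ring : Ring carrier]
  [algebra : Algebra k carrier]
  /-- The homogeneous component of a given degree. -/
  deg : ℕ → Submodule k carrier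
  isInternal : DirectSum.IsInternal deg
  one_mem : 1 ∈ deg 0
  mul_mem : ∀ {i j a b}, a ∈ deg i → b ∈ deg j → a * b ∈ deg (i + j)
  mul_comm : ∀ {i j a b}, a ∈ deg i → b ∈ deg j → a * b = (-1 : k) ^ (i * j) • (b * a)
  /-- The differential. -/
  d : carrier →ₗ[k] carrier
  d_mem : ∀ {i a}, a ∈ deg i → d a ∈ deg (i + 1)
  d_d : ∀ a, d (d a) = 0
  d_mul : ∀ {i a} (b), a ∈ deg i → d (a * b) = d a * b + (-1 : k) ^ i • (a * d b)

attribute [instance] CDGA.ring CDGA.algebra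

/-- A dg Lie algebra over `k`, graded in non-negative degrees, with differential of degree `1`. -/
structure DGLie (k : Type u) [Field k] where
  carrier : Type u
  [addCommGroup : AddCommGroup carrier]
  [module : Module k carrier]
  /-- The homogeneous component of a given degree. -/
  deg : ℕ → Submodule k carrier
  isInternal : DirectSum.IsInternal deg
  /-- The bracket. -/
  br : carrier →ₗ[k] carrier →ₗ[k] carrier
  br_mem : ∀ {i j x y}, x ∈ deg i → y ∈ deg j → br x y ∈ deg (i + j)
  br_skew : ∀ {i j x y}, x ∈ deg i → y ∈ deg j → br x y = -((-1 : k) ^ (i * j) • br y x)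
  jacobi : ∀ {i j x y} (z), x ∈ deg i → y ∈ deg j →
    br x (br y z) = br (br x y) z + (-1 : k) ^ (i * j) • br y (br x z)
  /-- The differential. -/
  d : carrier →ₗ[k] carrier
  d_mem : ∀ {i x}, x ∈ deg i → d x ∈ deg (i + 1)
  d_d : ∀ x, d (d x) = 0
  d_br : ∀ {i x} (y), x ∈ deg i → d (br x y) = br (d x) y + (-1 : k) ^ i • br x (d y)

attribute [instance] DGLie.addCommGroup DGLie.module

/-- Morphisms of commutative dg algebras. -/
@[ext]
structure CDGA.Hom {k : Type u} [Field k] (A B : CDGA k) where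
  toAlgHom : A.carrier →ₐ[k] B.carrier
  map_deg : ∀ {i a}, a ∈ A.deg i → toAlgHom a ∈ B.deg i
  map_d : ∀ a, toAlgHom (A.d a) = B.d (toAlgHom a)

/-- The identity morphism. -/
def CDGA.Hom.id {k : Type u} [Field k] (A : CDGA k) : CDGA.Hom A A :=
  ⟨AlgHom.id k A.carrier, fun h => h, fun _ => rfl⟩

/-- The composition of morphisms. -/
def CDGA.Hom.comp {k : Type u} [Field k] {A B C : CDGA k} (φ : CDGA.Hom B C) (ψ : CDGA.Hom A B) :
    CDGA.Hom A C where
  toAlgHom := φ.toAlgHom.comp ψ.toAlgHom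
  map_deg h := φ.map_deg (ψ.map_deg h)
  map_d a := by simp [ψ.map_d, φ.map_d]

namespace DGLie

variable {k : Type u} [Field k]

/-- Morphisms of dg Lie algebras. -/
@[ext]
structure Hom (g h : DGLie k) where
  toLinearMap : g.carrier →ₗ[k] h.carrier
  map_deg : ∀ {i x}, x ∈ g.deg i → toLinearMap x ∈ h.deg i
  map_br : ∀ x y, toLinearMap (g.br x y) = h.br (toLinearMap x) (toLinearMap y)
  map_d : ∀ x, toLinearMap (g.d x) = h.d (toLinearMap x)

/-- The identity morphism. -/
def Hom.id (g : DGLie k) : Hom g g := ⟨LinearMap.id, fun h => h, fun _ _ => rfl, fun _ => rfl⟩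

/-- The lower central series `g ⊇ [g, g] ⊇ [g, [g, g]] ⊇ ⋯`. -/
def lcs (g : DGLie k) : ℕ → Submodule k g.carrier
  | 0 => ⊤
  | n + 1 => Submodule.span k {z | ∃ x, ∃ y ∈ lcs g n, z = g.br x y}

/-- A dg Lie algebra is nilpotent if its lower central series vanishes from some point on. -/
class IsNilpotent (g : DGLie k) : Prop where
  exists_lcs_eq_bot : ∃ n, g.lcs n = ⊥

lemma br_mem_lcs (g : DGLie k) {n : ℕ} (x : g.carrier) {y : g.carrier} (hy : y ∈ g.lcs n) :
    g.br x y ∈ g.lcs (n + 1) := Submodule.subset_span ⟨x, y, hy, rfl⟩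

/-- The set of Maurer-Cartan elements: those `x` of degree `1` with `dx + 1/2 [x, x] = 0`. -/
def MC (g : DGLie k) : Set g.carrier :=
  {x | x ∈ g.deg 1 ∧ g.d x + (1 / 2 : k) • g.br x x = 0}

lemma Hom.map_mem_MC {g h : DGLie k} (f : Hom g h) {x : g.carrier} (hx : x ∈ g.MC) :
    f.toLinearMap x ∈ h.MC := by
  refine ⟨f.map_deg hx.1, ?_⟩
  rw [← f.map_d, ← f.map_br, ← map_smul, ← map_add, hx.2, map_zero]

/-- The map on Maurer-Cartan elements induced by a morphism. -/
def Hom.mapMC {g h : DGLie k} (f : Hom g h) (x : g.MC) : h.MC := ⟨f.toLinearMap x, f.map_mem_MC x.2⟩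

/-- The Lie algebra of elements of degree zero. -/
def Zero (g : DGLie k) : Type u := g.deg 0

namespace Zero

variable (g : DGLie k)

instance : AddCommGroup g.Zero := inferInstanceAs (AddCommGroup (g.deg 0))
instance : Module k g.Zero := inferInstanceAs (Module k (g.deg 0))

/-- The inclusion of the elements of degree zero. -/
def incl : g.Zero →ₗ[k] g.carrier := (g.deg 0).subtype

variable {g}

lemma incl_mem (x : g.Zero) : incl g x ∈ g.deg 0 := Subtype.property (p := (· ∈ g.deg 0)) x

lemma incl_injective : Function.Injective (incl g) := Subtype.val_injective

instance : Bracket g.Zero g.Zero :=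
  ⟨fun x y => (⟨g.br (incl g x) (incl g y), g.br_mem (incl_mem x) (incl_mem y)⟩ : g.deg 0)⟩

lemma incl_lie (x y : g.Zero) : incl g ⁅x, y⁆ = g.br (incl g x) (incl g y) := rfl

variable [CharZero k]

instance : LieRing g.Zero where
  add_lie x y z := incl_injective (by simp [incl_lie])
  lie_add x y z := incl_injective (by simp [incl_lie])
  lie_self x := incl_injective (by
    have h := g.br_skew (incl_mem x) (incl_mem x)
    rw [mul_zero, pow_zero, one_smul, eq_neg_iff_add_eq_zero, ← two_smul k] at h
    rw [incl_lie, map_zero]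
    exact (smul_eq_zero.1 h).resolve_left two_ne_zero)
  leibniz_lie x y z := incl_injective (by
    simp only [incl_lie, map_add]
    rw [g.jacobi _ (incl_mem x) (incl_mem y)]
    simp)

instance : LieAlgebra k g.Zero where
  lie_smul c x y := incl_injective (by simp [incl_lie])

instance [g.IsNilpotent] : LieRing.IsNilpotent g.Zero := by
  obtain ⟨N, hN⟩ := IsNilpotent.exists_lcs_eq_bot (g := g)
  have key : ∀ n, ∀ x ∈ LieModule.lowerCentralSeries k g.Zero g.Zero n, incl g x ∈ g.lcs n := by
    intro n
    induction n with
    | zero => intro x _; trivial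
    | succ n ih =>
      intro x hx
      rw [LieModule.lowerCentralSeries_succ, ← LieSubmodule.mem_toSubmodule,
        LieSubmodule.lieIdeal_oper_eq_linear_span'] at hx
      induction hx using Submodule.span_induction with
      | mem w hw =>
        obtain ⟨a, -, b, hb, rfl⟩ := hw
        exact g.br_mem_lcs _ (ih b hb)
      | zero => rw [map_zero]; exact zero_mem _
      | add a b _ _ ha hb => rw [map_add]; exact add_mem ha hb
      | smul c a _ ha => rw [map_smul]; exact Submodule.smul_mem _ c ha
  refine (LieModule.isNilpotent_iff k g.Zero g.Zero).2 ⟨N, ?_⟩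
  rw [eq_bot_iff]
  intro x hx
  have := key N x hx
  rw [hN, Submodule.mem_bot] at this
  have h0 : x = 0 := incl_injective (by rw [this, map_zero])
  rw [h0]
  exact zero_mem _

/-- The Lie algebra homomorphism induced by a morphism of dg Lie algebras. -/
def map {g h : DGLie k} (f : Hom g h) : g.Zero →ₗ⁅k⁆ h.Zero where
  toFun x := (⟨f.toLinearMap (incl g x), f.map_deg (incl_mem x)⟩ : h.deg 0)
  map_add' x y := incl_injective (by
    change f.toLinearMap _ = f.toLinearMap _ + f.toLinearMap _
    rw [map_add, map_add])
  map_smul' c x := incl_injective (by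
    change f.toLinearMap _ = c • f.toLinearMap _
    rw [map_smul, map_smul])
  map_lie' {x y} := incl_injective (f.map_br (incl g x) (incl g y))

lemma incl_map {g h : DGLie k} (f : Hom g h) (x : g.Zero) :
    incl h (map f x) = f.toLinearMap (incl g x) := rfl

end Zero

end DGLie

lemma neg_one_pow_congr' {k : Type*} [Field k] {m n : ℕ} (h : Even m ↔ Even n) :
    (-1 : k) ^ m = (-1) ^ n := by
  rcases Nat.even_or_odd m with hm | hm
  · rw [hm.neg_one_pow, (h.1 hm).neg_one_pow]
  · rw [hm.neg_one_pow, (Nat.not_even_iff_odd.1 fun hn => Nat.not_even_iff_odd.2 hm (h.2 hn)).neg_one_pow]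

namespace DGLie

open TensorProduct

section Tensor

variable {k : Type u} [Field k] (A : CDGA k) (g : DGLie k)

/-- The component of degree `n` of `A ⊗ g`. -/
def tensorDeg (n : ℕ) : Submodule k (A.carrier ⊗[k] g.carrier) :=
  Submodule.span k {t | ∃ i j a x, i + j = n ∧ a ∈ A.deg i ∧ x ∈ g.deg j ∧ t = a ⊗ₜ[k] x}

/-- The differential of `A ⊗ g`: `d (a ⊗ x) = da ⊗ x + (-1)^|a| a ⊗ dx`. -/
def tensorD : A.carrier ⊗[k] g.carrier →ₗ[k] A.carrier ⊗[k] g.carrier :=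
  TensorProduct.map A.d LinearMap.id +
    TensorProduct.map (gradedScale A.isInternal fun i => (-1) ^ i) g.d

/-- The bracket of `A ⊗ g`: `[a ⊗ x, b ⊗ y] = (-1)^(|x| |b|) ab ⊗ [x, y]`. It is the sum of two
terms, given by the even and by the odd component of `b`. -/
def tensorBr : A.carrier ⊗[k] g.carrier →ₗ[k] A.carrier ⊗[k] g.carrier →ₗ[k]
    A.carrier ⊗[k] g.carrier :=
  TensorProduct.map₂ ((LinearMap.mul k A.carrier).compl₂
      (gradedScale A.isInternal fun i => if Even i then 1 else 0)) g.br +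
    TensorProduct.map₂ ((LinearMap.mul k A.carrier).compl₂
      (gradedScale A.isInternal fun i => if Even i then 0 else 1))
        (g.br ∘ₗ gradedScale g.isInternal fun j => (-1) ^ j)

variable {A g}

lemma tensorD_tmul {i : ℕ} {a : A.carrier} (ha : a ∈ A.deg i) (x : g.carrier) :
    tensorD A g (a ⊗ₜ x) = A.d a ⊗ₜ x + (-1 : k) ^ i • a ⊗ₜ g.d x := by
  simp [tensorD, gradedScale_of_mem A.isInternal _ ha, TensorProduct.smul_tmul']

lemma tensorBr_tmul' (a b : A.carrier) (x y : g.carrier) :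
    tensorBr A g (a ⊗ₜ x) (b ⊗ₜ y) =
      (a * gradedScale A.isInternal (fun i => if Even i then 1 else 0) b) ⊗ₜ g.br x y +
      (a * gradedScale A.isInternal (fun i => if Even i then 0 else 1) b) ⊗ₜ
        g.br (gradedScale g.isInternal (fun j => (-1) ^ j) x) y := by
  simp [tensorBr]

lemma tensorBr_tmul (a : A.carrier) {i : ℕ} {b : A.carrier} (hb : b ∈ A.deg i) {j : ℕ}
    {x : g.carrier} (hx : x ∈ g.deg j) (y : g.carrier) :
    tensorBr A g (a ⊗ₜ x) (b ⊗ₜ y) = (-1 : k) ^ (j * i) • (a * b) ⊗ₜ g.br x y := by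
  rw [tensorBr_tmul', gradedScale_of_mem A.isInternal _ hb, gradedScale_of_mem A.isInternal _ hb,
    gradedScale_of_mem g.isInternal _ hx]
  rcases Nat.even_or_odd i with hi | hi
  · simp [hi, hi.mul_left j]
  · rw [if_neg (Nat.not_even_iff_odd.2 hi), if_neg (Nat.not_even_iff_odd.2 hi)]
    have : (-1 : k) ^ (j * i) = (-1) ^ j := neg_one_pow_congr' (by
      rw [Nat.even_mul]; have := Nat.not_even_iff_odd.2 hi; tauto)
    simp [this]

lemma tmul_mem {i j n : ℕ} {a : A.carrier} {x : g.carrier} (ha : a ∈ A.deg i) (hx : x ∈ g.deg j)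
    (h : i + j = n) : a ⊗ₜ[k] x ∈ tensorDeg A g n :=
  Submodule.subset_span ⟨i, j, a, x, h, ha, hx, rfl⟩

lemma tensorDeg_induction {n : ℕ} {p : A.carrier ⊗[k] g.carrier → Prop}
    (hom : ∀ i j a x, i + j = n → a ∈ A.deg i → x ∈ g.deg j → p (a ⊗ₜ x)) (zero : p 0)
    (add : ∀ x y, p x → p y → p (x + y)) (smul : ∀ (c : k) x, p x → p (c • x))
    {z : A.carrier ⊗[k] g.carrier} (hz : z ∈ tensorDeg A g n) : p z := by
  induction hz using Submodule.span_induction with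
  | mem z hz => obtain ⟨i, j, a, x, h, ha, hx, rfl⟩ := hz; exact hom i j a x h ha hx
  | zero => exact zero
  | add x y _ _ hx hy => exact add x y hx hy
  | smul c x _ hx => exact smul c x hx

lemma tensor_induction {p : A.carrier ⊗[k] g.carrier → Prop}
    (hom : ∀ i j a x, a ∈ A.deg i → x ∈ g.deg j → p (a ⊗ₜ x)) (zero : p 0)
    (add : ∀ x y, p x → p y → p (x + y)) (z : A.carrier ⊗[k] g.carrier) : p z := by
  induction z using TensorProduct.induction_on with
  | zero => exact zero
  | add x y hx hy => exact add x y hx hy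
  | tmul a x =>
    refine internal_induction A.isInternal (p := fun a => p (a ⊗ₜ x)) (fun i a ha => ?_) ?_ ?_ a
    · refine internal_induction g.isInternal (p := fun x => p (a ⊗ₜ x)) (fun j x hx => ?_) ?_ ?_ x
      · exact hom i j a x ha hx
      · rw [tmul_zero]; exact zero
      · intro x y hx hy; rw [tmul_add]; exact add _ _ hx hy
    · rw [zero_tmul]; exact zero
    · intro x y hx hy; rw [add_tmul]; exact add _ _ hx hy

lemma tensorD_mem {n : ℕ} {z : A.carrier ⊗[k] g.carrier} (hz : z ∈ tensorDeg A g n) :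
    tensorD A g z ∈ tensorDeg A g (n + 1) := by
  refine tensorDeg_induction (p := fun z => tensorD A g z ∈ tensorDeg A g (n + 1)) ?_ ?_ ?_ ?_ hz
  · intro i j a x h ha hx
    rw [tensorD_tmul ha]
    exact add_mem (tmul_mem (A.d_mem ha) hx (by omega))
      (Submodule.smul_mem _ _ (tmul_mem ha (g.d_mem hx) (by omega)))
  · rw [map_zero]; exact zero_mem _
  · intro x y hx hy; rw [map_add]; exact add_mem hx hy
  · intro c x hx; rw [map_smul]; exact Submodule.smul_mem _ c hx

lemma tensorD_tensorD (z : A.carrier ⊗[k] g.carrier) : tensorD A g (tensorD A g z) = 0 := by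
  refine tensor_induction (p := fun z => tensorD A g (tensorD A g z) = 0) ?_ ?_ ?_ z
  · intro i j a x ha hx
    rw [tensorD_tmul ha, map_add, map_smul, tensorD_tmul ha, tensorD_tmul (A.d_mem ha), A.d_d,
      g.d_d, pow_succ, tmul_zero, zero_tmul, smul_zero, add_zero, zero_add, mul_neg_one, ← add_smul,
      neg_add_cancel, zero_smul]
  · simp
  · intro x y hx hy; rw [map_add, map_add, hx, hy, add_zero]

lemma tensorBr_mem {m n : ℕ} {y z : A.carrier ⊗[k] g.carrier} (hy : y ∈ tensorDeg A g m)
    (hz : z ∈ tensorDeg A g n) : tensorBr A g y z ∈ tensorDeg A g (m + n) := by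
  refine tensorDeg_induction (p := fun y => tensorBr A g y z ∈ tensorDeg A g (m + n)) ?_ ?_ ?_ ?_ hy
  · intro i j a x h ha hx
    refine tensorDeg_induction
      (p := fun z => tensorBr A g (a ⊗ₜ x) z ∈ tensorDeg A g (m + n)) ?_ ?_ ?_ ?_ hz
    · intro i' j' b y h' hb hy
      rw [tensorBr_tmul a hb hx]
      exact Submodule.smul_mem _ _ (tmul_mem (A.mul_mem ha hb) (g.br_mem hx hy) (by omega))
    · rw [map_zero]; exact zero_mem _
    · intro x y hx hy; rw [map_add]; exact add_mem hx hy
    · intro c x hx; rw [map_smul]; exact Submodule.smul_mem _ c hx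
  · rw [map_zero]; exact zero_mem _
  · intro x y hx hy; rw [map_add]; exact add_mem hx hy
  · intro c x hx; rw [map_smul]; exact Submodule.smul_mem _ c hx

lemma tensorBr_skew {m n : ℕ} {y z : A.carrier ⊗[k] g.carrier} (hy : y ∈ tensorDeg A g m)
    (hz : z ∈ tensorDeg A g n) :
    tensorBr A g y z = -((-1 : k) ^ (m * n) • tensorBr A g z y) := by
  refine tensorDeg_induction
    (p := fun y => tensorBr A g y z = -((-1 : k) ^ (m * n) • tensorBr A g z y)) ?_ ?_ ?_ ?_ hy
  · intro i j a x h ha hx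
    refine tensorDeg_induction (p := fun z => tensorBr A g (a ⊗ₜ x) z =
      -((-1 : k) ^ (m * n) • tensorBr A g z (a ⊗ₜ x))) ?_ ?_ ?_ ?_ hz
    · intro i' j' b y h' hb hy
      rw [tensorBr_tmul a hb hx, tensorBr_tmul b ha hy, A.mul_comm ha hb, g.br_skew hx hy]
      simp only [tmul_neg, tmul_smul, ← smul_tmul', smul_neg, smul_smul, ← pow_add]
      rw [neg_one_pow_congr']
      subst h h'
      simp only [Nat.even_add, Nat.even_mul]
      tauto
    · simp
    · intro x y hx hy; simp only [map_add, LinearMap.add_apply, hx, hy, smul_add, neg_add]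
    · intro c x hx
      simp only [map_smul, LinearMap.smul_apply, hx, smul_neg]
      rw [smul_comm]
  · simp
  · intro x y hx hy; simp only [map_add, LinearMap.add_apply, hx, hy, smul_add, neg_add]
  · intro c x hx
    simp only [map_smul, LinearMap.smul_apply, hx, smul_neg]
    rw [smul_comm]

lemma tensor_jacobi_hom {i j i' j' i'' : ℕ} {a b c : A.carrier} {u v w : g.carrier}
    (ha : a ∈ A.deg i) (hu : u ∈ g.deg j) (hb : b ∈ A.deg i') (hv : v ∈ g.deg j')
    (hc : c ∈ A.deg i'') :
    tensorBr A g (a ⊗ₜ u) (tensorBr A g (b ⊗ₜ v) (c ⊗ₜ w)) =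
      tensorBr A g (tensorBr A g (a ⊗ₜ u) (b ⊗ₜ v)) (c ⊗ₜ w) +
        (-1 : k) ^ ((i + j) * (i' + j')) •
          tensorBr A g (b ⊗ₜ v) (tensorBr A g (a ⊗ₜ u) (c ⊗ₜ w)) := by
  have e1 : (-1 : k) ^ (j' * i'' + j * (i' + i'')) = (-1) ^ (j * i' + (j + j') * i'') :=
    congrArg _ (by ring)
  have e2 : (-1 : k) ^ (j' * i'' + j * (i' + i'') + j * j') =
      (-1) ^ ((i + j) * (i' + j') + (j * i'' + (j' * (i + i'') + i' * i))) := by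
    rw [show (i + j) * (i' + j') + (j * i'' + (j' * (i + i'') + i' * i)) =
      (j' * i'' + j * (i' + i'') + j * j') + 2 * (i * i' + i * j') by ring, pow_add _ _ (2 * _),
      pow_mul (-1 : k) 2]
    simp
  have hba : b * (a * c) = (-1 : k) ^ (i' * i) • (a * b * c) := by
    rw [← mul_assoc, A.mul_comm hb ha, smul_mul_assoc]
  rw [tensorBr_tmul b hc hv, tensorBr_tmul a hb hu, tensorBr_tmul a hc hu, map_smul, map_smul,
    map_smul, LinearMap.smul_apply, tensorBr_tmul a (A.mul_mem hb hc) hu,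
    tensorBr_tmul (a * b) hc (g.br_mem hu hv), tensorBr_tmul b (A.mul_mem ha hc) hv,
    g.jacobi w hu hv, ← mul_assoc, hba, tmul_add, tmul_smul, ← smul_tmul', smul_add, smul_add,
    smul_smul, smul_smul, smul_smul, smul_smul, smul_smul, smul_smul, smul_smul]
  simp only [← pow_add]
  rw [e1]
  congr 2
  rw [e2]
  simp only [add_assoc]

lemma tensor_jacobi {m n : ℕ} {x y : A.carrier ⊗[k] g.carrier} (z) (hx : x ∈ tensorDeg A g m)
    (hy : y ∈ tensorDeg A g n) :
    tensorBr A g x (tensorBr A g y z) = tensorBr A g (tensorBr A g x y) z +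
      (-1 : k) ^ (m * n) • tensorBr A g y (tensorBr A g x z) := by
  refine tensorDeg_induction (p := fun x => tensorBr A g x (tensorBr A g y z) =
    tensorBr A g (tensorBr A g x y) z +
      (-1 : k) ^ (m * n) • tensorBr A g y (tensorBr A g x z)) ?_ ?_ ?_ ?_ hx
  · intro i j a u h ha hu
    refine tensorDeg_induction (p := fun y => tensorBr A g (a ⊗ₜ u) (tensorBr A g y z) =
      tensorBr A g (tensorBr A g (a ⊗ₜ u) y) z +
        (-1 : k) ^ (m * n) • tensorBr A g y (tensorBr A g (a ⊗ₜ u) z)) ?_ ?_ ?_ ?_ hy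
    · intro i' j' b v h' hb hv
      refine tensor_induction (p := fun z =>
        tensorBr A g (a ⊗ₜ u) (tensorBr A g (b ⊗ₜ v) z) =
          tensorBr A g (tensorBr A g (a ⊗ₜ u) (b ⊗ₜ v)) z +
        (-1 : k) ^ (m * n) • tensorBr A g (b ⊗ₜ v) (tensorBr A g (a ⊗ₜ u) z)) ?_ ?_ ?_ z
      · intro i'' j'' c w hc hw
        subst h h'
        exact tensor_jacobi_hom ha hu hb hv hc
      · simp
      · intro x y hx hy
        simp only [map_add, hx, hy, smul_add]
        abel
    · simp
    · intro x y hx hy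
      simp only [map_add, LinearMap.add_apply, hx, hy, smul_add]
      abel
    · intro c x hx
      simp only [map_smul, LinearMap.smul_apply, hx, smul_add]
      rw [smul_comm c]
  · simp
  · intro x y hx hy
    simp only [map_add, LinearMap.add_apply, hx, hy, smul_add]
    abel
  · intro c x hx
    simp only [map_smul, LinearMap.smul_apply, hx, smul_add]
    rw [smul_comm c]

lemma tensorD_br {m : ℕ} {x : A.carrier ⊗[k] g.carrier} (z) (hx : x ∈ tensorDeg A g m) :
    tensorD A g (tensorBr A g x z) = tensorBr A g (tensorD A g x) z +
      (-1 : k) ^ m • tensorBr A g x (tensorD A g z) := by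
  refine tensorDeg_induction (p := fun x => tensorD A g (tensorBr A g x z) =
    tensorBr A g (tensorD A g x) z + (-1 : k) ^ m • tensorBr A g x (tensorD A g z)) ?_ ?_ ?_ ?_ hx
  · intro i j a u h ha hu
    refine tensor_induction (p := fun z => tensorD A g (tensorBr A g (a ⊗ₜ u) z) =
      tensorBr A g (tensorD A g (a ⊗ₜ u)) z +
        (-1 : k) ^ m • tensorBr A g (a ⊗ₜ u) (tensorD A g z)) ?_ ?_ ?_ z
    · intro i' j' b v hb hv
      rw [tensorBr_tmul a hb hu, map_smul, tensorD_tmul (A.mul_mem ha hb), tensorD_tmul ha,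
        tensorD_tmul hb, A.d_mul b ha, g.d_br v hu]
      simp only [map_add, LinearMap.add_apply, map_smul, LinearMap.smul_apply]
      rw [tensorBr_tmul _ hb hu, tensorBr_tmul _ hb (g.d_mem hu), tensorBr_tmul _ (A.d_mem hb) hu,
        tensorBr_tmul _ hb hu]
      simp only [tmul_add, add_tmul, tmul_smul, ← smul_tmul', smul_add, smul_smul, ← pow_add]
      subst h
      have e1 : (-1 : k) ^ (j * i' + i) = (-1) ^ (i + j + j * (i' + 1)) := neg_one_pow_congr' (by
        simp only [Nat.even_add, Nat.even_mul, Nat.not_even_one]; tauto)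
      have e2 : (-1 : k) ^ (j * i' + (i + i')) = (-1) ^ (i + (j + 1) * i') :=
        neg_one_pow_congr' (by
          simp only [Nat.even_add, Nat.even_mul, Nat.not_even_one]; tauto)
      have e3 : (-1 : k) ^ (j * i' + (i + i' + j)) = (-1) ^ (i + j + (i' + j * i')) :=
        neg_one_pow_congr' (by
          simp only [Nat.even_add, Nat.even_mul]; tauto)
      rw [e1, e2, e3]
      abel
    · simp
    · intro x y hx hy
      simp only [map_add, hx, hy, smul_add]
      abel
  · simp
  · intro x y hx hy
    simp only [map_add, LinearMap.add_apply, hx, hy, smul_add]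
    abel
  · intro c x hx
    simp only [map_smul, LinearMap.smul_apply, hx, smul_add]
    rw [smul_comm c]

variable [CharZero k]

lemma tensorDeg_isInternal : DirectSum.IsInternal (tensorDeg A g) := by
  refine isInternal_of_eigen (TensorProduct.map (gradedScale A.isInternal fun i => 2 ^ i)
    (gradedScale g.isInternal fun i => 2 ^ i)) (fun n z hz => ?_) ?_
  · refine tensorDeg_induction (p := fun z => TensorProduct.map _ _ z = (2 : k) ^ n • z)
      ?_ ?_ ?_ ?_ hz
    · intro i j a x h ha hx
      rw [TensorProduct.map_tmul, gradedScale_of_mem A.isInternal _ ha,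
        gradedScale_of_mem g.isInternal _ hx, ← h, pow_add, tmul_smul, ← smul_tmul', smul_smul,
        mul_comm]
    · simp
    · intro x y hx hy; rw [map_add, hx, hy, smul_add]
    · intro c x hx; rw [map_smul, hx, smul_comm]
  · rw [eq_top_iff]
    intro z _
    refine tensor_induction (p := fun z => z ∈ ⨆ i, tensorDeg A g i) ?_ (zero_mem _)
      (fun _ _ => add_mem) z
    intro i j a x ha hx
    exact Submodule.mem_iSup_of_mem (i + j) (tmul_mem ha hx rfl)

variable (A g) in
/-- The tensor product of a commutative dg algebra and a dg Lie algebra. -/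
def tensor : DGLie k where
  carrier := A.carrier ⊗[k] g.carrier
  deg := tensorDeg A g
  isInternal := tensorDeg_isInternal
  br := tensorBr A g
  br_mem := tensorBr_mem
  br_skew := tensorBr_skew
  jacobi := tensor_jacobi
  d := tensorD A g
  d_mem := tensorD_mem
  d_d := tensorD_tensorD
  d_br := tensorD_br

lemma tensorBr_mem_span (n : ℕ) (x : A.carrier ⊗[k] g.carrier) {y : A.carrier ⊗[k] g.carrier}
    (hy : y ∈ Submodule.span k {t | ∃ a x, x ∈ g.lcs n ∧ t = a ⊗ₜ[k] x}) :
    tensorBr A g x y ∈ Submodule.span k {t | ∃ a x, x ∈ g.lcs (n + 1) ∧ t = a ⊗ₜ[k] x} := by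
  induction hy using Submodule.span_induction with
  | zero => rw [map_zero]; exact zero_mem _
  | add u v _ _ hu hv => rw [map_add]; exact add_mem hu hv
  | smul c u _ hu => rw [map_smul]; exact Submodule.smul_mem _ c hu
  | mem y hy' =>
    obtain ⟨b, v, hv, rfl⟩ := hy'
    induction x using TensorProduct.induction_on with
    | zero => rw [map_zero]; exact zero_mem _
    | add u v hu hv => rw [map_add]; exact add_mem hu hv
    | tmul a u =>
      rw [tensorBr_tmul']
      exact add_mem (Submodule.subset_span ⟨_, _, g.br_mem_lcs _ hv, rfl⟩)
        (Submodule.subset_span ⟨_, _, g.br_mem_lcs _ hv, rfl⟩)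

instance [g.IsNilpotent] : (tensor A g).IsNilpotent := by
  obtain ⟨N, hN⟩ := IsNilpotent.exists_lcs_eq_bot (g := g)
  have key : ∀ n, ∀ z ∈ (tensor A g).lcs n,
      z ∈ Submodule.span k {t | ∃ a x, x ∈ g.lcs n ∧ t = a ⊗ₜ[k] x} := by
    intro n
    induction n with
    | zero =>
      intro z _
      induction z using TensorProduct.induction_on with
      | zero => exact zero_mem _
      | add x y hx hy => exact add_mem (hx trivial) (hy trivial)
      | tmul a x => exact Submodule.subset_span ⟨a, x, trivial, rfl⟩
    | succ n ih =>
      intro z hz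
      induction hz using Submodule.span_induction with
      | zero => exact zero_mem _
      | add x y _ _ hx hy => exact add_mem hx hy
      | smul c x _ hx => exact Submodule.smul_mem _ c hx
      | mem z hz =>
        obtain ⟨x, y, hy, rfl⟩ := hz
        exact tensorBr_mem_span n x (ih y hy)
  refine ⟨N, ?_⟩
  rw [eq_bot_iff]
  intro z hz
  have := key N z hz
  rw [hN] at this
  refine Submodule.span_le.2 ?_ this
  rintro _ ⟨a, x, hx, rfl⟩
  rw [Submodule.mem_bot] at hx
  rw [hx, tmul_zero]
  exact zero_mem _

end Tensor

end DGLie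

namespace DGLie

open TensorProduct CategoryTheory

section TensorMap

variable {k : Type u} [Field k] [CharZero k]

/-- The composition of morphisms. -/
def Hom.comp {g h l : DGLie k} (f : Hom h l) (f' : Hom g h) : Hom g l where
  toLinearMap := f.toLinearMap ∘ₗ f'.toLinearMap
  map_deg hx := f.map_deg (f'.map_deg hx)
  map_br x y := by simp [f'.map_br, f.map_br]
  map_d x := by simp [f'.map_d, f.map_d]

/-- The morphism `φ ⊗ f : A ⊗ g → B ⊗ h`. -/
def tensorMap {A B : CDGA k} {g h : DGLie k} (φ : CDGA.Hom A B) (f : Hom g h) :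
    Hom (tensor A g) (tensor B h) where
  toLinearMap := TensorProduct.map φ.toAlgHom.toLinearMap f.toLinearMap
  map_deg {i x} hx := by
    refine tensorDeg_induction (p := fun x => TensorProduct.map _ _ x ∈ tensorDeg B h i)
      ?_ ?_ ?_ ?_ hx
    · intro i j a x e ha hx
      exact tmul_mem (φ.map_deg ha) (f.map_deg hx) e
    · rw [map_zero]; exact zero_mem _
    · intro x y hx hy; rw [map_add]; exact add_mem hx hy
    · intro c x hx; rw [map_smul]; exact Submodule.smul_mem _ c hx
  map_br := fun (x y : A.carrier ⊗[k] g.carrier) => by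
    change TensorProduct.map _ _ (tensorBr A g x y) =
      tensorBr B h (TensorProduct.map _ _ x) (TensorProduct.map _ _ y)
    refine tensor_induction (p := fun x => TensorProduct.map _ _ (tensorBr A g x y) =
      tensorBr B h (TensorProduct.map _ _ x) (TensorProduct.map _ _ y)) ?_ ?_ ?_ x
    · intro i j a x ha hx
      refine tensor_induction (p := fun y => TensorProduct.map _ _ (tensorBr A g (a ⊗ₜ x) y) =
        tensorBr B h (TensorProduct.map _ _ (a ⊗ₜ x)) (TensorProduct.map _ _ y)) ?_ ?_ ?_ y
      · intro i' j' b y hb hy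
        rw [tensorBr_tmul a hb hx, map_smul, map_tmul, map_tmul, map_tmul]
        change _ = tensorBr B h (φ.toAlgHom a ⊗ₜ f.toLinearMap x) (φ.toAlgHom b ⊗ₜ f.toLinearMap y)
        rw [tensorBr_tmul _ (φ.map_deg hb) (f.map_deg hx), f.map_br]
        simp
      · simp
      · intro x y hx hy; simp only [map_add, hx, hy]
    · simp
    · intro x y hx hy; simp only [map_add, LinearMap.add_apply, hx, hy]
  map_d x := by
    change TensorProduct.map _ _ (tensorD A g x) = tensorD B h (TensorProduct.map _ _ x)
    refine tensor_induction (p := fun x => TensorProduct.map _ _ (tensorD A g x) =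
      tensorD B h (TensorProduct.map _ _ x)) ?_ ?_ ?_ x
    · intro i j a x ha hx
      rw [tensorD_tmul ha, map_add, map_smul, map_tmul, map_tmul, map_tmul]
      change _ = tensorD B h (φ.toAlgHom a ⊗ₜ f.toLinearMap x)
      rw [tensorD_tmul (φ.map_deg ha), f.map_d]
      simp [φ.map_d]
    · simp
    · intro x y hx hy; simp only [map_add, hx, hy]

lemma tensorMap_id (A : CDGA k) (g : DGLie k) :
    tensorMap (CDGA.Hom.id A) (Hom.id g) = Hom.id (tensor A g) := by
  refine Hom.ext ?_
  have h := TensorProduct.map_id (R := k) (M := A.carrier) (N := g.carrier)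
  exact h

lemma tensorMap_comp {A B C : CDGA k} {g h l : DGLie k} (φ : CDGA.Hom B C) (ψ : CDGA.Hom A B)
    (f : Hom h l) (f' : Hom g h) :
    tensorMap (φ.comp ψ) (f.comp f') = (tensorMap φ f).comp (tensorMap ψ f') := by
  refine Hom.ext ?_
  have h := TensorProduct.map_comp φ.toAlgHom.toLinearMap f.toLinearMap ψ.toAlgHom.toLinearMap
    f'.toLinearMap
  exact h

/-- The morphism `g → A ⊗ g`, `x ↦ 1 ⊗ x`. -/
def const (A : CDGA k) (g : DGLie k) : Hom g (tensor A g) where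
  toLinearMap := TensorProduct.mk k A.carrier g.carrier 1
  map_deg hx := tmul_mem A.one_mem hx (zero_add _)
  map_br x y := by
    change (1 : A.carrier) ⊗ₜ[k] g.br x y = tensorBr A g (1 ⊗ₜ x) (1 ⊗ₜ y)
    refine internal_induction g.isInternal
      (p := fun x => (1 : A.carrier) ⊗ₜ[k] g.br x y = tensorBr A g (1 ⊗ₜ x) (1 ⊗ₜ y)) ?_ ?_ ?_ x
    · intro i x hx
      rw [tensorBr_tmul _ A.one_mem hx]
      simp
    · simp
    · intro x y hx hy; simp only [map_add, tmul_add, LinearMap.add_apply, hx, hy]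
  map_d x := by
    change (1 : A.carrier) ⊗ₜ[k] g.d x = tensorD A g (1 ⊗ₜ x)
    have h1 : A.d 1 = 0 := by
      have := A.d_mul 1 A.one_mem
      simpa using this
    rw [tensorD_tmul A.one_mem, h1]
    simp

/-- The morphism `A ⊗ g → g`, `a ⊗ x ↦ ε(a) x`, defined by an augmentation `ε : A → k`. -/
def augment {A : CDGA k} (ε : A.carrier →ₐ[k] k) (hε : ∀ i, ∀ a ∈ A.deg (i + 1), ε a = 0)
    (g : DGLie k) : Hom (tensor A g) g where
  toLinearMap := TensorProduct.lift (LinearMap.lsmul k g.carrier ∘ₗ ε.toLinearMap)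
  map_deg {n x} hx := by
    refine tensorDeg_induction (p := fun x => TensorProduct.lift _ x ∈ g.deg n) ?_ ?_ ?_ ?_ hx
    · intro i j a x e ha hx
      rw [lift.tmul]
      change ε a • x ∈ _
      cases i with
      | zero => rw [← e, zero_add]; exact Submodule.smul_mem _ _ hx
      | succ i => rw [hε i a ha, zero_smul]; exact zero_mem _
    · rw [map_zero]; exact zero_mem _
    · intro x y hx hy; rw [map_add]; exact add_mem hx hy
    · intro c x hx; rw [map_smul]; exact Submodule.smul_mem _ c hx
  map_br := fun (x y : A.carrier ⊗[k] g.carrier) => by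
    change TensorProduct.lift _ (tensorBr A g x y) =
      g.br (TensorProduct.lift _ x) (TensorProduct.lift _ y)
    refine tensor_induction (p := fun x => TensorProduct.lift _ (tensorBr A g x y) =
      g.br (TensorProduct.lift _ x) (TensorProduct.lift _ y)) ?_ ?_ ?_ x
    · intro i j a x ha hx
      refine tensor_induction (p := fun y => TensorProduct.lift _ (tensorBr A g (a ⊗ₜ x) y) =
        g.br (TensorProduct.lift _ (a ⊗ₜ x)) (TensorProduct.lift _ y)) ?_ ?_ ?_ y
      · intro i' j' b y hb hy
        rw [tensorBr_tmul a hb hx, map_smul, lift.tmul, lift.tmul, lift.tmul]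
        change _ • ε (a * b) • g.br x y = g.br (ε a • x) (ε b • y)
        cases i' with
        | zero => simp [smul_smul, mul_comm]
        | succ i' => rw [map_mul, hε i' b hb]; simp
      · simp
      · intro x y hx hy; simp only [map_add, hx, hy]
    · simp
    · intro x y hx hy; simp only [map_add, LinearMap.add_apply, hx, hy]
  map_d x := by
    change TensorProduct.lift _ (tensorD A g x) = g.d (TensorProduct.lift _ x)
    refine tensor_induction (p := fun x => TensorProduct.lift _ (tensorD A g x) =
      g.d (TensorProduct.lift _ x)) ?_ ?_ ?_ x
    · intro i j a x ha hx
      rw [tensorD_tmul ha, map_add, map_smul, lift.tmul, lift.tmul, lift.tmul]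
      change ε (A.d a) • x + _ • ε a • g.d x = g.d (ε a • x)
      rw [hε i _ (A.d_mem ha), zero_smul, zero_add, map_smul]
      cases i with
      | zero => simp
      | succ i => rw [hε i a ha]; simp
    · simp
    · intro x y hx hy; simp only [map_add, hx, hy]

end TensorMap

section Gauge

variable {k : Type u} [Field k]

/-- The affine vector field `ρ(y)(x) = dy + [x, y]` on `g`, for `y` of degree zero, as the linear
endomorphism `(s, x) ↦ (0, s dy + [x, y])` of `k × g`, where `g` is identified with `{1} × g`. -/
def gaugeField (g : DGLie k) (y : g.Zero) : Module.End k (k × g.carrier) :=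
  LinearMap.inr k k g.carrier ∘ₗ
    LinearMap.coprod (LinearMap.toSpanSingleton k g.carrier (g.d (Zero.incl g y)))
      (g.br.flip (Zero.incl g y))

lemma gaugeField_apply (g : DGLie k) (y : g.Zero) (p : k × g.carrier) :
    gaugeField g y p = (0, p.1 • g.d (Zero.incl g y) + g.br p.2 (Zero.incl g y)) := by
  simp [gaugeField]

/-- The action of `exp y` on `g` is the exponential of the affine vector field `ρ(y)`. -/
def gauge {g : DGLie k} (γ : ExpGroup k g.Zero) (x : g.carrier) : g.carrier :=
  (nilExp k (gaugeField g γ.log) (1, x)).2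

lemma br_zero_skew (g : DGLie k) (y : g.Zero) (x : g.carrier) :
    g.br x (Zero.incl g y) = -g.br (Zero.incl g y) x := by
  refine internal_induction g.isInternal
    (p := fun x => g.br x (Zero.incl g y) = -g.br (Zero.incl g y) x) ?_ ?_ ?_ x
  · intro i x hx
    have := g.br_skew hx (Zero.incl_mem y)
    simpa using this
  · simp
  · intro x y hx hy
    simp only [map_add, LinearMap.add_apply, hx, hy, neg_add]

variable [CharZero k]

/-- The action of the degree zero part on `g`. -/
def adZero (g : DGLie k) : g.Zero →ₗ[k] Module.End k g.carrier := g.br ∘ₗ Zero.incl g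

lemma gaugeField_eq (g : DGLie k) (y : g.Zero) :
    gaugeField g y = BCH.affine (adZero g) (-(g.d ∘ₗ Zero.incl g)) (-y) := by
  refine LinearMap.ext fun p => ?_
  rw [gaugeField_apply, BCH.affine_apply, br_zero_skew]
  simp [adZero]

lemma adZero_lie (g : DGLie k) (x y : g.Zero) :
    adZero g ⁅x, y⁆ = adZero g x * adZero g y - adZero g y * adZero g x := by
  refine LinearMap.ext fun z => ?_
  have := g.jacobi z (Zero.incl_mem x) (Zero.incl_mem y)
  change g.br (g.br _ _) z = g.br _ (g.br _ z) - g.br _ (g.br _ z)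
  rw [this]
  simp

lemma d_lie (g : DGLie k) (x y : g.Zero) : (-(g.d ∘ₗ Zero.incl g)) ⁅x, y⁆ =
    adZero g x ((-(g.d ∘ₗ Zero.incl g)) y) - adZero g y ((-(g.d ∘ₗ Zero.incl g)) x) := by
  have := g.d_br (Zero.incl g y) (Zero.incl_mem x)
  change -g.d (g.br _ _) = g.br _ (-g.d _) - g.br _ (-g.d _)
  rw [this, br_zero_skew]
  simp

lemma adZero_mem_lcs (g : DGLie k) (x : g.Zero) (i : ℕ) : ∀ v ∈ g.lcs i,
    adZero g x v ∈ g.lcs (i + 1) := fun _ hv => g.br_mem_lcs _ hv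

variable {g h : DGLie k} [g.IsNilpotent] [h.IsNilpotent]

lemma gaugeField_isNilpotent (y : g.Zero) : _root_.IsNilpotent (gaugeField g y) := by
  obtain ⟨N, hN⟩ := IsNilpotent.exists_lcs_eq_bot (g := g)
  rw [gaugeField_eq]
  exact BCH.affine_isNilpotent (F := g.lcs) rfl hN (adZero_mem_lcs g) _

lemma nilExp_gaugeField (γ : ExpGroup k g.Zero) (x : g.carrier) :
    nilExp k (gaugeField g γ.log) (1, x) = (1, gauge γ x) := by
  refine Prod.ext ?_ rfl
  obtain ⟨n, hn⟩ := gaugeField_isNilpotent γ.log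
  rw [nilExp_eq_sum k (pow_eq_zero_of_le (Nat.le_succ n) hn), Finset.sum_range_succ']
  have : ∀ i, ((gaugeField g γ.log ^ (i + 1)) (1, x)).1 = 0 := by
    intro i
    rw [pow_succ', Module.End.mul_apply, gaugeField_apply]
  simp [LinearMap.sum_apply, Prod.fst_sum, this]

lemma gauge_one (x : g.carrier) : gauge (1 : ExpGroup k g.Zero) x = x := by
  have : gaugeField g 0 = 0 := by rw [gaugeField_eq, neg_zero, map_zero]
  rw [gauge, ExpGroup.log_one, this, nilExp_zero]
  rfl

/-- The group `exp(g⁰)` acts from the right. -/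
lemma gauge_mul (γ δ : ExpGroup k g.Zero) (x : g.carrier) :
    gauge (γ * δ) x = gauge δ (gauge γ x) := by
  obtain ⟨N, hN⟩ := IsNilpotent.exists_lcs_eq_bot (g := g)
  have h1 : -(γ * δ).log = BCH.bch k (-δ.log) (-γ.log) := by
    rw [← ExpGroup.log_inv, mul_inv_rev]
    rfl
  have h2 : nilExp k (gaugeField g (γ * δ).log) =
      nilExp k (gaugeField g δ.log) * nilExp k (gaugeField g γ.log) := by
    rw [gaugeField_eq, h1, BCH.nilExp_affine_bch (adZero_lie g) (d_lie g) (F := g.lcs) rfl hN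
      (adZero_mem_lcs g), ← gaugeField_eq, ← gaugeField_eq]
  rw [gauge, h2, Module.End.mul_apply, nilExp_gaugeField]
  rfl

lemma gauge_map (f : Hom g h) (γ : ExpGroup k g.Zero) (x : g.carrier) :
    gauge (ExpGroup.map (Zero.map f) γ) (f.toLinearMap x) = f.toLinearMap (gauge γ x) := by
  obtain ⟨n, hn⟩ := gaugeField_isNilpotent γ.log
  obtain ⟨m, hm⟩ := gaugeField_isNilpotent (Zero.map f γ.log)
  let F : k × g.carrier →ₗ[k] k × h.carrier := LinearMap.prodMap LinearMap.id f.toLinearMap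
  have h1 : ∀ p, gaugeField h (Zero.map f γ.log) (F p) = F (gaugeField g γ.log p) := by
    intro p
    simp [gaugeField_apply, F, Zero.incl_map, f.map_br, f.map_d]
  have h2 : ∀ i p, (gaugeField h (Zero.map f γ.log) ^ i) (F p) =
      F ((gaugeField g γ.log ^ i) p) := by
    intro i
    induction i with
    | zero => intro p; rfl
    | succ i ih => intro p; rw [pow_succ, pow_succ, Module.End.mul_apply, h1, ih]; rfl
  have h3 : nilExp k (gaugeField h (Zero.map f γ.log)) (F (1, x)) =
      F (nilExp k (gaugeField g γ.log) (1, x)) := by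
    rw [nilExp_eq_sum k (pow_eq_zero_of_le (Nat.le_add_right n m) hn),
      nilExp_eq_sum k (pow_eq_zero_of_le (Nat.le_add_left m n) hm)]
    simp only [LinearMap.sum_apply, LinearMap.smul_apply, map_sum, map_smul]
    exact Finset.sum_congr rfl fun i _ => by rw [← h2]
  exact congrArg Prod.snd h3

variable (g) in
/-- The Deligne groupoid `C(g)`. Its objects are the Maurer-Cartan elements of `g`. -/
structure Deligne where
  /-- The underlying Maurer-Cartan element. -/
  val : g.carrier
  mem : val ∈ g.MC

namespace Deligne

/-- Morphisms `x ⟶ x'` are the `γ ∈ exp(g⁰)` carrying `x` to `x'`. Composition is the product of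
the group, in diagrammatic order. -/
instance : Groupoid (Deligne g) where
  Hom x x' := {γ : ExpGroup k g.Zero // gauge γ x.val = x'.val}
  id x := ⟨1, gauge_one x.val⟩
  comp γ δ := ⟨γ.1 * δ.1, by rw [gauge_mul, γ.2, δ.2]⟩
  inv {x x'} γ := ⟨γ.1⁻¹, (congrArg (gauge γ.1⁻¹) γ.2).symm.trans (by
    rw [← gauge_mul, mul_inv_cancel, gauge_one])⟩
  id_comp γ := Subtype.ext (one_mul γ.1)
  comp_id γ := Subtype.ext (mul_one γ.1)
  assoc γ δ ε := Subtype.ext (mul_assoc γ.1 δ.1 ε.1)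
  inv_comp γ := Subtype.ext (inv_mul_cancel γ.1)
  comp_inv γ := Subtype.ext (mul_inv_cancel γ.1)

/-- The functor induced by a morphism. -/
def map (f : Hom g h) : Deligne g ⥤ Deligne h where
  obj x := ⟨f.toLinearMap x.val, f.map_mem_MC x.mem⟩
  map γ := ⟨ExpGroup.map (Zero.map f) γ.1, by rw [gauge_map, γ.2]⟩
  map_id x := Subtype.ext (map_one (ExpGroup.map (Zero.map f)))
  map_comp γ δ := Subtype.ext (map_mul (ExpGroup.map (Zero.map f)) γ.1 δ.1)

end Deligne

end Gauge

end DGLie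

/-- The relations defining the algebra of polynomial differential forms on the `n`-simplex, among
the generators `tᵢ` (left summand) and `dtᵢ` (right summand). -/
inductive SimplexForms.Rel (k : Type u) [Field k] (n : ℕ) :
    FreeAlgebra k (Fin (n + 1) ⊕ Fin (n + 1)) → FreeAlgebra k (Fin (n + 1) ⊕ Fin (n + 1)) → Prop
  | t_t (i j) : Rel k n (FreeAlgebra.ι k (.inl i) * FreeAlgebra.ι k (.inl j))
      (FreeAlgebra.ι k (.inl j) * FreeAlgebra.ι k (.inl i))
  | t_dt (i j) : Rel k n (FreeAlgebra.ι k (.inl i) * FreeAlgebra.ι k (.inr j))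
      (FreeAlgebra.ι k (.inr j) * FreeAlgebra.ι k (.inl i))
  | dt_dt (i j) : Rel k n (FreeAlgebra.ι k (.inr i) * FreeAlgebra.ι k (.inr j))
      (-(FreeAlgebra.ι k (.inr j) * FreeAlgebra.ι k (.inr i)))
  | sum_t : Rel k n (∑ i, FreeAlgebra.ι k (.inl i)) 1
  | sum_dt : Rel k n (∑ i, FreeAlgebra.ι k (.inr i)) 0

/-- The algebra `k[t₀, …, tₙ, dt₀, …, dtₙ] / (∑ tᵢ - 1, ∑ dtᵢ)` of polynomial differential forms on
the `n`-simplex. -/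
def SimplexForms (k : Type u) [Field k] (n : ℕ) : Type u := RingQuot (SimplexForms.Rel k n)

namespace SimplexForms

variable {k : Type u} [Field k] {n : ℕ}

instance : Ring (SimplexForms k n) := inferInstanceAs (Ring (RingQuot (Rel k n)))
instance : Algebra k (SimplexForms k n) := inferInstanceAs (Algebra k (RingQuot (Rel k n)))

variable (k n) in
/-- The projection from the free algebra. -/
def proj : FreeAlgebra k (Fin (n + 1) ⊕ Fin (n + 1)) →ₐ[k] SimplexForms k n :=
  RingQuot.mkAlgHom k (Rel k n)

lemma proj_rel {x y} (h : Rel k n x y) : proj k n x = proj k n y := RingQuot.mkAlgHom_rel k h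

/-- The generator `tᵢ` or `dtᵢ`. -/
def gen (s : Fin (n + 1) ⊕ Fin (n + 1)) : SimplexForms k n := proj k n (FreeAlgebra.ι k s)

/-- The function `tᵢ`. -/
def t (i : Fin (n + 1)) : SimplexForms k n := gen (.inl i)

/-- The form `dtᵢ`. -/
def dt (i : Fin (n + 1)) : SimplexForms k n := gen (.inr i)

lemma t_mul_t (i j : Fin (n + 1)) : (t i * t j : SimplexForms k n) = t j * t i := by
  simpa [t, dt, gen] using proj_rel (Rel.t_t (k := k) i j)

lemma t_mul_dt (i j : Fin (n + 1)) : (t i * dt j : SimplexForms k n) = dt j * t i := by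
  simpa [t, dt, gen] using proj_rel (Rel.t_dt (k := k) i j)

lemma dt_mul_dt (i j : Fin (n + 1)) : (dt i * dt j : SimplexForms k n) = -(dt j * dt i) := by
  simpa [t, dt, gen] using proj_rel (Rel.dt_dt (k := k) i j)

lemma sum_t : ∑ i, (t i : SimplexForms k n) = 1 := by
  simpa [t, dt, gen] using proj_rel (Rel.sum_t (k := k) (n := n))

lemma sum_dt : ∑ i, (dt i : SimplexForms k n) = 0 := by
  simpa [t, dt, gen] using proj_rel (Rel.sum_dt (k := k) (n := n))

/-- The universal property. -/
def lift {B : Type*} [Ring B] [Algebra k B] (T D : Fin (n + 1) → B)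
    (h1 : ∀ i j, T i * T j = T j * T i) (h2 : ∀ i j, T i * D j = D j * T i)
    (h3 : ∀ i j, D i * D j = -(D j * D i)) (h4 : ∑ i, T i = 1) (h5 : ∑ i, D i = 0) :
    SimplexForms k n →ₐ[k] B :=
  RingQuot.liftAlgHom k ⟨FreeAlgebra.lift k (Sum.elim T D), by
    intro x y h
    cases h with
    | t_t i j => simpa using h1 i j
    | t_dt i j => simpa using h2 i j
    | dt_dt i j => simpa using h3 i j
    | sum_t => simpa using h4
    | sum_dt => simpa using h5⟩

section

variable {B : Type*} [Ring B] [Algebra k B] {T D : Fin (n + 1) → B}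
    {h1 : ∀ i j, T i * T j = T j * T i} {h2 : ∀ i j, T i * D j = D j * T i}
    {h3 : ∀ i j, D i * D j = -(D j * D i)} {h4 : ∑ i, T i = 1} {h5 : ∑ i, D i = 0}

@[simp] lemma lift_t (i) : lift (k := k) T D h1 h2 h3 h4 h5 (t i) = T i := by
  exact (RingQuot.liftAlgHom_mkAlgHom_apply _ _ _ _).trans (by simp)

@[simp] lemma lift_dt (i) : lift (k := k) T D h1 h2 h3 h4 h5 (dt i) = D i := by
  exact (RingQuot.liftAlgHom_mkAlgHom_apply _ _ _ _).trans (by simp)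

end

lemma hom_ext {B : Type*} [Ring B] [Algebra k B] {f g : SimplexForms k n →ₐ[k] B}
    (ht : ∀ i, f (t i) = g (t i)) (hdt : ∀ i, f (dt i) = g (dt i)) : f = g := by
  refine RingQuot.ringQuot_ext' k f g (FreeAlgebra.hom_ext (funext fun s => ?_))
  cases s with
  | inl i => exact ht i
  | inr i => exact hdt i

variable (k n) in
/-- The forms of degree `p`: the span of the products of generators with exactly `p` factors
`dtᵢ`. -/
def deg (p : ℕ) : Submodule k (SimplexForms k n) :=
  Submodule.span k {w | ∃ l : List (Fin (n + 1) ⊕ Fin (n + 1)),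
    l.countP Sum.isRight = p ∧ w = (l.map gen).prod}

lemma prod_mem (l : List (Fin (n + 1) ⊕ Fin (n + 1))) :
    (l.map gen).prod ∈ deg k n (l.countP Sum.isRight) := Submodule.subset_span ⟨l, rfl, rfl⟩

lemma t_mem (i : Fin (n + 1)) : t i ∈ deg k n 0 := by
  simpa [t] using prod_mem (k := k) [Sum.inl i]

lemma dt_mem (i : Fin (n + 1)) : dt i ∈ deg k n 1 := by
  simpa [dt] using prod_mem (k := k) [Sum.inr i]

lemma one_mem : 1 ∈ deg k n 0 := by simpa using prod_mem (k := k) (n := n) []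

lemma mul_mem {p q : ℕ} {a b : SimplexForms k n} (ha : a ∈ deg k n p) (hb : b ∈ deg k n q) :
    a * b ∈ deg k n (p + q) := by
  induction ha using Submodule.span_induction with
  | zero => rw [zero_mul]; exact zero_mem _
  | add x y _ _ hx hy => rw [add_mul]; exact add_mem hx hy
  | smul c x _ hx => rw [smul_mul_assoc]; exact Submodule.smul_mem _ c hx
  | mem a ha =>
    obtain ⟨l, rfl, rfl⟩ := ha
    induction hb using Submodule.span_induction with
    | zero => rw [mul_zero]; exact zero_mem _
    | add x y _ _ hx hy => rw [mul_add]; exact add_mem hx hy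
    | smul c x _ hx => rw [mul_smul_comm]; exact Submodule.smul_mem _ c hx
    | mem b hb =>
      obtain ⟨m, rfl, rfl⟩ := hb
      rw [← List.prod_append, ← List.map_append, ← List.countP_append]
      exact prod_mem _

/-- Induction on the words in the generators. -/
lemma deg_induction {p : ℕ} {P : ℕ → SimplexForms k n → Prop} (one : P 0 1)
    (t_mul : ∀ i q a, a ∈ deg k n q → P q a → P q (t i * a))
    (dt_mul : ∀ i q a, a ∈ deg k n q → P q a → P (q + 1) (dt i * a)) (zero : P p 0)
    (add : ∀ a b, P p a → P p b → P p (a + b)) (smul : ∀ (c : k) a, P p a → P p (c • a))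
    {a : SimplexForms k n} (ha : a ∈ deg k n p) : P p a := by
  induction ha using Submodule.span_induction with
  | zero => exact zero
  | add x y _ _ hx hy => exact add x y hx hy
  | smul c x _ hx => exact smul c x hx
  | mem a ha =>
    obtain ⟨l, rfl, rfl⟩ := ha
    clear zero add smul
    induction l with
    | nil => exact one
    | cons s l ih =>
      cases s with
      | inl i =>
        have := t_mul i _ _ (prod_mem l) ih
        simpa [t] using this
      | inr i =>
        have := dt_mul i _ _ (prod_mem l) ih
        rw [List.countP_cons_of_pos rfl, List.map_cons, List.prod_cons]
        exact this

lemma iSup_deg : ⨆ p, deg k n p = ⊤ := by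
  have hm : ∀ {a b : SimplexForms k n}, a ∈ ⨆ p, deg k n p → b ∈ ⨆ p, deg k n p →
      a * b ∈ ⨆ p, deg k n p := by
    intro a b ha hb
    refine Submodule.iSup_induction _ (motive := fun a => a * b ∈ ⨆ p, deg k n p) ha
      (fun p a ha => ?_) (by rw [zero_mul]; exact zero_mem _)
      (fun x y hx hy => by rw [add_mul]; exact add_mem hx hy)
    refine Submodule.iSup_induction _ (motive := fun b => a * b ∈ ⨆ p, deg k n p) hb
      (fun q b hb => ?_) (by rw [mul_zero]; exact zero_mem _)
      (fun x y hx hy => by rw [mul_add]; exact add_mem hx hy)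
    exact Submodule.mem_iSup_of_mem _ (mul_mem ha hb)
  rw [eq_top_iff]
  intro a _
  obtain ⟨a, rfl⟩ : ∃ b, proj k n b = a := RingQuot.mkAlgHom_surjective k (Rel k n) a
  induction a using FreeAlgebra.induction with
  | grade0 c =>
    rw [AlgHom.commutes, Algebra.algebraMap_eq_smul_one]
    exact Submodule.smul_mem _ c (Submodule.mem_iSup_of_mem 0 one_mem)
  | grade1 s =>
    cases s with
    | inl i => exact Submodule.mem_iSup_of_mem 0 (t_mem i)
    | inr i => exact Submodule.mem_iSup_of_mem 1 (dt_mem i)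
  | mul a b ha hb => rw [map_mul]; exact hm (ha trivial) (hb trivial)
  | add a b ha hb => rw [map_add]; exact add_mem (ha trivial) (hb trivial)

/-- Induction on the words in the generators, for all forms. -/
lemma induction {P : SimplexForms k n → Prop} (one : P 1) (t_mul : ∀ i a, P a → P (t i * a))
    (dt_mul : ∀ i a, P a → P (dt i * a)) (zero : P 0) (add : ∀ a b, P a → P b → P (a + b))
    (smul : ∀ (c : k) a, P a → P (c • a)) (a : SimplexForms k n) : P a := by
  have ha : a ∈ ⨆ p, deg k n p := by rw [iSup_deg]; trivial
  refine Submodule.iSup_induction _ (motive := P) ha (fun p a ha => ?_) zero add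
  exact deg_induction (P := fun _ => P) one (fun i _ a _ => t_mul i a) (fun i _ a _ => dt_mul i a)
    zero add smul ha

lemma isInternal [CharZero k] : DirectSum.IsInternal (deg k n) := by
  let T : SimplexForms k n →ₐ[k] SimplexForms k n := lift t (fun i => (2 : k) • dt i) t_mul_t
    (fun i j => by rw [mul_smul_comm, t_mul_dt, smul_mul_assoc])
    (fun i j => by simp only [mul_smul_comm, smul_mul_assoc]; rw [dt_mul_dt, smul_neg, smul_neg])
    sum_t (by rw [← Finset.smul_sum, sum_dt, smul_zero])
  refine isInternal_of_eigen T.toLinearMap (fun p a ha => ?_) iSup_deg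
  refine deg_induction (P := fun p a => T a = (2 : k) ^ p • a) ?_ ?_ ?_ ?_ ?_ ?_ ha
  · simp
  · intro i q a _ h
    rw [map_mul, h, mul_smul_comm]
    simp [T]
  · intro i q a _ h
    rw [map_mul, h, mul_smul_comm, pow_succ, mul_smul]
    simp [T]
  · simp
  · intro a b ha hb; rw [map_add, ha, hb, smul_add]
  · intro c a ha; rw [map_smul, ha, smul_comm]

lemma t_mul {i : Fin (n + 1)} (a : SimplexForms k n) : t i * a = a * t i := by
  refine induction (P := fun a => t i * a = a * t i) ?_ ?_ ?_ ?_ ?_ ?_ a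
  · simp
  · intro j a h; rw [← mul_assoc, t_mul_t, mul_assoc, h, mul_assoc]
  · intro j a h; rw [← mul_assoc, t_mul_dt, mul_assoc, h, mul_assoc]
  · simp
  · intro a b ha hb; rw [mul_add, ha, hb, add_mul]
  · intro c a ha; rw [mul_smul_comm, ha, smul_mul_assoc]

lemma dt_mul {i : Fin (n + 1)} {p : ℕ} {a : SimplexForms k n} (ha : a ∈ deg k n p) :
    dt i * a = (-1 : k) ^ p • (a * dt i) := by
  refine deg_induction (P := fun p a => dt i * a = (-1 : k) ^ p • (a * dt i)) ?_ ?_ ?_ ?_ ?_ ?_ ha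
  · simp
  · intro j q a _ h; rw [← mul_assoc, ← t_mul_dt, mul_assoc, h, mul_smul_comm, mul_assoc]
  · intro j q a _ h
    rw [← mul_assoc, dt_mul_dt, neg_mul, mul_assoc, h, mul_smul_comm, mul_assoc, pow_succ,
      mul_neg_one, neg_smul]
  · simp
  · intro a b ha hb; rw [mul_add, ha, hb, add_mul, smul_add]
  · intro c a ha; rw [mul_smul_comm, ha, smul_mul_assoc, smul_comm]

lemma mul_comm {p q : ℕ} {a b : SimplexForms k n} (ha : a ∈ deg k n p) (hb : b ∈ deg k n q) :
    a * b = (-1 : k) ^ (p * q) • (b * a) := by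
  refine deg_induction (P := fun p a => a * b = (-1 : k) ^ (p * q) • (b * a)) ?_ ?_ ?_ ?_ ?_ ?_ ha
  · simp
  · intro i p a _ h; rw [mul_assoc, h, mul_smul_comm, ← mul_assoc, t_mul, mul_assoc]
  · intro i p a _ h
    rw [mul_assoc, h, mul_smul_comm, ← mul_assoc, dt_mul hb, smul_mul_assoc, smul_smul, mul_assoc,
      ← pow_add, Nat.succ_mul]
  · simp
  · intro a b ha hb; rw [mul_add, add_mul, ha, hb, smul_add]
  · intro c a ha; rw [mul_smul_comm, smul_mul_assoc, ha, smul_comm]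

/-- The algebra homomorphism `a ↦ !![± a, da; 0, a]`, where the sign is the parity of the degree.
Its multiplicativity encodes the Leibniz rule of `d`. -/
def jet : SimplexForms k n →ₐ[k] Matrix (Fin 2) (Fin 2) (SimplexForms k n) :=
  lift (fun i => !![t i, dt i; 0, t i]) (fun i => !![-dt i, 0; 0, dt i])
    (fun i j => by
      simp only [Matrix.mul_fin_two]
      rw [t_mul_t i j, t_mul_dt i j, ← t_mul_dt j i]
      simp [add_comm])
    (fun i j => by
      simp only [Matrix.mul_fin_two]
      simp [t_mul_dt i j, dt_mul_dt i j])
    (fun i j => by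
      simp only [Matrix.mul_fin_two]
      ext a b
      fin_cases a <;> fin_cases b <;> simp [dt_mul_dt i j])
    (by
      ext a b
      rw [Matrix.sum_apply]
      fin_cases a <;> fin_cases b <;> simp [sum_t, sum_dt])
    (by
      ext a b
      rw [Matrix.sum_apply]
      fin_cases a <;> fin_cases b <;> simp [sum_dt])

variable (k n) in
/-- The de Rham differential. -/
def d : SimplexForms k n →ₗ[k] SimplexForms k n :=
  Matrix.entryLinearMap k (SimplexForms k n) 0 1 ∘ₗ jet.toLinearMap

lemma d_apply (a : SimplexForms k n) : d k n a = jet a 0 1 := rfl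

lemma jet_one_one (a : SimplexForms k n) : jet a 1 1 = a := by
  refine induction (P := fun a => jet a 1 1 = a) ?_ ?_ ?_ ?_ ?_ ?_ a
  · simp
  · intro i a h; rw [map_mul, Matrix.mul_apply, Fin.sum_univ_two, h]; simp [jet]
  · intro i a h; rw [map_mul, Matrix.mul_apply, Fin.sum_univ_two, h]; simp [jet]
  · simp
  · intro a b ha hb; rw [map_add, Matrix.add_apply, ha, hb]
  · intro c a ha; rw [map_smul, Matrix.smul_apply, ha]

lemma d_one : d k n 1 = 0 := by simp [d_apply]

lemma d_t_mul (i) (a : SimplexForms k n) : d k n (t i * a) = dt i * a + t i * d k n a := by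
  simp only [d_apply]
  rw [map_mul, Matrix.mul_apply, Fin.sum_univ_two, jet_one_one]
  simp [jet, add_comm]

lemma d_dt_mul (i) (a : SimplexForms k n) : d k n (dt i * a) = -(dt i * d k n a) := by
  simp only [d_apply]
  rw [map_mul, Matrix.mul_apply, Fin.sum_univ_two]
  simp [jet]

lemma d_t (i) : d k n (t i) = dt i := by simpa [d_one] using d_t_mul (k := k) i 1

lemma d_d (a : SimplexForms k n) : d k n (d k n a) = 0 := by
  refine induction (P := fun a => d k n (d k n a) = 0) ?_ ?_ ?_ ?_ ?_ ?_ a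
  · simp [d_one]
  · intro i a h; rw [d_t_mul, map_add, d_dt_mul, d_t_mul, h]; simp
  · intro i a h; rw [d_dt_mul, map_neg, d_dt_mul, h]; simp
  · simp
  · intro a b ha hb; rw [map_add, map_add, ha, hb, add_zero]
  · intro c a ha; rw [map_smul, map_smul, ha, smul_zero]

lemma d_mem {p : ℕ} {a : SimplexForms k n} (ha : a ∈ deg k n p) : d k n a ∈ deg k n (p + 1) := by
  refine deg_induction (P := fun p a => d k n a ∈ deg k n (p + 1)) ?_ ?_ ?_ ?_ ?_ ?_ ha
  · rw [d_one]; exact zero_mem _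
  · intro i q a ha h
    rw [d_t_mul]
    refine add_mem ?_ ?_
    · simpa [add_comm] using mul_mem (dt_mem i) ha
    · simpa using mul_mem (t_mem i) h
  · intro i q a ha h
    rw [d_dt_mul]
    refine neg_mem ?_
    have := mul_mem (dt_mem i) h
    rwa [add_comm 1] at this
  · rw [map_zero]; exact zero_mem _
  · intro a b ha hb; rw [map_add]; exact add_mem ha hb
  · intro c a ha; rw [map_smul]; exact Submodule.smul_mem _ c ha

lemma d_mul {p : ℕ} {a : SimplexForms k n} (b) (ha : a ∈ deg k n p) :
    d k n (a * b) = d k n a * b + (-1 : k) ^ p • (a * d k n b) := by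
  refine deg_induction
    (P := fun p a => d k n (a * b) = d k n a * b + (-1 : k) ^ p • (a * d k n b)) ?_ ?_ ?_ ?_ ?_ ?_ ha
  · simp [d_one]
  · intro i q a _ h
    rw [mul_assoc, d_t_mul, h, d_t_mul, mul_add, add_mul, mul_smul_comm, mul_assoc, mul_assoc,
      mul_assoc, add_assoc]
  · intro i q a _ h
    rw [mul_assoc, d_dt_mul, h, d_dt_mul, mul_add, mul_smul_comm, mul_assoc, pow_succ, mul_neg_one,
      neg_smul, neg_add, neg_mul, mul_assoc]
  · simp
  · intro x y hx hy; rw [add_mul, map_add, hx, hy, map_add, add_mul, add_mul, smul_add]; abel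
  · intro c x hx
    rw [smul_mul_assoc, map_smul, hx, map_smul, smul_mul_assoc, smul_mul_assoc, smul_add,
      smul_comm c]

variable (k n) in
/-- The commutative dg algebra `Ωₙ` of polynomial differential forms on the `n`-simplex. -/
def cdga [CharZero k] : CDGA k where
  carrier := SimplexForms k n
  deg := deg k n
  isInternal := isInternal
  one_mem := one_mem
  mul_mem := mul_mem
  mul_comm := mul_comm
  d := d k n
  d_mem := d_mem
  d_d := d_d
  d_mul := d_mul

section Pullback

variable {m l : ℕ}

/-- The pullback of forms along a map of simplices: `tᵢ ↦ ∑_{u(j) = i} tⱼ`. -/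
def pullback (u : Fin (m + 1) → Fin (n + 1)) : SimplexForms k n →ₐ[k] SimplexForms k m :=
  lift (fun i => ∑ j with u j = i, t j) (fun i => ∑ j with u j = i, dt j)
    (fun i j => by
      rw [Finset.sum_mul, Finset.mul_sum]
      exact Finset.sum_congr rfl fun x _ => t_mul _)
    (fun i j => by
      rw [Finset.sum_mul, Finset.mul_sum]
      exact Finset.sum_congr rfl fun x _ => t_mul _)
    (fun i j => by
      rw [Finset.sum_mul_sum, Finset.sum_mul_sum, Finset.sum_comm, ← Finset.sum_neg_distrib]
      refine Finset.sum_congr rfl fun x _ => ?_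
      rw [← Finset.sum_neg_distrib]
      exact Finset.sum_congr rfl fun y _ => dt_mul_dt y x)
    (by rw [Finset.sum_fiberwise, sum_t]) (by rw [Finset.sum_fiberwise, sum_dt])

lemma pullback_t (u : Fin (m + 1) → Fin (n + 1)) (i) :
    pullback (k := k) u (t i) = ∑ j with u j = i, t j := by simp [pullback]

lemma pullback_dt (u : Fin (m + 1) → Fin (n + 1)) (i) :
    pullback (k := k) u (dt i) = ∑ j with u j = i, dt j := by simp [pullback]

variable (k) in
lemma pullback_id : pullback (k := k) (fun i : Fin (n + 1) => i) = AlgHom.id k _ := by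
  refine hom_ext (fun i => ?_) fun i => ?_
  · rw [pullback_t, Finset.sum_filter]; simp
  · rw [pullback_dt, Finset.sum_filter]; simp

lemma pullback_comp (u : Fin (m + 1) → Fin (n + 1)) (v : Fin (l + 1) → Fin (m + 1)) :
    (pullback v).comp (pullback (k := k) u) = pullback fun i => u (v i) := by
  have h : ∀ (f : Fin (l + 1) → SimplexForms k l) i,
      ∑ j with u j = i, ∑ j' with v j' = j, f j' = ∑ j' with u (v j') = i, f j' := by
    intro f i
    rw [Finset.sum_filter, Finset.sum_filter, ← Finset.sum_fiberwise (s := Finset.univ) (g := v)]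
    refine Finset.sum_congr rfl fun j _ => ?_
    split_ifs with hj
    · refine Finset.sum_congr rfl fun j' hj' => ?_
      rw [(Finset.mem_filter.1 hj').2, if_pos hj]
    · refine (Finset.sum_eq_zero fun j' hj' => ?_).symm
      rw [(Finset.mem_filter.1 hj').2, if_neg hj]
  refine hom_ext (fun i => ?_) fun i => ?_
  · simp only [AlgHom.comp_apply, pullback_t, map_sum, h]
  · simp only [AlgHom.comp_apply, pullback_dt, map_sum, h]

variable [CharZero k]

variable (k) in
/-- The morphism `Ωₙ → Ωₘ` of commutative dg algebras induced by a map of simplices. -/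
def pullbackHom (u : Fin (m + 1) → Fin (n + 1)) : CDGA.Hom (cdga k n) (cdga k m) where
  toAlgHom := pullback u
  map_deg {p a} ha := by
    refine deg_induction (P := fun p a => pullback u a ∈ deg k m p) ?_ ?_ ?_ ?_ ?_ ?_ ha
    · rw [map_one]; exact one_mem
    · intro i q a _ h
      rw [map_mul, pullback_t]
      have := mul_mem (Submodule.sum_mem (deg k m 0)
        fun j (_ : j ∈ Finset.univ.filter fun j => u j = i) => t_mem j) h
      rwa [zero_add] at this
    · intro i q a _ h
      rw [map_mul, pullback_dt, add_comm]
      exact mul_mem (Submodule.sum_mem (deg k m 1)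
        fun j (_ : j ∈ Finset.univ.filter fun j => u j = i) => dt_mem j) h
    · rw [map_zero]; exact zero_mem _
    · intro a b ha hb; rw [map_add]; exact add_mem ha hb
    · intro c a ha; rw [map_smul]; exact Submodule.smul_mem _ c ha
  map_d a := by
    change pullback u (d k n a) = d k m (pullback u a)
    refine induction (P := fun a => pullback u (d k n a) = d k m (pullback u a)) ?_ ?_ ?_ ?_ ?_ ?_ a
    · rw [d_one, map_zero, map_one, d_one]
    · intro i a h
      rw [d_t_mul, map_add, map_mul, map_mul, map_mul, h, pullback_t, pullback_dt, Finset.sum_mul,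
        Finset.sum_mul, Finset.sum_mul, map_sum, ← Finset.sum_add_distrib]
      exact Finset.sum_congr rfl fun j _ => (d_t_mul j _).symm
    · intro i a h
      rw [d_dt_mul, map_neg, map_mul, map_mul, h, pullback_dt, Finset.sum_mul, Finset.sum_mul,
        map_sum, ← Finset.sum_neg_distrib]
      exact Finset.sum_congr rfl fun j _ => (d_dt_mul j _).symm
    · simp
    · intro a b ha hb; simp only [map_add, ha, hb]
    · intro c a ha; simp only [map_smul, ha]

variable (k n) in
lemma pullbackHom_id : pullbackHom k (fun i : Fin (n + 1) => i) = CDGA.Hom.id (cdga k n) :=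
  CDGA.Hom.ext (pullback_id k)

lemma pullbackHom_comp (u : Fin (m + 1) → Fin (n + 1)) (v : Fin (l + 1) → Fin (m + 1)) :
    pullbackHom k (fun i => u (v i)) = (pullbackHom k v).comp (pullbackHom k u) :=
  CDGA.Hom.ext (pullback_comp u v).symm

end Pullback

/-- The evaluation of forms at the `i`-th vertex. -/
def eval (i : Fin (n + 1)) : SimplexForms k n →ₐ[k] k :=
  lift (fun j => if j = i then 1 else 0) (fun _ => 0) (fun _ _ => _root_.mul_comm _ _) (by simp)
    (by simp) (by simp) (by simp)

lemma eval_of_mem (i : Fin (n + 1)) (p : ℕ) (a : SimplexForms k n) (ha : a ∈ deg k n (p + 1)) :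
    eval i a = 0 := by
  suffices h : ∀ q, ∀ a ∈ deg k n q, q ≠ 0 → eval i a = 0 from h _ a ha (Nat.succ_ne_zero p)
  intro q a ha
  refine deg_induction (P := fun q a => q ≠ 0 → eval i a = 0) ?_ ?_ ?_ ?_ ?_ ?_ ha
  · intro h; exact absurd rfl h
  · intro j q a _ h hq; rw [map_mul, h hq, mul_zero]
  · intro j q a _ _ _; rw [map_mul]; simp [eval]
  · simp
  · intro a b ha hb hq; rw [map_add, ha hq, hb hq, add_zero]
  · intro c a ha hq; rw [map_smul, ha hq, smul_zero]

end SimplexForms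

namespace DGLie

open CategoryTheory Simplicial Opposite

variable {k : Type u} [Field k] [CharZero k]

/-- The simplicial set `Σ(g)`, the contents of `g`: its `n`-simplices are the Maurer-Cartan elements
of `Ωₙ ⊗ g`. -/
def contents (g : DGLie k) : SSet.{u} where
  obj Δ := (tensor (SimplexForms.cdga k Δ.unop.len) g).MC
  map u := ↾(tensorMap (SimplexForms.pullbackHom k u.unop.toOrderHom) (Hom.id g)).mapMC
  map_id Δ := by
    have h : tensorMap (SimplexForms.pullbackHom k (𝟙 Δ : Δ ⟶ Δ).unop.toOrderHom) (Hom.id g) =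
        Hom.id _ := by
      rw [← tensorMap_id, ← SimplexForms.pullbackHom_id]
      rfl
    rw [h]
    rfl
  map_comp u v := by
    have h : tensorMap (SimplexForms.pullbackHom k (u ≫ v).unop.toOrderHom) (Hom.id g) =
        (tensorMap (SimplexForms.pullbackHom k v.unop.toOrderHom) (Hom.id g)).comp
          (tensorMap (SimplexForms.pullbackHom k u.unop.toOrderHom) (Hom.id g)) := by
      rw [← tensorMap_comp, ← SimplexForms.pullbackHom_comp]
      rfl
    rw [h]
    rfl

/-- The map `Σ(g) → Σ(h)` induced by a morphism. -/
def contentsMap {g h : DGLie k} (f : Hom g h) : contents g ⟶ contents h where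
  app Δ := ↾(tensorMap (CDGA.Hom.id _) f).mapMC
  naturality Δ Δ' u := by
    have h : (tensorMap (CDGA.Hom.id _) f).comp
          (tensorMap (SimplexForms.pullbackHom k u.unop.toOrderHom) (Hom.id g)) =
        (tensorMap (SimplexForms.pullbackHom k u.unop.toOrderHom) (Hom.id h)).comp
          (tensorMap (CDGA.Hom.id _) f) := by
      rw [← tensorMap_comp, ← tensorMap_comp]
      rfl
    change ↾((tensorMap (CDGA.Hom.id _) f).comp
      (tensorMap (SimplexForms.pullbackHom k u.unop.toOrderHom) (Hom.id g))).mapMC = _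
    rw [h]
    rfl

/-- The restriction `Ωₙ ⊗ g → g` to the `i`-th vertex of the `n`-simplex. -/
def atVertex (g : DGLie k) (n : ℕ) (i : Fin (n + 1)) : Hom (tensor (SimplexForms.cdga k n) g) g :=
  augment (A := SimplexForms.cdga k n) (SimplexForms.eval i) (SimplexForms.eval_of_mem i) g

/-- The value at the `i`-th vertex of an element of `Gₙ = exp((Ωₙ ⊗ g)⁰)`. -/
def gaugeAtVertex {g : DGLie k} [g.IsNilpotent] {n : ℕ} (i : Fin (n + 1)) :
    ExpGroup k (tensor (SimplexForms.cdga k n) g).Zero →* ExpGroup k g.Zero :=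
  ExpGroup.map (Zero.map (atVertex g n i))

/-- The defining property of the map `τ : Σ(g) → N C(g)`: if an `n`-simplex of `Σ(g)` is obtained
from the constant simplex at `x ∈ MC(g)` by the action of `γ ∈ Gₙ`, with values
`γ₀, …, γₙ ∈ exp(g⁰)` at the vertices, then `τ` sends it to the `n`-simplex of the nerve whose
vertices are the elements obtained from `x` by the action of the `γᵢ`, and whose edge from `i` to
`j` is given by `γᵢ⁻¹ γⱼ`. -/
def IsTau (g : DGLie k) [g.IsNilpotent] (τ : contents g ⟶ nerve (Deligne g)) : Prop :=
  ∀ (n : ℕ) (z : (tensor (SimplexForms.cdga k n) g).MC)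
    (γ : ExpGroup k (tensor (SimplexForms.cdga k n) g).Zero), ∀ x ∈ g.MC,
    z.1 = gauge γ ((const (SimplexForms.cdga k n) g).toLinearMap x) →
    let σ : Fin (n + 1) ⥤ Deligne g := τ.app (op ⦋n⦌) z
    (∀ i, (σ.obj i).val = gauge (gaugeAtVertex i γ) x) ∧
      ∀ i j (hij : i ≤ j), (σ.map (homOfLE hij)).1 = (gaugeAtVertex i γ)⁻¹ * gaugeAtVertex j γ

end DGLie

namespace SSet

open CategoryTheory

/-- An acyclic fibration of simplicial sets: a map with the right lifting property with respect to
all boundary inclusions `∂Δ[n] → Δ[n]`. -/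
def AcyclicFibration {X Y : SSet.{u}} (p : X ⟶ Y) : Prop := modelCategoryQuillen.I.rlp p

/-- The Poincaré (fundamental) groupoid of a simplicial set: the groupoid generated by its
vertices and edges subject to the relations given by the degenerate edges and the triangles. -/
abbrev FundamentalGroupoid (X : SSet.{u}) : Type u := FreeGroupoid (hoFunctor.obj X)

/-- The functor from the Poincaré groupoid of `X` to a groupoid `C` corresponding to a map from `X`
to the nerve of `C`. -/
def FundamentalGroupoid.desc {X : SSet.{u}} {C : Type u} [Groupoid.{u} C] (τ : X ⟶ nerve C) :
    FundamentalGroupoid X ⥤ C :=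
  FreeGroupoid.lift ((nerveAdjunction.homEquiv X (Cat.of C)).symm τ).toFunctor

end SSet

end

open CategoryTheory

/-! Everything rests on the contractibility of `Ωₙ`. Polynomial forms on the simplex satisfy the
Poincaré lemma, with an explicit homotopy onto a vertex. Induction along the lower central series of
`g`, using this homotopy to kill the leading error, shows that every Maurer-Cartan element of `Ωₙ ⊗
g` has the form `(1 ⊗ x)·γ`; a constant change of gauge then moves the base point and prescribes the
value of `γ` at any one vertex (`exists_eq_gauge_const`). Conversely, a gauge transformation fixing
a constant element is itself constant (`eq_const_of_gauge_const_eq`), so `γ` is determined by `z`,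
`x` and its value at one vertex (`eq_of_gauge_const_eq`). Two presentations of `z` therefore differ
by a constant left factor, which cancels in `γᵢ⁻¹γⱼ` (`transport_eq`). Hence the formula for `τ` is
consistent, and since every simplex has a presentation it also forces `τ`.

Lifting problems become extension problems for `γ`. Given a boundary in `Σ(g)`, an `(n+1)`-simplex
of the nerve and a simplex of `Σ(h)`, take `x` to be the vertex `0` of the simplex of the nerve. The
edges issuing from that vertex prescribe the values of `γ` at all vertices, hence determine `γ` on
each face, and uniqueness makes these transformations agree on intersections. As a set `exp((Ωₙ ⊗
g)⁰)` is the vector space `(Ωₙ ⊗ g)⁰`, with linear restriction maps, so gluing is an additive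
problem: compatible forms on the faces extend to the simplex, even with prescribed image under a
surjection (`exists_exp_extension`). The outcome is `exists_MC_extension`. It gives part (2), and
its case `h = 0` shows that `τ` is an acyclic fibration. The Kan property uses the same argument,
normalized at the vertex common to all faces of the horn (`exists_MC_horn_extension`).

For the Poincaré groupoid, choose a section `s` of the acyclic fibration `τ`. Following `s` by the
canonical map to the nerve of the Poincaré groupoid gives a map between nerves, that is, a functor
`G`. One composite is the identity because `s` is a section. For the other, an edge `e` and
`s(τ(e))` have the same image under `τ`, so they are two sides of a triangle with degenerate third
side (`exists_triangle`) and become equal in the groupoid. -/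

namespace DGLie

variable {k : Type u} [Field k] [CharZero k]

/-! ### Power series expansion of the gauge action; its effect on curvature. -/

section GaugeExpansion

variable {g : DGLie k}

/-- The Taylor coefficients at `0` of the flow of the vector field `ρ(y)` through `x`. -/
def gaugeTerm (y : g.Zero) (x : g.carrier) : ℕ → g.carrier
  | 0 => x
  | n + 1 => ((n + 1 : ℕ) : k)⁻¹ •
      ((if n = 0 then g.d (Zero.incl g y) else 0) + g.br (gaugeTerm y x n) (Zero.incl g y))

lemma smul_gaugeTerm_succ (y : g.Zero) (x : g.carrier) (n : ℕ) :
    ((n + 1 : ℕ) : k) • gaugeTerm y x (n + 1) =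
      (if n = 0 then g.d (Zero.incl g y) else 0) + g.br (gaugeTerm y x n) (Zero.incl g y) := by
  rw [gaugeTerm, smul_smul, mul_inv_cancel₀ (Nat.cast_ne_zero.2 (Nat.succ_ne_zero n)), one_smul]

/-- From the first power on, the field lands in `0 × g`. The inhomogeneous term `dy` is multiplied
by the first coordinate, so it enters only the coefficient of index `1`; all later coefficients are
pure brackets. -/
lemma smul_gaugeField_pow (y : g.Zero) (x : g.carrier) (n : ℕ) :
    (n.factorial : k)⁻¹ • (gaugeField g y ^ n) (1, x) =
      (if n = 0 then 1 else 0, gaugeTerm y x n) := by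
  induction n with
  | zero => simp [gaugeTerm]
  | succ n ih =>
    rw [pow_succ', Module.End.mul_apply, Nat.factorial_succ, Nat.cast_mul, mul_inv, mul_smul,
      ← map_smul, ih, gaugeField_apply, gaugeTerm]
    refine Prod.ext (by simp) ?_
    by_cases h : n = 0 <;> simp [h]

/-- The vanishing beyond `N` is kept along with the finite sum, so that later arguments can enlarge
the range of summation freely. -/
lemma exists_gauge_eq_sum [g.IsNilpotent] (γ : ExpGroup k g.Zero) (x : g.carrier) :
    ∃ N, (∀ n, N ≤ n → gaugeTerm γ.log x n = 0) ∧
      gauge γ x = ∑ n ∈ Finset.range N, gaugeTerm γ.log x n := by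
  obtain ⟨N, hN⟩ := gaugeField_isNilpotent γ.log
  refine ⟨N, fun n hn => ?_, ?_⟩
  · have := smul_gaugeField_pow γ.log x n
    rw [pow_eq_zero_of_le hn hN, LinearMap.zero_apply, smul_zero] at this
    exact (congrArg Prod.snd this).symm
  · rw [gauge, nilExp_eq_sum k hN, LinearMap.sum_apply, Prod.snd_sum]
    refine Finset.sum_congr rfl fun n _ => ?_
    rw [LinearMap.smul_apply, smul_gaugeField_pow]

lemma gaugeTerm_mem (y : g.Zero) {x : g.carrier} (hx : x ∈ g.deg 1) (n : ℕ) :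
    gaugeTerm y x n ∈ g.deg 1 := by
  induction n with
  | zero => exact hx
  | succ n ih =>
    refine Submodule.smul_mem _ _ (add_mem ?_ (g.br_mem ih (Zero.incl_mem y)))
    split_ifs
    · exact g.d_mem (Zero.incl_mem y)
    · exact zero_mem _

lemma gauge_mem_deg [g.IsNilpotent] (γ : ExpGroup k g.Zero) {x : g.carrier} (hx : x ∈ g.deg 1) :
    gauge γ x ∈ g.deg 1 := by
  obtain ⟨N, -, h⟩ := exists_gauge_eq_sum γ x
  rw [h]
  exact sum_mem fun n _ => gaugeTerm_mem _ hx n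

lemma br_comm_of_mem_one {x y : g.carrier} (hx : x ∈ g.deg 1) (hy : y ∈ g.deg 1) :
    g.br x y = g.br y x := by
  have := g.br_skew hx hy
  simpa using this

/-- The Taylor coefficients of the curvature along the flow of `ρ(y)`. -/
lemma curvature_gaugeTerm (y : g.Zero) {x : g.carrier} (hx : x ∈ g.MC) (n : ℕ) :
    g.d (gaugeTerm y x n) + (1 / 2 : k) • ∑ p ∈ Finset.HasAntidiagonal.antidiagonal n,
      g.br (gaugeTerm y x p.1) (gaugeTerm y x p.2) = 0 := by
  induction n with
  | zero => simpa [gaugeTerm] using hx.2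
  | succ n ih =>
    set X := gaugeTerm y x with hX
    set w := Zero.incl g y with hw
    have hm : ∀ n, X n ∈ g.deg 1 := gaugeTerm_mem y hx.1
    have hs : ∀ n, ((n + 1 : ℕ) : k) • X (n + 1) = (if n = 0 then g.d w else 0) + g.br (X n) w :=
      smul_gaugeTerm_succ y x
    -- The aim is the coefficient form of `F' = [F, w]` for the curvature `F = dX + ½[X, X]` along a
    -- solution of `X' = dw + [X, w]`. Together with `F(0) = 0` it kills all coefficients. Here is
    -- the contribution of `dX'`.
    have hd : ((n + 1 : ℕ) : k) • g.d (X (n + 1)) = g.br (g.d (X n)) w - g.br (X n) (g.d w) := by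
      rw [← map_smul, hs, map_add, g.d_br _ (hm n)]
      split_ifs <;> simp [g.d_d, sub_eq_add_neg]
    have hsw : ∀ (m : ℕ) (f : ℕ → ℕ → g.carrier),
        ∑ p ∈ Finset.HasAntidiagonal.antidiagonal m, f p.1 p.2 =
        ∑ p ∈ Finset.HasAntidiagonal.antidiagonal m, f p.2 p.1 := fun m f =>
      (Finset.Nat.sum_antidiagonal_swap (f := fun p : ℕ × ℕ => f p.1 p.2)).symm
    -- `[X, X]' = 2[X, X']`, because the bracket is symmetric in degree one.
    have h1 : ((n + 1 : ℕ) : k) • ∑ p ∈ Finset.HasAntidiagonal.antidiagonal (n + 1),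
        g.br (X p.1) (X p.2) = (2 : k) • ∑ p ∈ Finset.HasAntidiagonal.antidiagonal (n + 1),
          g.br (X p.1) ((p.2 : k) • X p.2) := by
      have e : ∑ p ∈ Finset.HasAntidiagonal.antidiagonal (n + 1),
          g.br (X p.1) ((p.2 : k) • X p.2) = ∑ p ∈ Finset.HasAntidiagonal.antidiagonal (n + 1),
          (p.1 : k) • g.br (X p.1) (X p.2) := by
        rw [hsw (n + 1) fun i j => g.br (X i) ((j : k) • X j)]
        exact Finset.sum_congr rfl fun p _ => by rw [map_smul, br_comm_of_mem_one (hm _) (hm _)]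
      rw [two_smul]
      nth_rewrite 1 [e]
      rw [Finset.smul_sum, ← Finset.sum_add_distrib]
      refine Finset.sum_congr rfl fun p hp => ?_
      rw [map_smul, ← add_smul, ← Nat.cast_add, Finset.HasAntidiagonal.mem_antidiagonal.1 hp]
    have h2 : ∑ p ∈ Finset.HasAntidiagonal.antidiagonal (n + 1), g.br (X p.1) ((p.2 : k) • X p.2) =
        g.br (X n) (g.d w) +
          ∑ p ∈ Finset.HasAntidiagonal.antidiagonal n, g.br (X p.1) (g.br (X p.2) w) := by
      rw [Finset.Nat.sum_antidiagonal_succ']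
      simp only [Nat.cast_zero, zero_smul, map_zero, zero_add, hs, map_add,
        Finset.sum_add_distrib]
      congr 1
      rw [Finset.sum_eq_single (n, 0)]
      · simp
      · rintro ⟨i, j⟩ hp hne
        rw [Finset.HasAntidiagonal.mem_antidiagonal] at hp
        rw [if_neg, map_zero]
        rintro rfl
        exact hne (by simpa using hp)
      · simp
    -- The Jacobi identity in degree one, symmetrized over the antidiagonal: `2[X, [X, w]] = [[X,
    -- X], w]`.
    have h3 : (2 : k) • ∑ p ∈ Finset.HasAntidiagonal.antidiagonal n, g.br (X p.1) (g.br (X p.2) w) =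
        g.br (∑ p ∈ Finset.HasAntidiagonal.antidiagonal n, g.br (X p.1) (X p.2)) w := by
      rw [two_smul, map_sum, LinearMap.sum_apply]
      nth_rewrite 2 [hsw n fun i j => g.br (X i) (g.br (X j) w)]
      rw [← Finset.sum_add_distrib]
      refine Finset.sum_congr rfl fun p _ => ?_
      rw [g.jacobi w (hm p.1) (hm p.2)]
      simp
    -- The two occurrences of `[X, dw]` cancel, and what remains is the bracket of the previous
    -- coefficient of `F` with `w`.
    have h4 : ((n + 1 : ℕ) : k) • (g.d (X (n + 1)) + (1 / 2 : k) •
        ∑ p ∈ Finset.HasAntidiagonal.antidiagonal (n + 1), g.br (X p.1) (X p.2)) = 0 := by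
      rw [smul_add, smul_comm _ (1 / 2 : k), h1, hd, h2, smul_smul, smul_add, one_div,
        inv_mul_cancel₀ two_ne_zero, one_smul, one_smul]
      have := congrArg (fun v => g.br v w) ih
      simp only [map_add, map_smul, LinearMap.add_apply, LinearMap.smul_apply, map_zero,
        LinearMap.zero_apply, ← h3, smul_smul, one_div, inv_mul_cancel₀ (two_ne_zero (α := k)),
        one_smul] at this
      rw [← this]
      abel
    exact (smul_eq_zero.1 h4).resolve_left (Nat.cast_ne_zero.2 (Nat.succ_ne_zero n))

/-- The gauge group acts on the Maurer-Cartan elements. -/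
lemma gauge_mem_MC [g.IsNilpotent] (γ : ExpGroup k g.Zero) {x : g.carrier} (hx : x ∈ g.MC) :
    gauge γ x ∈ g.MC := by
  refine ⟨gauge_mem_deg γ hx.1, ?_⟩
  obtain ⟨N, h0, h⟩ := exists_gauge_eq_sum γ x
  set X := gaugeTerm γ.log x
  -- The product of two polynomials with coefficients below `N` is supported below `N + N`;
  -- regrouping by total degree makes it comparable with the curvature coefficients.
  have hbr : g.br (gauge γ x) (gauge γ x) = ∑ n ∈ Finset.range (N + N),
      ∑ p ∈ Finset.HasAntidiagonal.antidiagonal n, g.br (X p.1) (X p.2) := by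
    have e : g.br (gauge γ x) (gauge γ x) =
        ∑ p ∈ Finset.range N ×ˢ Finset.range N, g.br (X p.1) (X p.2) := by
      rw [h, map_sum, Finset.sum_product_right]
      exact Finset.sum_congr rfl fun i _ => by rw [map_sum, LinearMap.sum_apply]
    rw [e, ← Finset.sum_fiberwise_of_maps_to (g := fun p : ℕ × ℕ => p.1 + p.2)
      (t := Finset.range (N + N))]
    · refine Finset.sum_congr rfl fun n _ => Finset.sum_subset (fun p hp => ?_) fun p hp hp' => ?_
      · exact Finset.HasAntidiagonal.mem_antidiagonal.2 (Finset.mem_filter.1 hp).2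
      · rw [Finset.HasAntidiagonal.mem_antidiagonal] at hp
        simp only [Finset.mem_filter, Finset.mem_product, Finset.mem_range, hp, and_true,
          not_and_or, not_lt] at hp'
        rcases hp' with hp' | hp' <;> simp [h0 _ hp']
    · intro p hp
      simp only [Finset.mem_product, Finset.mem_range] at hp ⊢
      omega
  have hd : g.d (gauge γ x) = ∑ n ∈ Finset.range (N + N), g.d (X n) := by
    rw [h, map_sum]
    refine Finset.sum_subset (Finset.range_mono (Nat.le_add_right N N)) fun n _ hn => ?_
    rw [h0 n (by simpa using hn), map_zero]
  rw [hbr, hd, Finset.smul_sum, ← Finset.sum_add_distrib]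
  exact Finset.sum_eq_zero fun n _ => curvature_gaugeTerm γ.log hx n

end GaugeExpansion

end DGLie

/-! ### The Poincaré lemma for polynomial forms on the simplex. -/

namespace SimplexForms

variable {k : Type u} [Field k] {n : ℕ}

/-- The algebra homomorphism `a ↦ !![± a, ι a; 0, a]`, where `ι` is the contraction with the Euler
vector field of the affine space with origin the vertex `0`. -/
noncomputable def contractJet :
    SimplexForms k n →ₐ[k] Matrix (Fin 2) (Fin 2) (SimplexForms k n) :=
  lift (fun i => !![t i, 0; 0, t i]) (fun i => !![-dt i, t i - if i = 0 then 1 else 0; 0, dt i])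
    (fun i j => by
      simp only [Matrix.mul_fin_two]
      rw [t_mul_t i j]
      simp)
    (fun i j => by
      have : ∀ c : SimplexForms k n, t i * (t j - if j = 0 then c else 0) =
          (t j * t i - if j = 0 then t i * c else 0) := by
        intro c; split_ifs <;> simp [mul_sub, t_mul_t i j]
      simp only [Matrix.mul_fin_two]
      simp [t_mul_dt i j, this, sub_mul])
    (fun i j => by
      have e : ∀ i j : Fin (n + 1), dt i * (t j - if j = 0 then (1 : SimplexForms k n) else 0) =
          (t j - if j = 0 then 1 else 0) * dt i := by
        intro i j; split_ifs <;> simp [mul_sub, sub_mul, t_mul_dt j i]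
      simp only [Matrix.mul_fin_two]
      ext a b
      fin_cases a <;> fin_cases b <;> simp [dt_mul_dt i j, e, add_comm])
    (by
      ext a b
      rw [Matrix.sum_apply]
      fin_cases a <;> fin_cases b <;> simp [sum_t])
    (by
      ext a b
      rw [Matrix.sum_apply]
      fin_cases a <;> fin_cases b <;> simp [sum_dt, sum_t])

variable (k n) in
/-- The contraction with the Euler vector field centered at the vertex `0`. -/
noncomputable def contract : SimplexForms k n →ₗ[k] SimplexForms k n :=
  Matrix.entryLinearMap k (SimplexForms k n) 0 1 ∘ₗ contractJet.toLinearMap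

lemma contract_apply (a : SimplexForms k n) : contract k n a = contractJet a 0 1 := rfl

lemma contractJet_one_one (a : SimplexForms k n) : contractJet a 1 1 = a := by
  refine induction (P := fun a => contractJet a 1 1 = a) ?_ ?_ ?_ ?_ ?_ ?_ a
  · simp
  · intro i a h; rw [map_mul, Matrix.mul_apply, Fin.sum_univ_two, h]; simp [contractJet]
  · intro i a h; rw [map_mul, Matrix.mul_apply, Fin.sum_univ_two, h]; simp [contractJet]
  · simp
  · intro a b ha hb; rw [map_add, Matrix.add_apply, ha, hb]
  · intro c a ha; rw [map_smul, Matrix.smul_apply, ha]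

lemma contract_one : contract k n 1 = 0 := by simp [contract_apply]

lemma contract_t_mul (i) (a : SimplexForms k n) : contract k n (t i * a) = t i * contract k n a := by
  simp only [contract_apply]
  rw [map_mul, Matrix.mul_apply, Fin.sum_univ_two]
  simp [contractJet]

lemma contract_dt_mul (i) (a : SimplexForms k n) :
    contract k n (dt i * a) = (t i - if i = 0 then 1 else 0) * a - dt i * contract k n a := by
  simp only [contract_apply]
  rw [map_mul, Matrix.mul_apply, Fin.sum_univ_two, contractJet_one_one]
  simp [contractJet, sub_eq_add_neg, add_comm]

/-- Degrees are natural numbers, so lowering by one must be stated separately in degree zero. The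
two halves are proved together because the step for `dtᵢ` applied to a function needs the vanishing
half. -/
lemma contract_mem_aux {p : ℕ} {a : SimplexForms k n} (ha : a ∈ deg k n p) :
    (p = 0 → contract k n a = 0) ∧ ∀ q, p = q + 1 → contract k n a ∈ deg k n q := by
  refine deg_induction (P := fun p a => (p = 0 → contract k n a = 0) ∧
    ∀ q, p = q + 1 → contract k n a ∈ deg k n q) ?_ ?_ ?_ ?_ ?_ ?_ ha
  · exact ⟨fun _ => contract_one, fun _ h => by omega⟩
  · intro i p a _ h
    refine ⟨fun hp => by rw [contract_t_mul, h.1 hp, mul_zero], fun q hq => ?_⟩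
    rw [contract_t_mul]
    simpa using mul_mem (t_mem i) (h.2 q hq)
  · intro i p a ha h
    refine ⟨fun hp => by omega, fun q hq => ?_⟩
    obtain rfl : p = q := by omega
    rw [contract_dt_mul]
    refine sub_mem ?_ ?_
    · have : (t i - if i = 0 then 1 else 0 : SimplexForms k n) ∈ deg k n 0 := by
        refine sub_mem (t_mem i) ?_
        split_ifs
        · exact one_mem
        · exact zero_mem _
      simpa using mul_mem this ha
    · rcases p with _ | p
      · rw [h.1 rfl, mul_zero]; exact zero_mem _
      · simpa [add_comm] using mul_mem (dt_mem i) (h.2 p rfl)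
  · exact ⟨fun _ => map_zero _, fun _ _ => by rw [map_zero]; exact zero_mem _⟩
  · intro a b ha hb
    exact ⟨fun hp => by rw [map_add, ha.1 hp, hb.1 hp, add_zero],
      fun q hq => by rw [map_add]; exact add_mem (ha.2 q hq) (hb.2 q hq)⟩
  · intro c a ha
    exact ⟨fun hp => by rw [map_smul, ha.1 hp, smul_zero],
      fun q hq => by rw [map_smul]; exact Submodule.smul_mem _ c (ha.2 q hq)⟩

lemma contract_eq_zero {a : SimplexForms k n} (ha : a ∈ deg k n 0) : contract k n a = 0 :=
  (contract_mem_aux ha).1 rfl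

lemma contract_mem {p : ℕ} {a : SimplexForms k n} (ha : a ∈ deg k n (p + 1)) :
    contract k n a ∈ deg k n p := (contract_mem_aux ha).2 p rfl

lemma eval_t (i j : Fin (n + 1)) : eval (k := k) i (t j) = if j = i then 1 else 0 := by
  simp [eval]

lemma eval_dt (i j : Fin (n + 1)) : eval (k := k) i (dt j) = 0 := by simp [eval]

/-- The Euler vector field vanishes at its centre, the vertex `0`. -/
lemma eval_contract (a : SimplexForms k n) : eval 0 (contract k n a) = 0 := by
  refine induction (P := fun a => eval 0 (contract k n a) = 0) ?_ ?_ ?_ ?_ ?_ ?_ a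
  · rw [contract_one, map_zero]
  · intro i a h; rw [contract_t_mul, map_mul, h, mul_zero]
  · intro i a h
    rw [contract_dt_mul, map_sub, map_mul, map_mul, eval_dt, map_sub, eval_t]
    split_ifs <;> simp
  · simp
  · intro a b ha hb; rw [map_add, map_add, ha, hb, add_zero]
  · intro c a ha; rw [map_smul, map_smul, ha, smul_zero]

/-- The words in the generators other than `t₀` and `dt₀`. -/
def word (l : List (Fin n ⊕ Fin n)) : SimplexForms k n :=
  (l.map fun s => gen (s.map Fin.succ Fin.succ)).prod

lemma word_nil : word (k := k) (n := n) [] = 1 := rfl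

lemma word_inl (i : Fin n) (l : List (Fin n ⊕ Fin n)) :
    word (k := k) (Sum.inl i :: l) = t i.succ * word l := by
  rw [word, List.map_cons, List.prod_cons]; rfl

lemma word_inr (i : Fin n) (l : List (Fin n ⊕ Fin n)) :
    word (k := k) (Sum.inr i :: l) = dt i.succ * word l := by
  rw [word, List.map_cons, List.prod_cons]; rfl

lemma word_mem (l : List (Fin n ⊕ Fin n)) : word l ∈ deg k n (l.countP Sum.isRight) := by
  induction l with
  | nil => exact one_mem
  | cons s l ih =>
    cases s with
    | inl i => rw [word_inl]; simpa using mul_mem (t_mem i.succ) ih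
    | inr i =>
      rw [word_inr, List.countP_cons_of_pos rfl, add_comm]
      exact mul_mem (dt_mem i.succ) ih

/-- The relations eliminate `t₀ = 1 - ∑ tᵢ` and `dt₀ = -∑ dtᵢ`. The remaining generators are
homogeneous for the Euler field centred at the vertex `0`, which makes the length of a word
meaningful. -/
lemma deg_le_span_word (p : ℕ) :
    deg k n p ≤ Submodule.span k {w | ∃ l : List (Fin n ⊕ Fin n),
      l.countP Sum.isRight = p ∧ w = word l} := by
  intro a ha
  refine deg_induction (P := fun p a => a ∈ Submodule.span k {w | ∃ l : List (Fin n ⊕ Fin n),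
      l.countP Sum.isRight = p ∧ w = word l}) ?_ ?_ ?_ (zero_mem _) (fun _ _ => add_mem)
      (fun c _ => Submodule.smul_mem _ c) ha
  · exact Submodule.subset_span ⟨[], rfl, rfl⟩
  · intro i q a haq h
    clear haq
    have hs : ∀ j : Fin n, t j.succ * a ∈ Submodule.span k {w | ∃ l : List (Fin n ⊕ Fin n),
        l.countP Sum.isRight = q ∧ w = word l} := by
      intro j
      induction h using Submodule.span_induction with
      | mem w hw =>
        obtain ⟨l, hl, rfl⟩ := hw
        exact Submodule.subset_span ⟨Sum.inl j :: l, by simpa using hl, (word_inl j l).symm⟩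
      | zero => rw [mul_zero]; exact zero_mem _
      | add x y _ _ hx hy => rw [mul_add]; exact add_mem hx hy
      | smul c x _ hx => rw [mul_smul_comm]; exact Submodule.smul_mem _ c hx
    refine Fin.cases ?_ hs i
    have := sum_t (k := k) (n := n)
    rw [Fin.sum_univ_succ, ← eq_sub_iff_add_eq] at this
    rw [this, sub_mul, one_mul, Finset.sum_mul]
    exact sub_mem h (sum_mem fun j _ => hs j)
  · intro i q a haq h
    clear haq
    have hs : ∀ j : Fin n, dt j.succ * a ∈ Submodule.span k {w | ∃ l : List (Fin n ⊕ Fin n),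
        l.countP Sum.isRight = q + 1 ∧ w = word l} := by
      intro j
      induction h using Submodule.span_induction with
      | mem w hw =>
        obtain ⟨l, hl, rfl⟩ := hw
        exact Submodule.subset_span ⟨Sum.inr j :: l, by
          rw [List.countP_cons_of_pos rfl, hl], (word_inr j l).symm⟩
      | zero => rw [mul_zero]; exact zero_mem _
      | add x y _ _ hx hy => rw [mul_add]; exact add_mem hx hy
      | smul c x _ hx => rw [mul_smul_comm]; exact Submodule.smul_mem _ c hx
    refine Fin.cases ?_ hs i
    have := sum_dt (k := k) (n := n)
    rw [Fin.sum_univ_succ, add_eq_zero_iff_eq_neg] at this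
    rw [this, neg_mul, Finset.sum_mul]
    exact neg_mem (sum_mem fun j _ => hs j)

lemma word_induction {P : SimplexForms k n → Prop} (word : ∀ l, P (word l)) (zero : P 0)
    (add : ∀ a b, P a → P b → P (a + b)) (smul : ∀ (c : k) a, P a → P (c • a))
    (a : SimplexForms k n) : P a := by
  refine Submodule.iSup_induction (deg k n) (motive := P) (by rw [iSup_deg]; trivial)
    (fun p a ha => ?_) zero add
  refine Submodule.span_induction (p := fun a _ => P a) ?_ zero (fun a b _ _ => add a b)
    (fun c a _ => smul c a) (deg_le_span_word p ha)
  rintro _ ⟨l, -, rfl⟩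
  exact word l

variable (k n) in
/-- The span of the words of a given length in the generators other than `t₀` and `dt₀`. -/
def weight (w : ℕ) : Submodule k (SimplexForms k n) :=
  Submodule.span k {a | ∃ l : List (Fin n ⊕ Fin n), l.length = w ∧ a = word l}

lemma word_mem_weight (l : List (Fin n ⊕ Fin n)) : word l ∈ weight k n l.length :=
  Submodule.subset_span ⟨l, rfl, rfl⟩

/-- Word length is well defined because it is read off from an algebra endomorphism `T`, the
pullback along dilation by `2` about the vertex `0`. This explains the correction by `1` in the
image of `t₀`: `T` multiplies a word of length `w` by `2ʷ`. -/
lemma weight_isInternal [CharZero k] : DirectSum.IsInternal (weight k n) := by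
  let T : SimplexForms k n →ₐ[k] SimplexForms k n :=
    lift (fun i => (2 : k) • t i - if i = 0 then 1 else 0) (fun i => (2 : k) • dt i)
    (fun i j => by
      have := t_mul_t (k := k) i j
      split_ifs <;> simp [mul_sub, sub_mul, this, smul_sub] <;> abel)
    (fun i j => by
      have := t_mul_dt (k := k) i j
      split_ifs <;> simp [mul_sub, sub_mul, this, smul_sub])
    (fun i j => by simp only [mul_smul_comm, smul_mul_assoc]; rw [dt_mul_dt, smul_neg, smul_neg])
    (by
      rw [Finset.sum_sub_distrib, ← Finset.smul_sum, sum_t, two_smul]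
      simp) (by rw [← Finset.smul_sum, sum_dt, smul_zero])
  refine isInternal_of_eigen T.toLinearMap (fun w a ha => ?_) ?_
  · have hT : ∀ l, T (word l) = (2 : k) ^ l.length • word l := by
      intro l
      induction l with
      | nil => simp [word_nil]
      | cons s l ih =>
        cases s with
        | inl i => rw [word_inl, map_mul, ih, mul_smul_comm]; simp [T, pow_succ, mul_smul]
        | inr i => rw [word_inr, map_mul, ih, mul_smul_comm]; simp [T, pow_succ, mul_smul]
    change T a = _
    induction ha using Submodule.span_induction with
    | mem a ha => obtain ⟨l, rfl, rfl⟩ := ha; exact hT l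
    | zero => simp
    | add x y _ _ hx hy => rw [map_add, hx, hy, smul_add]
    | smul c x _ hx => rw [map_smul, hx, smul_comm]
  · rw [eq_top_iff]
    intro a _
    exact word_induction (P := fun a => a ∈ ⨆ w, weight k n w)
      (fun l => Submodule.mem_iSup_of_mem _ (word_mem_weight l)) (zero_mem _) (fun _ _ => add_mem)
      (fun c _ => Submodule.smul_mem _ c) a

/-- The differential replaces one letter `tᵢ` by `dtᵢ`, so it preserves length. Consequently
dividing by the length commutes with `d`. -/
lemma d_word_mem (l : List (Fin n ⊕ Fin n)) : d k n (word l) ∈ weight k n l.length := by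
  have hmem : ∀ (s : Fin n ⊕ Fin n) (w : ℕ), ∀ a ∈ weight k n w,
      gen (s.map Fin.succ Fin.succ) * a ∈ weight k n (w + 1) := by
    intro s w a ha
    induction ha using Submodule.span_induction with
    | mem a ha =>
      obtain ⟨l, rfl, rfl⟩ := ha
      exact Submodule.subset_span ⟨s :: l, rfl, rfl⟩
    | zero => rw [mul_zero]; exact zero_mem _
    | add x y _ _ hx hy => rw [mul_add]; exact add_mem hx hy
    | smul c x _ hx => rw [mul_smul_comm]; exact Submodule.smul_mem _ c hx
  induction l with
  | nil => rw [word_nil, d_one]; exact zero_mem _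
  | cons s l ih =>
    cases s with
    | inl i =>
      rw [word_inl, d_t_mul]
      exact add_mem (hmem (Sum.inr i) _ _ (word_mem_weight l)) (hmem (Sum.inl i) _ _ ih)
    | inr i =>
      rw [word_inr, d_dt_mul]
      exact neg_mem (hmem (Sum.inr i) _ _ ih)

/-- Cartan's formula: `dι + ιd` is the Lie derivative along the Euler field, which counts letters.
-/
lemma lieDerivative_word (l : List (Fin n ⊕ Fin n)) :
    d k n (contract k n (word l)) + contract k n (d k n (word l)) = (l.length : k) • word l := by
  induction l with
  | nil => simp [word_nil, contract_one, d_one]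
  | cons s l ih =>
    rw [List.length_cons, Nat.cast_succ, add_smul, one_smul]
    cases s with
    | inl i =>
      rw [word_inl, contract_t_mul, d_t_mul, d_t_mul, map_add, contract_t_mul, contract_dt_mul,
        if_neg (Fin.succ_ne_zero i), sub_zero, ← mul_smul_comm, ← ih, mul_add]
      abel
    | inr i =>
      rw [word_inr, contract_dt_mul, d_dt_mul, map_neg, contract_dt_mul,
        if_neg (Fin.succ_ne_zero i), sub_zero, map_sub, d_t_mul, d_dt_mul, ← mul_smul_comm, ← ih,
        mul_add]
      abel

variable [CharZero k]

variable (k n) in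
/-- A homotopy contracting the forms on the simplex to the vertex `0`. -/
noncomputable def homotopy : SimplexForms k n →ₗ[k] SimplexForms k n :=
  contract k n ∘ₗ gradedScale weight_isInternal fun w => (w : k)⁻¹

lemma gradedScale_word (l : List (Fin n ⊕ Fin n)) :
    gradedScale (weight_isInternal (k := k) (n := n)) (fun w => (w : k)⁻¹) (word l) =
      (l.length : k)⁻¹ • word l :=
  gradedScale_of_mem _ _ (word_mem_weight l)

lemma gradedScale_mem_deg {p : ℕ} {a : SimplexForms k n} (ha : a ∈ deg k n p) :
    gradedScale (weight_isInternal (k := k) (n := n)) (fun w => (w : k)⁻¹) a ∈ deg k n p := by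
  refine Submodule.span_induction (p := fun a _ => gradedScale (weight_isInternal (k := k) (n := n))
    (fun w => (w : k)⁻¹) a ∈ deg k n p) ?_ (by rw [map_zero]; exact zero_mem _)
    (fun a b _ _ ha hb => by rw [map_add]; exact add_mem ha hb)
    (fun c a _ ha => by rw [map_smul]; exact Submodule.smul_mem _ c ha) (deg_le_span_word p ha)
  rintro _ ⟨l, rfl, rfl⟩
  rw [gradedScale_word]
  exact Submodule.smul_mem _ _ (word_mem l)

lemma homotopy_eq_zero {a : SimplexForms k n} (ha : a ∈ deg k n 0) : homotopy k n a = 0 :=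
  contract_eq_zero (gradedScale_mem_deg ha)

lemma homotopy_mem {p : ℕ} {a : SimplexForms k n} (ha : a ∈ deg k n (p + 1)) :
    homotopy k n a ∈ deg k n p := contract_mem (gradedScale_mem_deg ha)

lemma eval_homotopy (a : SimplexForms k n) : eval 0 (homotopy k n a) = 0 := eval_contract _

/-- On words of positive length the Lie derivative is invertible, and dividing the contraction by
the length gives a homotopy. Such words vanish at the vertex `0`, while the constants are what
remains. -/
lemma d_homotopy_add (a : SimplexForms k n) :
    d k n (homotopy k n a) + homotopy k n (d k n a) = a - eval 0 a • 1 := by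
  refine word_induction (P := fun a => d k n (homotopy k n a) + homotopy k n (d k n a) =
    a - eval 0 a • 1) (fun l => ?_) (by simp) (fun a b ha hb => ?_) (fun c a ha => ?_) a
  · have h1 : homotopy k n (word l) = (l.length : k)⁻¹ • contract k n (word l) := by
      rw [homotopy, LinearMap.comp_apply, gradedScale_word, map_smul]
    have h2 : homotopy k n (d k n (word l)) = (l.length : k)⁻¹ • contract k n (d k n (word l)) := by
      rw [homotopy, LinearMap.comp_apply, gradedScale_of_mem _ _ (d_word_mem l), map_smul]
    rw [h1, h2, map_smul, ← smul_add, lieDerivative_word, smul_smul]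
    -- For the empty word the inverse of the length is `0⁻¹ = 0`, and both sides vanish.
    rcases l with _ | ⟨s, l⟩
    · simp [word_nil]
    · have : eval 0 (word (k := k) (s :: l)) = 0 := by
        cases s with
        | inl i => rw [word_inl, map_mul, eval_t, if_neg (Fin.succ_ne_zero i), zero_mul]
        | inr i => rw [word_inr, map_mul, eval_dt, zero_mul]
      rw [this, inv_mul_cancel₀ (Nat.cast_ne_zero.2 (by simp))]
      simp
  · simp only [map_add, add_smul]
    rw [add_sub_add_comm, ← ha, ← hb]
    abel
  · simp only [map_smul, smul_assoc]
    rw [← smul_add, ha, smul_sub]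

end SimplexForms

/-! ### The leading term of the gauge action and the filtration of `A ⊗ g`. -/

namespace DGLie

open TensorProduct

variable {k : Type u} [Field k] [CharZero k]

/-- The part of first order in `log γ` is isolated; every term of the remaining sum is a bracket
with `log γ`, hence lies deeper in any filtration compatible with the bracket. -/
lemma exists_gauge_eq_add_sum {g : DGLie k} [g.IsNilpotent] (γ : ExpGroup k g.Zero)
    (x : g.carrier) : ∃ N, gauge γ x =
      x + (g.d (Zero.incl g γ.log) + g.br x (Zero.incl g γ.log)) +
        ∑ n ∈ Finset.range N, gaugeTerm γ.log x (n + 2) := by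
  obtain ⟨N, h0, h⟩ := exists_gauge_eq_sum γ x
  refine ⟨N, ?_⟩
  have h1 : gaugeTerm γ.log x 1 = g.d (Zero.incl g γ.log) + g.br x (Zero.incl g γ.log) := by
    simp [gaugeTerm]
  have h2 : gaugeTerm γ.log x 0 = x := rfl
  rw [h, ← h1, Finset.sum_subset (Finset.range_mono (Nat.le_add_right N 2))
    (fun n _ hn => h0 n (by simpa using hn)), Finset.sum_range_succ', Finset.sum_range_succ', h2]
  abel

lemma gaugeTerm_add_two {g : DGLie k} (y : g.Zero) (x : g.carrier) (n : ℕ) :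
    gaugeTerm y x (n + 2) =
      ((n + 2 : ℕ) : k)⁻¹ • g.br (gaugeTerm y x (n + 1)) (Zero.incl g y) := by
  rw [gaugeTerm, if_neg (Nat.succ_ne_zero n), zero_add]

/-- The action of `exp y` is `x ↦ x + dy` up to brackets with `y`. -/
lemma gauge_sub_mem {g : DGLie k} [g.IsNilpotent] (γ : ExpGroup k g.Zero) (x : g.carrier)
    {F : Submodule k g.carrier} (hF : ∀ z, g.br z (Zero.incl g γ.log) ∈ F) :
    gauge γ x - x - g.d (Zero.incl g γ.log) ∈ F := by
  obtain ⟨N, h⟩ := exists_gauge_eq_add_sum γ x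
  have : gauge γ x - x - g.d (Zero.incl g γ.log) = g.br x (Zero.incl g γ.log) +
      ∑ n ∈ Finset.range N, gaugeTerm γ.log x (n + 2) := by rw [h]; abel
  rw [this]
  refine add_mem (hF x) (sum_mem fun n _ => ?_)
  rw [gaugeTerm_add_two]
  exact F.smul_mem _ (hF _)

lemma lcs_succ_le {g : DGLie k} (i : ℕ) : g.lcs (i + 1) ≤ g.lcs i := by
  induction i with
  | zero => exact le_top
  | succ i ih =>
    refine Submodule.span_mono ?_
    rintro _ ⟨x, y, hy, rfl⟩
    exact ⟨x, y, ih hy, rfl⟩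

section LcsTensor

variable {A : CDGA k} {g : DGLie k}

variable (A g) in
/-- The filtration of `A ⊗ g` induced by the lower central series of `g`. -/
noncomputable def lcsTensor (i : ℕ) : Submodule k (tensor A g).carrier :=
  Submodule.span k {t : A.carrier ⊗[k] g.carrier | ∃ a x, x ∈ g.lcs i ∧ t = a ⊗ₜ[k] x}

lemma lcsTensor_zero : lcsTensor A g 0 = ⊤ := by
  rw [eq_top_iff]
  intro (z : A.carrier ⊗[k] g.carrier) _
  induction z using TensorProduct.induction_on with
  | zero => exact zero_mem _
  | add x y hx hy => exact add_mem (hx trivial) (hy trivial)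
  | tmul a x => exact Submodule.subset_span ⟨a, x, trivial, rfl⟩

lemma lcsTensor_eq_bot {i : ℕ} (h : g.lcs i = ⊥) : lcsTensor A g i = ⊥ := by
  rw [eq_bot_iff]
  refine Submodule.span_le.2 ?_
  rintro _ ⟨a, x, hx, rfl⟩
  rw [h, Submodule.mem_bot] at hx
  rw [hx, tmul_zero]
  exact zero_mem _

lemma lcsTensor_succ_le (i : ℕ) : lcsTensor A g (i + 1) ≤ lcsTensor A g i := by
  refine Submodule.span_mono ?_
  rintro _ ⟨a, x, hx, rfl⟩
  exact ⟨a, x, lcs_succ_le i hx, rfl⟩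

lemma br_mem_lcsTensor {i : ℕ} (x : (tensor A g).carrier) {y : (tensor A g).carrier}
    (hy : y ∈ lcsTensor A g i) : (tensor A g).br x y ∈ lcsTensor A g (i + 1) :=
  tensorBr_mem_span i x hy

/-- Only the factor `A` is touched. This stability under a homotopy of `A` is the reason for
filtering by the lower central series of `g` alone. -/
lemma rTensor_mem_span {i : ℕ} (φ : A.carrier →ₗ[k] A.carrier) {y : A.carrier ⊗[k] g.carrier}
    (hy : y ∈ Submodule.span k {t : A.carrier ⊗[k] g.carrier | ∃ a x, x ∈ g.lcs i ∧
      t = a ⊗ₜ[k] x}) : LinearMap.rTensor g.carrier φ y ∈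
        Submodule.span k {t : A.carrier ⊗[k] g.carrier | ∃ a x, x ∈ g.lcs i ∧ t = a ⊗ₜ[k] x} := by
  induction hy using Submodule.span_induction with
  | zero => rw [map_zero]; exact zero_mem _
  | add u v _ _ hu hv => rw [map_add]; exact add_mem hu hv
  | smul c u _ hu => rw [map_smul]; exact Submodule.smul_mem _ c hu
  | mem z hz =>
    obtain ⟨a, x, hx, rfl⟩ := hz
    exact Submodule.subset_span ⟨φ a, x, hx, rfl⟩

lemma map_mem_lcsTensor {i : ℕ} (φ : A.carrier →ₗ[k] A.carrier) {y : (tensor A g).carrier}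
    (hy : y ∈ lcsTensor A g i) : LinearMap.rTensor g.carrier φ y ∈ lcsTensor A g i :=
  rTensor_mem_span φ hy

end LcsTensor

end DGLie

/-! ### Contractible coefficients: Maurer-Cartan elements are gauge equivalent to constants. -/

/-- A contraction of a commutative dg algebra onto the base field. -/
structure CDGA.Contraction {k : Type u} [Field k] (A : CDGA k) where
  ε : A.carrier →ₐ[k] k
  ε_eq_zero : ∀ i, ∀ a ∈ A.deg (i + 1), ε a = 0
  /-- The homotopy. -/
  h : A.carrier →ₗ[k] A.carrier
  h_mem : ∀ i, ∀ a ∈ A.deg (i + 1), h a ∈ A.deg i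
  h_eq_zero : ∀ a ∈ A.deg 0, h a = 0
  ε_h : ∀ a, ε (h a) = 0
  d_h_add : ∀ a, A.d (h a) + h (A.d a) = a - ε a • 1

namespace DGLie

open TensorProduct

variable {k : Type u} [Field k] [CharZero k]

section Contraction

variable {A : CDGA k} (H : A.Contraction) {g : DGLie k}

lemma rTensor_h_mem {p : ℕ} {z : A.carrier ⊗[k] g.carrier} (hz : z ∈ tensorDeg A g (p + 1)) :
    LinearMap.rTensor g.carrier H.h z ∈ tensorDeg A g p := by
  refine tensorDeg_induction (p := fun z => LinearMap.rTensor g.carrier H.h z ∈ tensorDeg A g p)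
    ?_ ?_ ?_ ?_ hz
  · intro i j a x h ha hx
    rw [LinearMap.rTensor_tmul]
    cases i with
    | zero =>
      rw [H.h_eq_zero a ha, zero_tmul]
      exact zero_mem _
    | succ i => exact tmul_mem (H.h_mem i a ha) hx (by omega)
  · rw [map_zero]; exact zero_mem _
  · intro x y hx hy; rw [map_add]; exact add_mem hx hy
  · intro c x hx; rw [map_smul]; exact Submodule.smul_mem _ c hx

lemma augment_rTensor_h (z : A.carrier ⊗[k] g.carrier) :
    TensorProduct.lift (LinearMap.lsmul k g.carrier ∘ₗ H.ε.toLinearMap)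
      (LinearMap.rTensor g.carrier H.h z) = 0 := by
  induction z using TensorProduct.induction_on with
  | zero => simp
  | add x y hx hy => rw [map_add, map_add, hx, hy, add_zero]
  | tmul a x => simp [H.ε_h]

/-- Only the `A`-part of the differential contributes. The two terms with `g.d` cancel, since `h`
lowers the degree in `A` by one and so reverses the Koszul sign; in degree zero both are absent. -/
lemma tensorD_rTensor_h_add (z : A.carrier ⊗[k] g.carrier) :
    tensorD A g (LinearMap.rTensor g.carrier H.h z) +
        LinearMap.rTensor g.carrier H.h (tensorD A g z) =
      z - 1 ⊗ₜ TensorProduct.lift (LinearMap.lsmul k g.carrier ∘ₗ H.ε.toLinearMap) z := by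
  refine tensor_induction (p := fun z => tensorD A g (LinearMap.rTensor g.carrier H.h z) +
        LinearMap.rTensor g.carrier H.h (tensorD A g z) =
      z - 1 ⊗ₜ TensorProduct.lift (LinearMap.lsmul k g.carrier ∘ₗ H.ε.toLinearMap) z)
    ?_ ?_ ?_ z
  · intro i j a x ha hx
    have e : A.d (H.h a) ⊗ₜ[k] x + H.h (A.d a) ⊗ₜ[k] x =
        a ⊗ₜ[k] x - (1 : A.carrier) ⊗ₜ[k] (H.ε a • x) := by
      rw [← add_tmul, H.d_h_add, sub_tmul, smul_tmul]
    simp only [LinearMap.rTensor_tmul, tensorD_tmul ha, map_add, map_smul, lift.tmul,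
      LinearMap.comp_apply, AlgHom.toLinearMap_apply, LinearMap.lsmul_apply]
    rw [← e]
    cases i with
    | zero => simp [H.h_eq_zero a ha]
    | succ i =>
      rw [tensorD_tmul (H.h_mem i a ha), pow_succ, mul_neg_one]
      simp only [smul_tmul', neg_smul, neg_tmul]
      abel
  · simp
  · intro x y hx hy
    simp only [map_add, tmul_add]
    rw [add_sub_add_comm, ← hx, ← hy]
    abel

/-- The augmentation `A ⊗ g → g` of a contraction. -/
noncomputable abbrev contractionHom (g : DGLie k) : Hom (tensor A g) g :=
  augment H.ε H.ε_eq_zero g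

/-- The homotopy on `A ⊗ g`. -/
noncomputable def tensorHomotopy (g : DGLie k) : (tensor A g).carrier →ₗ[k] (tensor A g).carrier :=
  LinearMap.rTensor g.carrier H.h

lemma tensorHomotopy_mem {p : ℕ} {z : (tensor A g).carrier} (hz : z ∈ (tensor A g).deg (p + 1)) :
    tensorHomotopy H g z ∈ (tensor A g).deg p := rTensor_h_mem H hz

lemma contractionHom_tensorHomotopy (z : (tensor A g).carrier) :
    (contractionHom H g).toLinearMap (tensorHomotopy H g z) = 0 := augment_rTensor_h H z

lemma d_tensorHomotopy_add (z : (tensor A g).carrier) :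
    (tensor A g).d (tensorHomotopy H g z) + tensorHomotopy H g ((tensor A g).d z) =
      z - (const A g).toLinearMap ((contractionHom H g).toLinearMap z) :=
  tensorD_rTensor_h_add H z

lemma augment_const (ε : A.carrier →ₐ[k] k) (hε : ∀ i, ∀ a ∈ A.deg (i + 1), ε a = 0)
    (x : g.carrier) : (augment ε hε g).toLinearMap ((const A g).toLinearMap x) = x := by
  change TensorProduct.lift (LinearMap.lsmul k g.carrier ∘ₗ ε.toLinearMap)
    ((1 : A.carrier) ⊗ₜ[k] x) = x
  simp

lemma tensorHomotopy_mem_lcsTensor {i : ℕ} {y : (tensor A g).carrier}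
    (hy : y ∈ lcsTensor A g i) : tensorHomotopy H g y ∈ lcsTensor A g i :=
  map_mem_lcsTensor H.h hy

variable [g.IsNilpotent]

/-- One step of the trivialization of a Maurer-Cartan element along the lower central series. -/
lemma exists_gauge_sub_mem_succ {x : g.carrier} (hx : x ∈ g.MC) {i : ℕ} {z : (tensor A g).carrier}
    (hz : z ∈ (tensor A g).MC) (hzx : (contractionHom H g).toLinearMap z = x)
    (hi : z - (const A g).toLinearMap x ∈ lcsTensor A g i) :
    ∃ γ : ExpGroup k (tensor A g).Zero, ExpGroup.map (Zero.map (contractionHom H g)) γ = 1 ∧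
      gauge γ z - (const A g).toLinearMap x ∈ lcsTensor A g (i + 1) := by
  have hc := (const A g).map_mem_MC hx
  have hc0 := augment_const H.ε H.ε_eq_zero x
  generalize (const A g).toLinearMap x = c at hc hi hc0 ⊢
  have hw1 : z - c ∈ (tensor A g).deg 1 := sub_mem hz.1 hc.1
  have hw0 : (contractionHom H g).toLinearMap (z - c) = 0 := by
    rw [map_sub, hzx, hc0, sub_self]
  -- The leading error `z - c` should be removed as a boundary, so the gauge parameter is minus its
  -- homotopy. Its augmentation is zero, hence the value of `z` at the base point does not move.
  let y : (tensor A g).Zero :=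
    (⟨tensorHomotopy H g (z - c), tensorHomotopy_mem H hw1⟩ : (tensor A g).deg 0)
  have hy : Zero.incl _ y = tensorHomotopy H g (z - c) := rfl
  have hyF := tensorHomotopy_mem_lcsTensor H hi
  refine ⟨ExpGroup.exp (-y), ExpGroup.ext (Zero.incl_injective ?_), ?_⟩
  · rw [ExpGroup.log_map, Zero.incl_map, map_neg, map_neg, hy,
      contractionHom_tensorHomotopy, ExpGroup.log_one, map_zero, neg_zero]
  · have h1 := gauge_sub_mem (g := tensor A g) (ExpGroup.exp (-y)) z (F := lcsTensor A g (i + 1))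
      (fun v => br_mem_lcsTensor v (by
        rw [map_neg, hy]
        exact neg_mem hyF))
    have h2 := d_tensorHomotopy_add H (z - c)
    rw [hw0, map_zero, sub_zero] at h2
    -- The difference of the Maurer-Cartan equations of `z` and `c` is `d(z - c) = -½([z, z - c] +
    -- [c, z - c])`: the error is closed one step deeper in the filtration.
    have h3 : (tensor A g).d (z - c) ∈ lcsTensor A g (i + 1) := by
      have e : (tensor A g).d (z - c) =
          -((1 / 2 : k) • ((tensor A g).br z (z - c) + (tensor A g).br c (z - c))) := by
        rw [br_comm_of_mem_one hc.1 hw1, map_sub, eq_neg_of_add_eq_zero_left hz.2,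
          eq_neg_of_add_eq_zero_left hc.2, map_sub, map_sub, LinearMap.sub_apply, smul_add,
          smul_sub, smul_sub]
        abel
      rw [e]
      exact neg_mem (Submodule.smul_mem _ _ (add_mem (br_mem_lcsTensor _ hi)
        (br_mem_lcsTensor _ hi)))
    have h4 := tensorHomotopy_mem_lcsTensor H h3
    -- By the homotopy formula `(z - c) - dy = h d(z - c)`, so the new error consists of brackets
    -- with `y` and the homotopy of the right side of the previous formula.
    have e : gauge (ExpGroup.exp (-y)) z - c =
        (gauge (ExpGroup.exp (-y)) z - z - (tensor A g).d (Zero.incl _ (-y))) +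
          tensorHomotopy H g ((tensor A g).d (z - c)) := by
      rw [← sub_eq_of_eq_add' h2.symm, map_neg, map_neg, hy]
      abel
    rw [e]
    exact add_mem h1 h4

/-- If `A` is contractible, every Maurer-Cartan element of `A ⊗ g` is gauge equivalent to a
constant one. -/
theorem exists_eq_gauge_const_of_contraction {z : (tensor A g).carrier} (hz : z ∈ (tensor A g).MC) :
    ∃ γ : ExpGroup k (tensor A g).Zero, ExpGroup.map (Zero.map (contractionHom H g)) γ = 1 ∧
      z = gauge γ ((const A g).toLinearMap ((contractionHom H g).toLinearMap z)) := by
  have hx := (contractionHom H g).map_mem_MC hz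
  have key : ∀ i, ∃ γ : ExpGroup k (tensor A g).Zero,
      ExpGroup.map (Zero.map (contractionHom H g)) γ = 1 ∧
        gauge γ z - (const A g).toLinearMap ((contractionHom H g).toLinearMap z) ∈
          lcsTensor A g i := by
    intro i
    induction i with
    | zero => exact ⟨1, map_one _, by rw [lcsTensor_zero]; trivial⟩
    | succ i ih =>
      obtain ⟨γ, h1, h2⟩ := ih
      obtain ⟨δ, h3, h4⟩ := exists_gauge_sub_mem_succ H hx (gauge_mem_MC γ hz)
        (by rw [← gauge_map, h1, gauge_one]) h2
      exact ⟨γ * δ, by rw [map_mul, h1, h3, one_mul], by rw [gauge_mul]; exact h4⟩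
  obtain ⟨N, hN⟩ := IsNilpotent.exists_lcs_eq_bot (g := g)
  obtain ⟨γ, h1, h2⟩ := key N
  rw [lcsTensor_eq_bot hN, Submodule.mem_bot, sub_eq_zero] at h2
  -- The `γ` found by induction carries `z` to the constant element, so its inverse gives the
  -- presentation.
  exact ⟨γ⁻¹, by rw [map_inv, h1, inv_one], by rw [← h2, ← gauge_mul, mul_inv_cancel, gauge_one]⟩

end Contraction

/-! ### Contractible coefficients: stabilizers of constant elements are constant. -/

section Stabilizer

variable {A : CDGA k} {g : DGLie k}

variable (A g) in
/-- The projection of `A ⊗ g` onto `A ⊗ g⁰`. -/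
noncomputable def projZero : (tensor A g).carrier →ₗ[k] (tensor A g).carrier :=
  LinearMap.lTensor A.carrier (gradedScale g.isInternal fun j => if j = 0 then 1 else 0)

variable (A g) in
/-- The differential of `A`, extended to `A ⊗ g`. -/
noncomputable def tensorDLeft : (tensor A g).carrier →ₗ[k] (tensor A g).carrier :=
  LinearMap.rTensor g.carrier A.d

/-- Total degree zero means `A⁰ ⊗ g⁰`. The part of the differential coming from `g` lands in `A⁰ ⊗
g¹` and is killed; projecting thus isolates the derivative in the direction of `A`. -/
lemma projZero_tensorD {y : A.carrier ⊗[k] g.carrier} (hy : y ∈ tensorDeg A g 0) :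
    LinearMap.lTensor A.carrier (gradedScale g.isInternal fun j => if j = 0 then 1 else 0)
      (tensorD A g y) = LinearMap.rTensor g.carrier A.d y := by
  refine tensorDeg_induction (p := fun y =>
    LinearMap.lTensor A.carrier (gradedScale g.isInternal fun j => if j = 0 then 1 else 0)
      (tensorD A g y) = LinearMap.rTensor g.carrier A.d y) ?_ (by simp) ?_ ?_ hy
  · intro i j a x h ha hx
    obtain ⟨rfl, rfl⟩ : i = 0 ∧ j = 0 := by omega
    rw [tensorD_tmul ha, map_add, map_smul, LinearMap.lTensor_tmul, LinearMap.lTensor_tmul,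
      gradedScale_of_mem _ _ hx, gradedScale_of_mem _ _ (g.d_mem hx), LinearMap.rTensor_tmul]
    simp
  · intro x y hx hy; simp only [map_add, hx, hy]
  · intro c x hx; simp only [map_smul, hx]

/-- Bracketing with an element of `A⁰ ⊗ g⁰` preserves the degree in `g`. -/
lemma projZero_tensorBr {y : A.carrier ⊗[k] g.carrier} (hy : y ∈ tensorDeg A g 0)
    (z : A.carrier ⊗[k] g.carrier) :
    LinearMap.lTensor A.carrier (gradedScale g.isInternal fun j => if j = 0 then 1 else 0)
      (tensorBr A g z y) = tensorBr A g (LinearMap.lTensor A.carrier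
        (gradedScale g.isInternal fun j => if j = 0 then 1 else 0) z) y := by
  refine tensorDeg_induction (p := fun y =>
    LinearMap.lTensor A.carrier (gradedScale g.isInternal fun j => if j = 0 then 1 else 0)
      (tensorBr A g z y) = tensorBr A g (LinearMap.lTensor A.carrier
        (gradedScale g.isInternal fun j => if j = 0 then 1 else 0) z) y) ?_ (by simp) ?_ ?_ hy
  · intro i j a x h ha hx
    obtain ⟨rfl, rfl⟩ : i = 0 ∧ j = 0 := by omega
    refine tensor_induction (p := fun z =>
      LinearMap.lTensor A.carrier (gradedScale g.isInternal fun j => if j = 0 then 1 else 0)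
        (tensorBr A g z (a ⊗ₜ x)) = tensorBr A g (LinearMap.lTensor A.carrier
          (gradedScale g.isInternal fun j => if j = 0 then 1 else 0) z) (a ⊗ₜ x)) ?_ (by simp) ?_ z
    · intro i j b v hb hv
      have hbr : g.br v x ∈ g.deg j := by simpa using g.br_mem hv hx
      rw [tensorBr_tmul b ha hv, LinearMap.lTensor_tmul, gradedScale_of_mem _ _ hv, map_smul,
        LinearMap.lTensor_tmul, gradedScale_of_mem _ _ hbr, tmul_smul, tmul_smul, map_smul,
        LinearMap.smul_apply, tensorBr_tmul b ha hv, smul_comm]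
    · intro x y hx hy; simp only [map_add, LinearMap.add_apply, hx, hy]
  · intro x y hx hy; simp only [map_add, hx, hy]
  · intro c x hx; simp only [map_smul, hx]

lemma projZero_d (y : (tensor A g).Zero) :
    projZero A g ((tensor A g).d (Zero.incl _ y)) = tensorDLeft A g (Zero.incl _ y) :=
  projZero_tensorD (Zero.incl_mem y)

lemma projZero_br (y : (tensor A g).Zero) (z : (tensor A g).carrier) :
    projZero A g ((tensor A g).br z (Zero.incl _ y)) =
      (tensor A g).br (projZero A g z) (Zero.incl _ y) :=
  projZero_tensorBr (Zero.incl_mem y) z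

lemma projZero_const {x : g.carrier} (hx : x ∈ g.deg 1) :
    projZero A g ((const A g).toLinearMap x) = 0 := by
  change LinearMap.lTensor A.carrier (gradedScale g.isInternal fun j => if j = 0 then 1 else 0)
    ((1 : A.carrier) ⊗ₜ[k] x) = 0
  rw [LinearMap.lTensor_tmul, gradedScale_of_mem _ _ hx]
  simp

lemma br_zero_mem_lcsTensor {i : ℕ} {z : (tensor A g).carrier} (hz : z ∈ lcsTensor A g i)
    (y : (tensor A g).Zero) : (tensor A g).br z (Zero.incl _ y) ∈ lcsTensor A g (i + 1) := by
  rw [br_zero_skew]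
  exact neg_mem (br_mem_lcsTensor _ hz)

/-- An element of the gauge group fixing a constant Maurer-Cartan element has a logarithm constant
in the direction of `A`. -/
lemma tensorDLeft_log_eq_zero [g.IsNilpotent] {x : g.carrier} (hx : x ∈ g.deg 1)
    (γ : ExpGroup k (tensor A g).Zero)
    (h : gauge γ ((const A g).toLinearMap x) = (const A g).toLinearMap x) :
    tensorDLeft A g (Zero.incl _ γ.log) = 0 := by
  obtain ⟨N, hN⟩ := exists_gauge_eq_add_sum γ ((const A g).toLinearMap x)
  have hc := projZero_const (A := A) hx
  rw [h] at hN
  generalize (const A g).toLinearMap x = c at hN hc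
  have h1 : projZero A g (gaugeTerm γ.log c 1) = tensorDLeft A g (Zero.incl _ γ.log) := by
    simp only [gaugeTerm, if_true, zero_add, Nat.cast_one, inv_one, one_smul]
    rw [map_add, projZero_d, projZero_br, hc, map_zero, LinearMap.zero_apply, add_zero]
  -- A constant element of degree one lies in `A⁰ ⊗ g¹`, so its projection is zero. The projected
  -- equation expresses `d_A(log γ)` through the terms of order at least two.
  have h2 := congrArg (projZero A g) hN
  rw [map_add, map_add, map_add, projZero_d, projZero_br, hc, map_zero, LinearMap.zero_apply,
    add_zero, zero_add, map_sum, eq_comm, add_eq_zero_iff_eq_neg] at h2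
  have key : ∀ i, tensorDLeft A g (Zero.incl _ γ.log) ∈ lcsTensor A g i := by
    intro i
    induction i with
    | zero => rw [lcsTensor_zero]; trivial
    | succ i ih =>
      -- The projected terms are iterated brackets with `log γ` starting from `d_A(log γ)` itself.
      -- If the latter lies in step `i`, all terms of order at least two lie in step `i + 1`, and
      -- then so does it.
      have h3 : ∀ m, projZero A g (gaugeTerm γ.log c (m + 1)) ∈ lcsTensor A g i := by
        intro m
        induction m with
        | zero => rw [h1]; exact ih
        | succ m ihm =>
          rw [gaugeTerm_add_two, map_smul, projZero_br]
          exact Submodule.smul_mem _ _ (lcsTensor_succ_le i (br_zero_mem_lcsTensor ihm _))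
      rw [h2]
      refine neg_mem (sum_mem fun m _ => ?_)
      rw [gaugeTerm_add_two, map_smul, projZero_br]
      exact Submodule.smul_mem _ _ (br_zero_mem_lcsTensor (h3 m) _)
  obtain ⟨M, hM⟩ := IsNilpotent.exists_lcs_eq_bot (g := g)
  have := key M
  rwa [lcsTensor_eq_bot hM, Submodule.mem_bot] at this

/-- On functions `h` vanishes, so the homotopy formula reduces to `a = ε(a) + h(da)`: a function
with zero derivative is constant. -/
lemma eq_const_of_rTensor_d (H : A.Contraction) {y : A.carrier ⊗[k] g.carrier}
    (hy : y ∈ tensorDeg A g 0) : y = 1 ⊗ₜ TensorProduct.lift (LinearMap.lsmul k g.carrier ∘ₗ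
      H.ε.toLinearMap) y + LinearMap.rTensor g.carrier H.h (LinearMap.rTensor g.carrier A.d y) := by
  refine tensorDeg_induction (p := fun y => y = 1 ⊗ₜ TensorProduct.lift
    (LinearMap.lsmul k g.carrier ∘ₗ H.ε.toLinearMap) y +
      LinearMap.rTensor g.carrier H.h (LinearMap.rTensor g.carrier A.d y)) ?_ (by simp) ?_ ?_ hy
  · intro i j a x h ha hx
    obtain ⟨rfl, rfl⟩ : i = 0 ∧ j = 0 := by omega
    have := H.d_h_add a
    rw [H.h_eq_zero a ha, map_zero, zero_add] at this
    simp only [LinearMap.rTensor_tmul, lift.tmul, this, sub_tmul, smul_tmul]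
    simp
  · intro x y hx hy
    simp only [map_add, tmul_add]
    rw [add_add_add_comm, ← hx, ← hy]
  · intro c x hx
    simp only [map_smul, tmul_smul]
    rw [← smul_add, ← hx]

/-- If `A` is contractible, the stabilizer of a constant Maurer-Cartan element consists of constant
gauge transformations. -/
theorem eq_const_of_gauge_const_eq (H : A.Contraction) [g.IsNilpotent] {x : g.carrier}
    (hx : x ∈ g.deg 1) (γ : ExpGroup k (tensor A g).Zero)
    (h : gauge γ ((const A g).toLinearMap x) = (const A g).toLinearMap x) :
    γ = ExpGroup.map (Zero.map (const A g)) (ExpGroup.map (Zero.map (contractionHom H g)) γ) := by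
  refine ExpGroup.ext (Zero.incl_injective ?_)
  have h1 : LinearMap.rTensor g.carrier A.d (Zero.incl _ γ.log) = 0 :=
    tensorDLeft_log_eq_zero hx γ h
  have h2 := eq_const_of_rTensor_d H (Zero.incl_mem γ.log)
  rw [h1, map_zero, add_zero] at h2
  exact h2

end Stabilizer

end DGLie

/-! ### The simplex as a contractible coefficient algebra; values at vertices. -/

namespace SimplexForms

variable {k : Type u} [Field k] [CharZero k] {n : ℕ}

variable (k n) in
/-- The contraction of the `n`-simplex to its vertex `0`. -/
noncomputable def contraction : (cdga k n).Contraction where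
  ε := eval (0 : Fin (n + 1))
  ε_eq_zero := eval_of_mem 0
  h := homotopy k n
  h_mem _ _ ha := homotopy_mem ha
  h_eq_zero _ ha := homotopy_eq_zero ha
  ε_h a := eval_homotopy a
  d_h_add a := d_homotopy_add a

lemma eval_pullback {m : ℕ} (u : Fin (m + 1) → Fin (n + 1)) (i : Fin (m + 1))
    (a : SimplexForms k n) : eval i (pullback u a) = eval (u i) a := by
  have h : (eval i).comp (pullback u) = eval (k := k) (u i) := by
    refine hom_ext (fun j => ?_) fun j => ?_
    · simp only [AlgHom.comp_apply, pullback_t, map_sum, eval_t, Finset.sum_ite_eq',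
        Finset.mem_filter, Finset.mem_univ, true_and, eq_comm (a := u i)]
    · simp [pullback_dt, eval_dt]
  exact DFunLike.congr_fun h a

lemma eq_algebraMap_of_zero (a : SimplexForms k 0) : a = algebraMap k _ (eval 0 a) := by
  have h : AlgHom.id k (SimplexForms k 0) = (Algebra.ofId k _).comp (eval 0) := by
    refine hom_ext (fun i => ?_) fun i => ?_
    · have := sum_t (k := k) (n := 0)
      rw [Fin.sum_univ_one] at this
      rw [Fin.fin_one_eq_zero i, this, map_one, map_one]
    · have := sum_dt (k := k) (n := 0)
      rw [Fin.sum_univ_one] at this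
      rw [Fin.fin_one_eq_zero i, this, map_zero, map_zero]
  exact DFunLike.congr_fun h a

end SimplexForms

/-! ### Forms with values in `g`, normalized gauges and transport between vertices. -/

namespace DGLie

open TensorProduct

variable {k : Type u} [Field k] [CharZero k]

lemma Hom.comp_apply {g h l : DGLie k} (f : Hom h l) (f' : Hom g h) (x : g.carrier) :
    (f.comp f').toLinearMap x = f.toLinearMap (f'.toLinearMap x) := rfl

/-- Morphisms out of a tensor product are determined by pure tensors. -/
lemma Hom.tensor_ext {A : CDGA k} {g h : DGLie k} {φ ψ : Hom (tensor A g) h}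
    (H : ∀ (a : A.carrier) (x : g.carrier), φ.toLinearMap (a ⊗ₜ[k] x) = ψ.toLinearMap (a ⊗ₜ[k] x)) :
    φ = ψ := Hom.ext (TensorProduct.ext' H)

/-- The group homomorphism `exp(g⁰) → exp(h⁰)` induced by a morphism. -/
noncomputable def Hom.exp {g h : DGLie k} [g.IsNilpotent] [h.IsNilpotent] (f : Hom g h) :
    ExpGroup k g.Zero →* ExpGroup k h.Zero := ExpGroup.map (Zero.map f)

section

variable {g h l : DGLie k} [g.IsNilpotent] [h.IsNilpotent] [l.IsNilpotent]

lemma Hom.exp_comp (f : Hom h l) (f' : Hom g h) (γ : ExpGroup k g.Zero) :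
    (f.comp f').exp γ = f.exp (f'.exp γ) := rfl

lemma Hom.gauge_exp (f : Hom g h) (γ : ExpGroup k g.Zero) (x : g.carrier) :
    gauge (f.exp γ) (f.toLinearMap x) = f.toLinearMap (gauge γ x) := gauge_map f γ x

end

variable (g : DGLie k)

/-- The polynomial forms on the `n`-simplex with values in `g`. -/
noncomputable abbrev forms (n : ℕ) : DGLie k := tensor (SimplexForms.cdga k n) g

instance [g.IsNilpotent] (n : ℕ) : (g.forms n).IsNilpotent :=
  inferInstanceAs (tensor (SimplexForms.cdga k n) g).IsNilpotent

/-- The constant forms. -/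
noncomputable def constForms (n : ℕ) : Hom g (g.forms n) := const (SimplexForms.cdga k n) g

/-- The pullback of forms along a map of simplices. -/
noncomputable def pull {m n : ℕ} (u : Fin (m + 1) → Fin (n + 1)) : Hom (g.forms n) (g.forms m) :=
  tensorMap (SimplexForms.pullbackHom k u) (Hom.id g)

variable {g} in
/-- The map on forms induced by a morphism. -/
noncomputable def Hom.forms {h : DGLie k} (f : Hom g h) (n : ℕ) : Hom (g.forms n) (h.forms n) :=
  tensorMap (CDGA.Hom.id _) f

/-- Pullbacks are taken along all maps of vertices, monotone or not: the retractions onto faces used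
to extend forms are not monotone in general. -/
lemma pull_comp {l m n : ℕ} (u : Fin (m + 1) → Fin (n + 1)) (v : Fin (l + 1) → Fin (m + 1)) :
    (g.pull v).comp (g.pull u) = g.pull (u ∘ v) := by
  rw [pull, pull, ← tensorMap_comp, ← SimplexForms.pullbackHom_comp]
  rfl

lemma pull_id (n : ℕ) : g.pull (id : Fin (n + 1) → Fin (n + 1)) = Hom.id _ := by
  have := SimplexForms.pullbackHom_id k n
  rw [← tensorMap_id, ← this]
  rfl

lemma forms_pull {h : DGLie k} (f : Hom g h) {m n : ℕ} (u : Fin (m + 1) → Fin (n + 1)) :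
    (f.forms m).comp (g.pull u) = (h.pull u).comp (f.forms n) := by
  rw [pull, pull, Hom.forms, Hom.forms, ← tensorMap_comp, ← tensorMap_comp]
  rfl

lemma forms_const {h : DGLie k} (f : Hom g h) (n : ℕ) :
    (f.forms n).comp (g.constForms n) = (h.constForms n).comp f :=
  Hom.ext (LinearMap.ext fun x =>
    show TensorProduct.map _ _ ((1 : SimplexForms k n) ⊗ₜ[k] x) = _ from rfl)

lemma pull_const {m n : ℕ} (u : Fin (m + 1) → Fin (n + 1)) :
    (g.pull u).comp (g.constForms n) = g.constForms m :=
  Hom.ext (LinearMap.ext fun x => by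
    change (SimplexForms.pullback u (1 : SimplexForms k n)) ⊗ₜ[k] x = (1 : SimplexForms k m) ⊗ₜ[k] x
    rw [map_one])

lemma atVertex_const (n : ℕ) (i : Fin (n + 1)) :
    (g.atVertex n i).comp (g.constForms n) = Hom.id g :=
  Hom.ext (LinearMap.ext fun x => augment_const (A := SimplexForms.cdga k n) _
    (SimplexForms.eval_of_mem i) x)

lemma atVertex_pull {m n : ℕ} (u : Fin (m + 1) → Fin (n + 1)) (i : Fin (m + 1)) :
    (g.atVertex m i).comp (g.pull u) = g.atVertex n (u i) :=
  Hom.tensor_ext fun (a : SimplexForms k n) x => by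
    change SimplexForms.eval i (SimplexForms.pullback u a) • x = SimplexForms.eval (u i) a • x
    rw [SimplexForms.eval_pullback]

lemma atVertex_forms {h : DGLie k} (f : Hom g h) (n : ℕ) (i : Fin (n + 1)) :
    (h.atVertex n i).comp (f.forms n) = f.comp (g.atVertex n i) :=
  Hom.tensor_ext fun (a : SimplexForms k n) x => by
    change SimplexForms.eval i a • f.toLinearMap x = f.toLinearMap (SimplexForms.eval i a • x)
    rw [map_smul]

/-- The relations give `t₀ = 1` and `dt₀ = 0` on a point, so `Ω₀ = k`. -/
lemma const_atVertex_zero : (g.constForms 0).comp (g.atVertex 0 0) = Hom.id _ :=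
  Hom.tensor_ext fun (a : SimplexForms k 0) x => by
    change (1 : SimplexForms k 0) ⊗ₜ[k] (SimplexForms.eval 0 a • x) = a ⊗ₜ[k] x
    rw [← smul_tmul, ← Algebra.algebraMap_eq_smul_one, ← SimplexForms.eq_algebraMap_of_zero]

section Apply

variable {g} {h : DGLie k} (f : Hom g h) {l m n : ℕ}

lemma pull_pull (u : Fin (m + 1) → Fin (n + 1)) (v : Fin (l + 1) → Fin (m + 1))
    (z : (g.forms n).carrier) :
    (g.pull v).toLinearMap ((g.pull u).toLinearMap z) = (g.pull (u ∘ v)).toLinearMap z := by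
  rw [← pull_comp]; rfl

lemma pull_id_apply (z : (g.forms n).carrier) :
    (g.pull (id : Fin (n + 1) → Fin (n + 1))).toLinearMap z = z := by
  rw [pull_id]; rfl

lemma forms_pull_apply (u : Fin (m + 1) → Fin (n + 1)) (z : (g.forms n).carrier) :
    (f.forms m).toLinearMap ((g.pull u).toLinearMap z) =
      (h.pull u).toLinearMap ((f.forms n).toLinearMap z) := by
  rw [← Hom.comp_apply, forms_pull]; rfl

lemma forms_const_apply (n : ℕ) (x : g.carrier) :
    (f.forms n).toLinearMap ((g.constForms n).toLinearMap x) =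
      (h.constForms n).toLinearMap (f.toLinearMap x) := by
  rw [← Hom.comp_apply, forms_const]; rfl

lemma pull_const_apply (u : Fin (m + 1) → Fin (n + 1)) (x : g.carrier) :
    (g.pull u).toLinearMap ((g.constForms n).toLinearMap x) = (g.constForms m).toLinearMap x := by
  rw [← Hom.comp_apply, pull_const]

lemma atVertex_const_apply (n : ℕ) (i : Fin (n + 1)) (x : g.carrier) :
    (g.atVertex n i).toLinearMap ((g.constForms n).toLinearMap x) = x := by
  rw [← Hom.comp_apply, atVertex_const]; rfl

lemma atVertex_pull_apply (u : Fin (m + 1) → Fin (n + 1)) (i : Fin (m + 1))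
    (z : (g.forms n).carrier) : (g.atVertex m i).toLinearMap ((g.pull u).toLinearMap z) =
      (g.atVertex n (u i)).toLinearMap z := by
  rw [← Hom.comp_apply, atVertex_pull]

lemma const_atVertex_zero_apply (z : (g.forms 0).carrier) :
    (g.constForms 0).toLinearMap ((g.atVertex 0 0).toLinearMap z) = z := by
  rw [← Hom.comp_apply, const_atVertex_zero]; rfl

variable [g.IsNilpotent] [h.IsNilpotent]

lemma exp_pull_pull (u : Fin (m + 1) → Fin (n + 1)) (v : Fin (l + 1) → Fin (m + 1))
    (γ : ExpGroup k (g.forms n).Zero) :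
    (g.pull v).exp ((g.pull u).exp γ) = (g.pull (u ∘ v)).exp γ := by
  rw [← pull_comp]; rfl

lemma gaugeAtVertex_const (i : Fin (n + 1)) (γ : ExpGroup k g.Zero) :
    gaugeAtVertex i ((g.constForms n).exp γ) = γ := by
  change (g.atVertex n i).exp _ = γ
  rw [← Hom.exp_comp, atVertex_const]; rfl

lemma gaugeAtVertex_pull (u : Fin (m + 1) → Fin (n + 1)) (i : Fin (m + 1))
    (γ : ExpGroup k (g.forms n).Zero) :
    gaugeAtVertex i ((g.pull u).exp γ) = gaugeAtVertex (u i) γ := by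
  change (g.atVertex m i).exp _ = (g.atVertex n (u i)).exp γ
  rw [← Hom.exp_comp, atVertex_pull]

lemma gaugeAtVertex_forms (i : Fin (n + 1)) (γ : ExpGroup k (g.forms n).Zero) :
    gaugeAtVertex i ((f.forms n).exp γ) = f.exp (gaugeAtVertex i γ) := by
  change (h.atVertex n i).exp _ = f.exp ((g.atVertex n i).exp γ)
  rw [← Hom.exp_comp, atVertex_forms]; rfl

lemma atVertex_gauge (i : Fin (n + 1)) (γ : ExpGroup k (g.forms n).Zero)
    (z : (g.forms n).carrier) : (g.atVertex n i).toLinearMap (gauge γ z) =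
      gauge (gaugeAtVertex i γ) ((g.atVertex n i).toLinearMap z) :=
  ((g.atVertex n i).gauge_exp γ z).symm

lemma atVertex_gauge_const (i : Fin (n + 1)) (γ : ExpGroup k (g.forms n).Zero) (x : g.carrier) :
    (g.atVertex n i).toLinearMap (gauge γ ((g.constForms n).toLinearMap x)) =
      gauge (gaugeAtVertex i γ) x := by
  rw [atVertex_gauge, atVertex_const_apply]

lemma pull_gauge_const (u : Fin (m + 1) → Fin (n + 1)) (γ : ExpGroup k (g.forms n).Zero)
    (x : g.carrier) : (g.pull u).toLinearMap (gauge γ ((g.constForms n).toLinearMap x)) =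
      gauge ((g.pull u).exp γ) ((g.constForms m).toLinearMap x) := by
  rw [← Hom.gauge_exp, pull_const_apply]

lemma forms_gauge_const (γ : ExpGroup k (g.forms n).Zero) (x : g.carrier) :
    (f.forms n).toLinearMap (gauge γ ((g.constForms n).toLinearMap x)) =
      gauge ((f.forms n).exp γ) ((h.constForms n).toLinearMap (f.toLinearMap x)) := by
  rw [← Hom.gauge_exp, forms_const_apply]

lemma gauge_const_const (γ : ExpGroup k g.Zero) (x : g.carrier) :
    gauge ((g.constForms n).exp γ) ((g.constForms n).toLinearMap x) =
      (g.constForms n).toLinearMap (gauge γ x) := Hom.gauge_exp _ _ _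

/-- Every Maurer-Cartan form is gauge equivalent to a constant one; the gauge transformation can be
prescribed at one vertex. -/
theorem exists_eq_gauge_const {z : (g.forms n).carrier} (hz : z ∈ (g.forms n).MC) (i : Fin (n + 1))
    {x : g.carrier} {ρ : ExpGroup k g.Zero} (hx : (g.atVertex n i).toLinearMap z = gauge ρ x) :
    ∃ γ : ExpGroup k (g.forms n).Zero, gaugeAtVertex i γ = ρ ∧
      z = gauge γ ((g.constForms n).toLinearMap x) := by
  obtain ⟨γ, -, h⟩ : ∃ γ : ExpGroup k (g.forms n).Zero, _ ∧
      z = gauge γ ((g.constForms n).toLinearMap ((g.atVertex n 0).toLinearMap z)) :=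
    exists_eq_gauge_const_of_contraction (SimplexForms.contraction k n) hz
  generalize (g.atVertex n 0).toLinearMap z = y at h
  subst h
  rw [atVertex_gauge_const] at hx
  -- The constant factor first carries `x` to the old base point `y`, and it is chosen so that the
  -- value at the vertex `i` becomes `ρ`.
  refine ⟨(g.constForms n).exp (ρ * (gaugeAtVertex i γ)⁻¹) * γ, ?_, ?_⟩
  · rw [map_mul, gaugeAtVertex_const, inv_mul_cancel_right]
  · rw [gauge_mul, gauge_const_const, gauge_mul, ← hx, ← gauge_mul, mul_inv_cancel, gauge_one]

/-- A gauge transformation is determined by its effect on a constant form and its value at one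
vertex. -/
theorem eq_of_gauge_const_eq {x : g.carrier} (hx : x ∈ g.deg 1)
    {γ δ : ExpGroup k (g.forms n).Zero}
    (h : gauge γ ((g.constForms n).toLinearMap x) = gauge δ ((g.constForms n).toLinearMap x))
    (i : Fin (n + 1)) (hi : gaugeAtVertex i γ = gaugeAtVertex i δ) : γ = δ := by
  -- The quotient stabilizes a constant form, so it is constant; its value at the vertex `i` is `1`,
  -- which then is its value everywhere.
  have h1 : γ * δ⁻¹ = (g.constForms n).exp (gaugeAtVertex 0 (γ * δ⁻¹)) :=
    eq_const_of_gauge_const_eq (SimplexForms.contraction k n) hx (γ * δ⁻¹)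
      (show gauge (γ * δ⁻¹) ((g.constForms n).toLinearMap x) = (g.constForms n).toLinearMap x by
        rw [gauge_mul, h, ← gauge_mul, mul_inv_cancel, gauge_one])
  have h2 := congrArg (gaugeAtVertex i) h1
  rw [gaugeAtVertex_const, map_mul, hi, map_inv, mul_inv_cancel] at h2
  rw [← h2, map_one] at h1
  exact mul_inv_eq_one.1 h1

/-- The transport between two vertices does not depend on the presentation of a form. -/
theorem transport_eq {x x' : g.carrier} (hx : x ∈ g.MC) {γ γ' : ExpGroup k (g.forms n).Zero}
    (h : gauge γ ((g.constForms n).toLinearMap x) = gauge γ' ((g.constForms n).toLinearMap x'))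
    (i j : Fin (n + 1)) : (gaugeAtVertex i γ)⁻¹ * gaugeAtVertex j γ =
      (gaugeAtVertex i γ')⁻¹ * gaugeAtVertex j γ' := by
  have h0 := congrArg (g.atVertex n i).toLinearMap h
  rw [atVertex_gauge_const, atVertex_gauge_const] at h0
  have hx' : x' = gauge (gaugeAtVertex i γ * (gaugeAtVertex i γ')⁻¹) x := by
    rw [gauge_mul, h0, ← gauge_mul, mul_inv_cancel, gauge_one]
  -- The constant factor carries `x` to `x'` and matches the two values at `i`, so uniqueness
  -- applies. Being a common left factor at all vertices, it cancels in the transport.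
  have h1 : γ = (g.constForms n).exp (gaugeAtVertex i γ * (gaugeAtVertex i γ')⁻¹) * γ' := by
    refine eq_of_gauge_const_eq hx.1 ?_ i ?_
    · rw [h, gauge_mul, gauge_const_const, ← hx']
    · rw [map_mul, gaugeAtVertex_const, inv_mul_cancel_right]
  have h2 := congrArg (gaugeAtVertex j) h1
  rw [map_mul, gaugeAtVertex_const] at h2
  rw [h2]
  group

end Apply

end DGLie

/-! ### Extension of forms from faces to the simplex, as an additive problem. -/

/-- The retraction of a simplex onto its `i`-th face carrying the vertex `i` to `c`. -/
lemma Fin.exists_succAbove_retraction {n : ℕ} {i c : Fin (n + 2)} (h : c ≠ i) :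
    ∃ σ : Fin (n + 2) → Fin (n + 1), ∀ x, i.succAbove (σ x) = if x = i then c else x := by
  have : ∀ x, ∃ y : Fin (n + 1), i.succAbove y = if x = i then c else x := by
    intro x
    apply Fin.exists_succAbove_eq
    split_ifs with hx
    · exact h
    · exact hx
  exact ⟨fun x => (this x).choose, fun x => (this x).choose_spec⟩

/-- The form in which "a subsimplex avoiding the vertex `j` lies in the face opposite to `j`" is
used below. -/
lemma Fin.exists_comp_succAbove {n : ℕ} {ι : Type*} {j : Fin (n + 2)} {w : ι → Fin (n + 2)}
    (h : ∀ x, w x ≠ j) : ∃ v : ι → Fin (n + 1), w = j.succAbove ∘ v :=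
  ⟨fun x => (Fin.exists_succAbove_eq (h x)).choose,
    funext fun x => (Fin.exists_succAbove_eq (h x)).choose_spec.symm⟩

section Filling

variable {M : ℕ → Type*} [∀ n, AddCommGroup (M n)] (K : ∀ n, AddSubgroup (M n))
  (P : ∀ {m n : ℕ}, (Fin (m + 1) → Fin (n + 1)) → M n →+ M m)
  (P_mem : ∀ {m n : ℕ} (u : Fin (m + 1) → Fin (n + 1)) (x : M n), x ∈ K n → P u x ∈ K m)
  (P_comp : ∀ {l m n : ℕ} (u : Fin (m + 1) → Fin (n + 1)) (v : Fin (l + 1) → Fin (m + 1)) (x : M n),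
    P v (P u x) = P (u ∘ v) x)
  (P_id : ∀ {n : ℕ} (x : M n), P (id : Fin (n + 1) → Fin (n + 1)) x = x)

include P_mem P_comp P_id

/-- A compatible family of forms on the faces of a simplex containing a vertex `c` extends to the
simplex. -/
lemma exists_extension_of_mem_faces {n : ℕ} (c : Fin (n + 2)) (S : Finset (Fin (n + 2)))
    (hS : c ∉ S) (y : Fin (n + 2) → M n) (hy : ∀ i ∈ S, y i ∈ K n)
    (compat : ∀ i ∈ S, ∀ j ∈ S, ∀ (l : ℕ) (u v : Fin (l + 1) → Fin (n + 1)),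
      i.succAbove ∘ u = j.succAbove ∘ v → P u (y i) = P v (y j)) :
    ∃ Y ∈ K (n + 1), ∀ i ∈ S, P i.succAbove Y = y i := by
  classical
  induction S using Finset.induction_on with
  | empty => exact ⟨0, zero_mem _, by simp⟩
  | insert i S hi ih =>
    obtain ⟨Y, hYK, hY⟩ := ih (fun h => hS (Finset.mem_insert_of_mem h))
      (fun j hj => hy j (Finset.mem_insert_of_mem hj))
      (fun j hj j' hj' => compat j (Finset.mem_insert_of_mem hj) j' (Finset.mem_insert_of_mem hj'))
    have hci : c ≠ i := fun h => hS (h ▸ Finset.mem_insert_self i S)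
    obtain ⟨σ, hσ⟩ := Fin.exists_succAbove_retraction hci
    -- The error on the new face `i` is spread over the simplex by the retraction `σ`, which is the
    -- identity on that face.
    refine ⟨Y + P σ (y i - P i.succAbove Y), add_mem hYK (P_mem _ _ (sub_mem
      (hy i (Finset.mem_insert_self i S)) (P_mem _ _ hYK))), fun j hj => ?_⟩
    rw [map_add, P_comp]
    rcases Finset.mem_insert.1 hj with rfl | hjS
    · have h1 : σ ∘ j.succAbove = id := funext fun x => Fin.succAbove_right_injective (p := j) (by
        rw [Function.comp_apply, hσ, if_neg (Fin.succAbove_ne j x), id])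
      rw [h1, P_id, add_sub_cancel]
    · have hcj : c ≠ j := fun h => hS (h ▸ hj)
      -- The retraction sends the vertex `i` to `c`, and `c` belongs to every face in `S`, so `σ`
      -- maps the face `j` into itself. On the intersection of the faces `i` and `j` the error is
      -- zero, and the faces already matched are undisturbed.
      have hw : ∀ x, (i.succAbove ∘ σ ∘ j.succAbove) x ≠ j := by
        intro x
        rw [Function.comp_apply, Function.comp_apply, hσ]
        split_ifs with h
        · exact hcj
        · exact Fin.succAbove_ne j x
      obtain ⟨v, hv⟩ := Fin.exists_comp_succAbove hw
      rw [map_sub, compat i (Finset.mem_insert_self i S) j hj _ _ _ hv, P_comp, hv, ← P_comp,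
        hY j hjS, sub_self, add_zero]

variable (T : ∀ {n : ℕ}, Fin (n + 1) → M n →+ M n)
  (T_mem : ∀ {n : ℕ} (i : Fin (n + 1)) (x : M n), x ∈ K n → T i x ∈ K n)
  (P_T : ∀ {m n : ℕ} (u : Fin (m + 1) → Fin (n + 1)) (i : Fin (n + 1)) (x : M n),
    P u (T i x) = ∑ j with u j = i, T j (P u x))
  (sum_T : ∀ {n : ℕ} (x : M n), ∑ i, T i x = x)

include T_mem P_T sum_T

/-- A compatible family of forms on the faces of a simplex extends to the simplex. -/
lemma exists_extension_of_faces {n : ℕ} (y : Fin (n + 2) → M n) (hy : ∀ i, y i ∈ K n)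
    (compat : ∀ i j (l : ℕ) (u v : Fin (l + 1) → Fin (n + 1)),
      i.succAbove ∘ u = j.succAbove ∘ v → P u (y i) = P v (y j)) :
    ∃ Y ∈ K (n + 1), ∀ i, P i.succAbove Y = y i := by
  classical
  let c : Fin (n + 2) := 0
  obtain ⟨Y, hYK, hY⟩ := exists_extension_of_mem_faces K P P_mem P_comp P_id c (Finset.univ.erase c)
    (by simp) y (fun i _ => hy i) (fun i _ j _ => compat i j)
  set e := y c - P c.succAbove Y with he
  have heK : e ∈ K n := sub_mem (hy c) (P_mem _ _ hYK)
  -- All faces except the one opposite to `c` are already matched, so the error `e` on this last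
  -- face vanishes on its boundary.
  have hvan : ∀ (l : ℕ) (u : Fin (l + 1) → Fin (n + 1)) (j : Fin (n + 2)), j ≠ c →
      (∀ x, (c.succAbove ∘ u) x ≠ j) → P u e = 0 := by
    intro l u j hj hu
    obtain ⟨v, hv⟩ := Fin.exists_comp_succAbove hu
    rw [he, map_sub, compat c j _ _ _ hv, P_comp, hv, ← P_comp, hY j (by simp [hj]), sub_self]
  have hσ : ∀ l : Fin (n + 1), ∃ σ : Fin (n + 2) → Fin (n + 1),
      ∀ x, c.succAbove (σ x) = if x = c then c.succAbove l else x :=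
    fun l => Fin.exists_succAbove_retraction (Fin.succAbove_ne c l)
  choose σ hσ using hσ
  -- No single retraction onto the last face respects all the other faces. Instead, for each vertex
  -- `l` of that face, `e` is pulled back along the retraction sending `c` to `l` and multiplied by
  -- the coordinate of `l`; on the last face these weights add up to one.
  refine ⟨Y + ∑ l, T (c.succAbove l) (P (σ l) e),
    add_mem hYK (sum_mem fun l _ => T_mem _ _ (P_mem _ _ heK)), fun i => ?_⟩
  rw [map_add, map_sum]
  by_cases hi : i = c
  · rw [hi]
    have h1 : ∀ l, P c.succAbove (T (c.succAbove l) (P (σ l) e)) = T l e := by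
      intro l
      have h2 : σ l ∘ c.succAbove = id :=
        funext fun x => Fin.succAbove_right_injective (p := c) (by
          rw [Function.comp_apply, hσ, if_neg (Fin.succAbove_ne c x), id])
      rw [P_T, P_comp, h2, P_id]
      simp [Finset.sum_filter]
    rw [Finset.sum_congr rfl fun l _ => h1 l, sum_T, he, add_sub_cancel]
  · rw [hY i (by simp [hi]), Finset.sum_eq_zero, add_zero]
    intro l _
    rw [P_T, P_comp]
    -- If `l` is the vertex missing from the face `i`, its coordinate restricts to zero and the sum
    -- is empty. Otherwise the retraction sends the face `i` into itself, where `e` vanishes.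
    refine Finset.sum_eq_zero fun j hj => ?_
    rw [hvan _ _ i hi, map_zero]
    intro x
    rw [Function.comp_apply, Function.comp_apply, hσ]
    split_ifs with h
    · rw [← (Finset.mem_filter.1 hj).2]
      exact Fin.succAbove_ne i j
    · exact Fin.succAbove_ne i x

end Filling

/-- Compatibility along monotone maps implies compatibility along all maps. -/
lemma compat_of_monotone {M : ℕ → Type*}
    (P : ∀ {m n : ℕ}, (Fin (m + 1) → Fin (n + 1)) → M n → M m)
    (P_comp : ∀ {l m n : ℕ} (u : Fin (m + 1) → Fin (n + 1)) (v : Fin (l + 1) → Fin (m + 1))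
      (x : M n), P v (P u x) = P (u ∘ v) x)
    {n : ℕ} (p : Fin (n + 2) → Prop) (y : Fin (n + 2) → M n)
    (compat : ∀ i j, p i → p j → ∀ (l : ℕ) (u v : Fin (l + 1) →o Fin (n + 1)),
      i.succAbove ∘ u = j.succAbove ∘ v → P u (y i) = P v (y j))
    {i j : Fin (n + 2)} (hi : p i) (hj : p j) {l : ℕ} {u v : Fin (l + 1) → Fin (n + 1)}
    (h : i.succAbove ∘ u = j.succAbove ∘ v) : P u (y i) = P v (y j) := by
  wlog hij : i ≤ j generalizing i j u v
  · exact (this hj hi h.symm (not_le.1 hij).le).symm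
  rcases hij.eq_or_lt with rfl | hij
  · have : u = v := funext fun x => Fin.succAbove_right_injective (congrFun h x)
    rw [this]
  obtain ⟨b, rfl⟩ := Fin.exists_succ_eq.2 (Fin.ne_zero_of_lt hij)
  obtain ⟨a, rfl⟩ : ∃ a : Fin (n + 1), a.castSucc = i :=
    ⟨i.castPred (Fin.ne_last_of_lt hij), Fin.castSucc_castPred _ _⟩
  have hab : a ≤ b := Fin.castSucc_lt_succ_iff.1 hij
  -- The common values of the two composites avoid both missing vertices, so both maps factor
  -- through the codimension-two face. Its two inclusions are monotone, and there the hypothesis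
  -- applies.
  have hu : ∀ x, u x ≠ b := by
    intro x hx
    have := congrFun h x
    rw [Function.comp_apply, hx, Fin.succAbove_of_le_castSucc _ _ (Fin.castSucc_le_castSucc_iff.2 hab)] at this
    exact Fin.succAbove_ne _ _ this.symm
  cases n with
  | zero => exact absurd (Subsingleton.elim (α := Fin 1) (u 0) b) (hu 0)
  | succ n =>
    obtain ⟨w, rfl⟩ := Fin.exists_comp_succAbove hu
    have hc : a.castSucc.succAbove ∘ b.succAbove = b.succ.succAbove ∘ a.succAbove := by
      funext x
      have := congrArg (fun f => f.toOrderHom x) (SimplexCategory.δ_comp_δ hab)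
      exact this.symm
    have hv : v = a.succAbove ∘ w := by
      funext x
      refine Fin.succAbove_right_injective (p := b.succ) ?_
      have h1 := congrFun h x
      have h2 := congrFun hc (w x)
      exact h1.symm.trans h2
    rw [hv, ← P_comp, ← P_comp]
    congr 1
    exact compat _ _ hi hj _ ⟨_, b.strictMono_succAbove.monotone⟩ ⟨_, a.strictMono_succAbove.monotone⟩ hc

/-! ### Extension of forms and of gauge transformations, relative to a surjection. -/

namespace DGLie

open TensorProduct

variable {k : Type u} [Field k] [CharZero k]

lemma Hom.gradedScale_apply {g h : DGLie k} (f : Hom g h) (c : ℕ → k) (x : g.carrier) :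
    f.toLinearMap (gradedScale g.isInternal c x) = gradedScale h.isInternal c (f.toLinearMap x) := by
  refine internal_induction g.isInternal (p := fun x => f.toLinearMap (gradedScale g.isInternal c x)
    = gradedScale h.isInternal c (f.toLinearMap x)) ?_ ?_ ?_ x
  · intro i x hx
    rw [gradedScale_of_mem _ _ hx, gradedScale_of_mem _ _ (f.map_deg hx), map_smul]
  · simp
  · intro x y hx hy; simp only [map_add, hx, hy]

/-- Any preimage may be replaced by its component of degree `i`, since morphisms commute with the
projections onto degrees. -/
lemma Hom.exists_mem_deg {g h : DGLie k} {f : Hom g h} (hf : Function.Surjective f.toLinearMap)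
    {i : ℕ} {y : h.carrier} (hy : y ∈ h.deg i) : ∃ x ∈ g.deg i, f.toLinearMap x = y := by
  obtain ⟨x, rfl⟩ := hf y
  refine ⟨gradedScale g.isInternal (fun j => if j = i then 1 else 0) x, ?_, ?_⟩
  · refine internal_induction g.isInternal (p := fun x =>
      gradedScale g.isInternal (fun j => if j = i then (1 : k) else 0) x ∈ g.deg i) ?_ ?_ ?_ x
    · intro j x hx
      rw [gradedScale_of_mem _ _ hx]
      split_ifs with h
      · exact Submodule.smul_mem _ _ (h ▸ hx)
      · rw [zero_smul]; exact zero_mem _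
    · rw [map_zero]; exact zero_mem _
    · intro x y hx hy; rw [map_add]; exact add_mem hx hy
  · rw [f.gradedScale_apply, gradedScale_of_mem _ _ hy, if_pos rfl, one_smul]

lemma exists_map_eq_of_surjective (A : CDGA k) {g h : DGLie k} {f : Hom g h}
    (hf : Function.Surjective f.toLinearMap) {n : ℕ} {w : A.carrier ⊗[k] h.carrier}
    (hw : w ∈ tensorDeg A h n) : ∃ z ∈ tensorDeg A g n,
      TensorProduct.map (AlgHom.id k A.carrier).toLinearMap f.toLinearMap z = w := by
  refine tensorDeg_induction (p := fun w => ∃ z ∈ tensorDeg A g n,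
      TensorProduct.map (AlgHom.id k A.carrier).toLinearMap f.toLinearMap z = w) ?_ ?_ ?_ ?_ hw
  · intro i j a y e ha hy
    obtain ⟨x, hx, rfl⟩ := Hom.exists_mem_deg hf hy
    exact ⟨a ⊗ₜ x, tmul_mem ha hx e, rfl⟩
  · exact ⟨0, zero_mem _, map_zero _⟩
  · rintro _ _ ⟨x, hx, rfl⟩ ⟨y, hy, rfl⟩
    exact ⟨x + y, add_mem hx hy, map_add _ _ _⟩
  · rintro c _ ⟨x, hx, rfl⟩
    exact ⟨c • x, Submodule.smul_mem _ c hx, map_smul _ _ _⟩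

lemma Hom.exists_forms_eq {g h : DGLie k} {f : Hom g h} (hf : Function.Surjective f.toLinearMap)
    {n i : ℕ} {w : (h.forms n).carrier} (hw : w ∈ (h.forms n).deg i) :
    ∃ z ∈ (g.forms n).deg i, (f.forms n).toLinearMap z = w :=
  exists_map_eq_of_surjective (SimplexForms.cdga k n) hf hw

section MulT

variable {g h : DGLie k} {n : ℕ}

/-- Multiplication of forms by a barycentric coordinate. -/
noncomputable def mulT (i : Fin (n + 1)) : (g.forms n).carrier →ₗ[k] (g.forms n).carrier :=
  LinearMap.rTensor g.carrier (LinearMap.mulLeft k (SimplexForms.t i : SimplexForms k n))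

lemma mulT_mem (i : Fin (n + 1)) {p : ℕ} {z : (g.forms n).carrier} (hz : z ∈ (g.forms n).deg p) :
    mulT i z ∈ (g.forms n).deg p := by
  refine tensorDeg_induction (A := SimplexForms.cdga k n) (p := fun z : (g.forms n).carrier =>
    mulT i z ∈ (g.forms n).deg p) ?_ ?_ ?_ ?_ hz
  · intro q j a x e ha hx
    refine tmul_mem (A := SimplexForms.cdga k n) ?_ hx e
    have := SimplexForms.mul_mem (SimplexForms.t_mem i) ha
    rwa [zero_add] at this
  · exact (map_zero (mulT (g := g) i)).symm ▸ zero_mem _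
  · intro x y hx hy; exact (map_add (mulT (g := g) i) x y).symm ▸ add_mem hx hy
  · intro c x hx; exact (map_smul (mulT (g := g) i) c x).symm ▸ Submodule.smul_mem _ c hx

lemma forms_mulT (f : Hom g h) (i : Fin (n + 1)) (z : (g.forms n).carrier) :
    (f.forms n).toLinearMap (mulT i z) = mulT i ((f.forms n).toLinearMap z) := by
  have : (f.forms n).toLinearMap ∘ₗ mulT i = mulT i ∘ₗ (f.forms n).toLinearMap :=
    TensorProduct.ext' (M := SimplexForms k n) fun a x => rfl
  exact LinearMap.congr_fun this z

lemma pull_mulT {m : ℕ} (u : Fin (m + 1) → Fin (n + 1)) (i : Fin (n + 1))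
    (z : (g.forms n).carrier) : (g.pull u).toLinearMap (mulT i z) =
      ∑ j with u j = i, mulT j ((g.pull u).toLinearMap z) := by
  have hs : ∀ z : (g.forms n).carrier, (∑ j with u j = i, mulT j ∘ₗ (g.pull u).toLinearMap) z =
      ∑ j with u j = i, mulT j ((g.pull u).toLinearMap z) := fun z => LinearMap.sum_apply _ _ z
  have : (g.pull u).toLinearMap ∘ₗ mulT i =
      ∑ j with u j = i, mulT j ∘ₗ (g.pull u).toLinearMap :=
    TensorProduct.ext' (M := SimplexForms k n) fun a x => by
      refine Eq.trans ?_ (hs _).symm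
      change SimplexForms.pullback u (SimplexForms.t i * a) ⊗ₜ[k] x = ∑ j with u j = i,
        (SimplexForms.t j * SimplexForms.pullback u a) ⊗ₜ[k] x
      rw [map_mul, SimplexForms.pullback_t, Finset.sum_mul, sum_tmul]
  rw [← hs, ← this]
  rfl

lemma sum_mulT (z : (g.forms n).carrier) : ∑ i, mulT i z = z := by
  have hs : ∀ z : (g.forms n).carrier, (∑ i, mulT i) z = ∑ i, mulT i z :=
    fun z => LinearMap.sum_apply _ _ z
  have : ∑ i, mulT i = (LinearMap.id : (g.forms n).carrier →ₗ[k] (g.forms n).carrier) :=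
    TensorProduct.ext' (M := SimplexForms k n) fun a x => by
      refine (hs _).trans ?_
      change ∑ i, (SimplexForms.t i * a) ⊗ₜ[k] x = a ⊗ₜ[k] x
      rw [← sum_tmul, ← Finset.sum_mul, SimplexForms.sum_t, one_mul]
  rw [← hs, this]
  rfl

end MulT

section Extension

variable {g h : DGLie k} {n : ℕ}

/-- The forms of degree zero in the kernel of a morphism. -/
noncomputable def formsKer (f : Hom g h) (n : ℕ) : AddSubgroup (g.forms n).carrier :=
  ((g.forms n).deg 0 ⊓ LinearMap.ker (f.forms n).toLinearMap).toAddSubgroup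

lemma pull_mem_formsKer (f : Hom g h) {m : ℕ} (u : Fin (m + 1) → Fin (n + 1))
    (x : (g.forms n).carrier) (hx : x ∈ formsKer f n) :
    (g.pull u).toLinearMap.toAddMonoidHom x ∈ formsKer f m := by
  refine ⟨(g.pull u).map_deg hx.1, LinearMap.mem_ker.2 ?_⟩
  have := forms_pull_apply f u x
  rw [LinearMap.mem_ker.1 hx.2, map_zero] at this
  exact this

lemma mulT_mem_formsKer (f : Hom g h) (i : Fin (n + 1)) (x : (g.forms n).carrier)
    (hx : x ∈ formsKer f n) : (mulT i).toAddMonoidHom x ∈ formsKer f n := by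
  refine ⟨mulT_mem i hx.1, LinearMap.mem_ker.2 ?_⟩
  have := forms_mulT f i x
  rw [LinearMap.mem_ker.1 hx.2, map_zero] at this
  exact this

lemma exists_forms_extension_of_mem_faces (c : Fin (n + 2)) (S : Finset (Fin (n + 2))) (hS : c ∉ S)
    (y : Fin (n + 2) → (g.forms n).carrier) (hy : ∀ i ∈ S, y i ∈ (g.forms n).deg 0)
    (compat : ∀ i ∈ S, ∀ j ∈ S, ∀ (l : ℕ) (u v : Fin (l + 1) → Fin (n + 1)),
      i.succAbove ∘ u = j.succAbove ∘ v →
        (g.pull u).toLinearMap (y i) = (g.pull v).toLinearMap (y j)) :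
    ∃ Y ∈ (g.forms (n + 1)).deg 0, ∀ i ∈ S, (g.pull i.succAbove).toLinearMap Y = y i :=
  exists_extension_of_mem_faces (M := fun n => (g.forms n).carrier)
    (fun n => ((g.forms n).deg 0).toAddSubgroup)
    (fun u => (g.pull u).toLinearMap.toAddMonoidHom) (fun u _ hx => (g.pull u).map_deg hx)
    (fun u v x => pull_pull u v x) (fun x => pull_id_apply x) c S hS y hy compat

/-- A lift `B` of `w` is chosen without regard to the faces. The discrepancies on the faces are then
compatible forms in the kernel of `f`, and this kernel is stable under pullback and under
multiplication by the `tᵢ`, so the extension can be made inside it. -/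
lemma exists_forms_extension {f : Hom g h} (hf : Function.Surjective f.toLinearMap)
    (y : Fin (n + 2) → (g.forms n).carrier) (hy : ∀ i, y i ∈ (g.forms n).deg 0)
    (compat : ∀ i j (l : ℕ) (u v : Fin (l + 1) → Fin (n + 1)), i.succAbove ∘ u = j.succAbove ∘ v →
      (g.pull u).toLinearMap (y i) = (g.pull v).toLinearMap (y j))
    {w : (h.forms (n + 1)).carrier} (hw : w ∈ (h.forms (n + 1)).deg 0)
    (hyw : ∀ i, (f.forms n).toLinearMap (y i) = (h.pull i.succAbove).toLinearMap w) :
    ∃ Y ∈ (g.forms (n + 1)).deg 0, (∀ i, (g.pull i.succAbove).toLinearMap Y = y i) ∧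
      (f.forms (n + 1)).toLinearMap Y = w := by
  obtain ⟨B, hB, rfl⟩ := Hom.exists_forms_eq hf hw
  obtain ⟨Y, hY, h⟩ := exists_extension_of_faces (M := fun n => (g.forms n).carrier)
    (fun n => formsKer f n)
    (fun u => (g.pull u).toLinearMap.toAddMonoidHom) (fun u x hx => pull_mem_formsKer f u x hx)
    (fun u v x => pull_pull u v x) (fun x => pull_id_apply x)
    (fun i => (mulT i).toAddMonoidHom) (fun i x hx => mulT_mem_formsKer f i x hx)
    (fun u i x => pull_mulT u i x) (fun x => sum_mulT x)
    (fun i => y i - (g.pull i.succAbove).toLinearMap B)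
    (fun i => ⟨sub_mem (hy i) ((g.pull _).map_deg hB), LinearMap.mem_ker.2 (by
      rw [map_sub, forms_pull_apply, hyw, sub_self])⟩)
    (fun i j l u v huv => by
      change (g.pull u).toLinearMap (y i - (g.pull i.succAbove).toLinearMap B) =
        (g.pull v).toLinearMap (y j - (g.pull j.succAbove).toLinearMap B)
      rw [map_sub, map_sub, pull_pull, pull_pull, huv, compat i j l u v huv])
  refine ⟨B + Y, add_mem hB hY.1, fun i => ?_, ?_⟩
  · rw [map_add, show (g.pull i.succAbove).toLinearMap Y = _ from h i, add_sub_cancel]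
  · rw [map_add, LinearMap.mem_ker.1 hY.2, add_zero]

variable [g.IsNilpotent] [h.IsNilpotent]

lemma incl_log_eq_iff {γ δ : ExpGroup k g.Zero} :
    Zero.incl g γ.log = Zero.incl g δ.log ↔ γ = δ :=
  ⟨fun h => ExpGroup.ext (Zero.incl_injective h), fun h => h ▸ rfl⟩

theorem exists_exp_extension_of_mem_faces (c : Fin (n + 2)) (S : Finset (Fin (n + 2))) (hS : c ∉ S)
    (α : Fin (n + 2) → ExpGroup k (g.forms n).Zero)
    (compat : ∀ i ∈ S, ∀ j ∈ S, ∀ (l : ℕ) (u v : Fin (l + 1) → Fin (n + 1)),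
      i.succAbove ∘ u = j.succAbove ∘ v → (g.pull u).exp (α i) = (g.pull v).exp (α j)) :
    ∃ γ : ExpGroup k (g.forms (n + 1)).Zero, ∀ i ∈ S, (g.pull i.succAbove).exp γ = α i := by
  obtain ⟨Y, hY, h⟩ := exists_forms_extension_of_mem_faces c S hS
    (fun i => Zero.incl _ (α i).log) (fun i _ => Zero.incl_mem _)
    (fun i hi j hj l u v huv => incl_log_eq_iff.2 (compat i hi j hj l u v huv))
  exact ⟨ExpGroup.exp (⟨Y, hY⟩ : (g.forms (n + 1)).deg 0), fun i hi => incl_log_eq_iff.1 (h i hi)⟩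

/-- The logarithm identifies gauge transformations with forms of degree zero, and restriction and
`f` act linearly on logarithms; the group law plays no role in gluing. -/
theorem exists_exp_extension {f : Hom g h} (hf : Function.Surjective f.toLinearMap)
    (α : Fin (n + 2) → ExpGroup k (g.forms n).Zero)
    (compat : ∀ i j (l : ℕ) (u v : Fin (l + 1) → Fin (n + 1)), i.succAbove ∘ u = j.succAbove ∘ v →
      (g.pull u).exp (α i) = (g.pull v).exp (α j))
    (δ : ExpGroup k (h.forms (n + 1)).Zero)
    (hδ : ∀ i, (f.forms n).exp (α i) = (h.pull i.succAbove).exp δ) :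
    ∃ γ : ExpGroup k (g.forms (n + 1)).Zero, (∀ i, (g.pull i.succAbove).exp γ = α i) ∧
      (f.forms (n + 1)).exp γ = δ := by
  obtain ⟨Y, hY, h1, h2⟩ := exists_forms_extension hf
    (fun i => Zero.incl _ (α i).log) (fun i => Zero.incl_mem _)
    (fun i j l u v huv => incl_log_eq_iff.2 (compat i j l u v huv)) (Zero.incl_mem δ.log)
    (fun i => incl_log_eq_iff.2 (hδ i))
  exact ⟨ExpGroup.exp (⟨Y, hY⟩ : (g.forms (n + 1)).deg 0), fun i => incl_log_eq_iff.1 (h1 i),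
    incl_log_eq_iff.1 h2⟩

end Extension

end DGLie

/-! ### Lifting properties in terms of simplices with prescribed faces. -/

namespace SSet

open Simplicial Opposite Limits

lemma stdSimplex_map_comp_eq {l n : ℕ} {u v : ⦋l⦌ ⟶ ⦋n⦌} {i j : Fin (n + 2)}
    (h : u ≫ SimplexCategory.δ i = v ≫ SimplexCategory.δ j) :
    SSet.stdSimplex.{u}.map u ≫ SSet.stdSimplex.δ i =
      SSet.stdSimplex.map v ≫ SSet.stdSimplex.δ j :=
  (SSet.stdSimplex.{u}.map_comp _ _).symm.trans
    ((congrArg (fun w => SSet.stdSimplex.{u}.map w) h).trans (SSet.stdSimplex.map_comp _ _))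

/-- Acyclic fibrations in terms of simplices with prescribed faces. -/
lemma acyclicFibration_of_exists {X Y : SSet.{u}} (p : X ⟶ Y)
    (h0 : ∀ y : Y.obj (op ⦋0⦌), ∃ x, p.app _ x = y)
    (h : ∀ (n : ℕ) (z : Fin (n + 2) → X.obj (op ⦋n⦌)) (y : Y.obj (op ⦋n + 1⦌)),
      (∀ i j (l : ℕ) (u v : ⦋l⦌ ⟶ ⦋n⦌), u ≫ SimplexCategory.δ i = v ≫ SimplexCategory.δ j →
        X.map u.op (z i) = X.map v.op (z j)) →
      (∀ i, Y.map (SimplexCategory.δ i).op y = p.app _ (z i)) →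
      ∃ x, (∀ i, X.map (SimplexCategory.δ i).op x = z i) ∧ p.app _ x = y) :
    AcyclicFibration p := by
  rintro A B _ ⟨n⟩
  refine ⟨fun {a b} sq => ?_⟩
  cases n with
  | zero =>
    obtain ⟨x, hx⟩ := h0 (yonedaEquiv b)
    exact ⟨⟨{
      l := yonedaEquiv.symm x
      fac_left := boundary.hom_ext₀
      fac_right := by
        apply yonedaEquiv.injective
        rw [yonedaEquiv_comp, Equiv.apply_symm_apply, hx] }⟩⟩
  | succ n =>
    obtain ⟨x, hx, hx'⟩ := h n (fun i => yonedaEquiv (boundary.ι i ≫ a)) (yonedaEquiv b)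
      (fun i j l u v huv => by
        rw [yonedaEquiv_naturality, yonedaEquiv_naturality, ← Category.assoc, ← Category.assoc]
        congr 2
        rw [← cancel_mono (boundary (n + 1)).ι, Category.assoc, Category.assoc, boundary.ι_ι,
          boundary.ι_ι]
        exact stdSimplex_map_comp_eq huv)
      (fun i => by
        rw [yonedaEquiv_naturality, ← yonedaEquiv_comp, Category.assoc, sq.w, ← Category.assoc,
          boundary.ι_ι]
        rfl)
    exact ⟨⟨{
      l := yonedaEquiv.symm x
      fac_left := boundary.hom_ext fun i => by
        apply yonedaEquiv.injective
        rw [← Category.assoc, boundary.ι_ι]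
        change yonedaEquiv (SSet.stdSimplex.map _ ≫ _) = _
        rw [← yonedaEquiv_naturality, Equiv.apply_symm_apply, hx]
      fac_right := by
        apply yonedaEquiv.injective
        rw [yonedaEquiv_comp, Equiv.apply_symm_apply, hx'] }⟩⟩

/-- Kan complexes in terms of simplices with prescribed faces. -/
lemma kanComplex_of_exists {X : SSet.{u}}
    (h : ∀ (n : ℕ) (c : Fin (n + 2)) (z : Fin (n + 2) → X.obj (op ⦋n⦌)),
      (∀ i j, i ≠ c → j ≠ c → ∀ (l : ℕ) (u v : ⦋l⦌ ⟶ ⦋n⦌),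
        u ≫ SimplexCategory.δ i = v ≫ SimplexCategory.δ j → X.map u.op (z i) = X.map v.op (z j)) →
      ∃ x, ∀ i, i ≠ c → X.map (SimplexCategory.δ i).op x = z i) :
    KanComplex X := by
  classical
  rw [KanComplex.iff]
  intro n c f hf
  obtain ⟨φ, hφ⟩ := hf.exists_desc
  -- The family of faces must also have an entry at the missing index `c`; a copy of another face
  -- serves as a dummy.
  obtain ⟨d, hd⟩ := exists_ne c
  obtain ⟨x, hx⟩ := h n c (fun i => if hi : i = c then yonedaEquiv (f d hd) else
    yonedaEquiv (f i hi)) (fun i j hi hj l u v huv => by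
      rw [dif_neg hi, dif_neg hj, ← hφ i hi, ← hφ j hj, yonedaEquiv_naturality,
        yonedaEquiv_naturality, ← Category.assoc, ← Category.assoc]
      congr 2
      rw [← cancel_mono (horn (n + 1) c).ι, Category.assoc, Category.assoc, horn.ι_ι,
        horn.ι_ι]
      exact stdSimplex_map_comp_eq huv)
  refine ⟨yonedaEquiv.symm x, fun j hj => ?_⟩
  apply yonedaEquiv.injective
  change yonedaEquiv (SSet.stdSimplex.map _ ≫ _) = _
  rw [← yonedaEquiv_naturality, Equiv.apply_symm_apply, hx j hj, dif_neg hj]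

/-- By the Yoneda lemma simplices are maps from a standard simplex, to which the universal property
applies. -/
lemma pullback_simplex_ext {X Y S : SSet.{u}} {f : X ⟶ S} {g : Y ⟶ S} {n : ℕ}
    {a b : (pullback f g).obj (op ⦋n⦌)}
    (h1 : (pullback.fst f g).app _ a = (pullback.fst f g).app _ b)
    (h2 : (pullback.snd f g).app _ a = (pullback.snd f g).app _ b) : a = b := by
  apply yonedaEquiv.symm.injective
  apply pullback.hom_ext
  · rw [yonedaEquiv_symm_comp, yonedaEquiv_symm_comp, h1]
  · rw [yonedaEquiv_symm_comp, yonedaEquiv_symm_comp, h2]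

end SSet

/-! ### The map `τ`: construction, uniqueness and naturality. -/

namespace DGLie

open Simplicial Opposite

variable {k : Type u} [Field k] [CharZero k] {g h : DGLie k} [g.IsNilpotent] [h.IsNilpotent]

lemma Deligne.ext_val {x y : Deligne g} (e : x.val = y.val) : x = y := by
  cases x; cases y; cases e; rfl

/-- Arrows are compared as elements of the single group `exp(g⁰)`, which avoids transport between
hom-sets with different endpoints. -/
lemma Deligne.functor_ext {C : Type*} [Category C] {F G : C ⥤ Deligne g}
    (h1 : ∀ i, (F.obj i).val = (G.obj i).val)
    (h2 : ∀ {i j} (f : i ⟶ j), (F.map f).1 = (G.map f).1) : F = G := by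
  obtain ⟨o, m, _, _⟩ := F
  obtain ⟨o', m', _, _⟩ := G
  obtain rfl : o = o' := funext fun i => Deligne.ext_val (h1 i)
  obtain rfl : @m = @m' := by
    funext i j f
    exact Subtype.ext (h2 f)
  rfl

/-- The functor to the Deligne groupoid defined by a Maurer-Cartan form on the simplex. -/
noncomputable def tauFunctor {n : ℕ} (γ : ExpGroup k (g.forms n).Zero) (x : g.carrier)
    (hx : x ∈ g.MC) : Fin (n + 1) ⥤ Deligne g where
  obj i := ⟨gauge (gaugeAtVertex i γ) x, gauge_mem_MC _ hx⟩
  map {i j} _ := ⟨(gaugeAtVertex i γ)⁻¹ * gaugeAtVertex j γ, by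
    rw [← gauge_mul, mul_inv_cancel_left]⟩
  map_id i := Subtype.ext (inv_mul_cancel _)
  map_comp {i j l} _ _ := Subtype.ext (show (gaugeAtVertex i γ)⁻¹ * gaugeAtVertex l γ =
    ((gaugeAtVertex i γ)⁻¹ * gaugeAtVertex j γ) * ((gaugeAtVertex j γ)⁻¹ * gaugeAtVertex l γ) by
      group)

lemma tauFunctor_eq {n : ℕ} {γ γ' : ExpGroup k (g.forms n).Zero} {x x' : g.carrier}
    (hx : x ∈ g.MC) (hx' : x' ∈ g.MC)
    (e : gauge γ ((g.constForms n).toLinearMap x) = gauge γ' ((g.constForms n).toLinearMap x')) :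
    tauFunctor γ x hx = tauFunctor γ' x' hx' := by
  refine Deligne.functor_ext (fun i => ?_) fun {i j} _ => transport_eq hx e i j
  have := congrArg (g.atVertex n i).toLinearMap e
  rwa [atVertex_gauge_const, atVertex_gauge_const] at this

lemma exists_eq_gauge {n : ℕ} {z : (g.forms n).carrier} (hz : z ∈ (g.forms n).MC) :
    ∃ γ : ExpGroup k (g.forms n).Zero,
      z = gauge γ ((g.constForms n).toLinearMap ((g.atVertex n 0).toLinearMap z)) := by
  obtain ⟨γ, -, h⟩ := exists_eq_gauge_const hz 0 (ρ := 1) (gauge_one _).symm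
  exact ⟨γ, h⟩

/-- The simplex of the nerve of the Deligne groupoid defined by a Maurer-Cartan form. -/
noncomputable def tauApp {n : ℕ} (z : (g.forms n).MC) : Fin (n + 1) ⥤ Deligne g :=
  tauFunctor (exists_eq_gauge z.2).choose _ ((g.atVertex n 0).map_mem_MC z.2)

/-- Although `tauApp` is defined by a choice, any presentation computes it; naturality and the
defining property all go through this. -/
lemma tauApp_eq {n : ℕ} (z : (g.forms n).MC) (γ : ExpGroup k (g.forms n).Zero) {x : g.carrier}
    (hx : x ∈ g.MC) (hz : z.1 = gauge γ ((g.constForms n).toLinearMap x)) :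
    tauApp z = tauFunctor γ x hx :=
  tauFunctor_eq _ _ ((exists_eq_gauge z.2).choose_spec.symm.trans hz)

lemma exists_tauApp_eq {n : ℕ} (z : (g.forms n).MC) :
    ∃ (γ : ExpGroup k (g.forms n).Zero) (x : g.carrier) (hx : x ∈ g.MC),
      z.1 = gauge γ ((g.constForms n).toLinearMap x) ∧ tauApp z = tauFunctor γ x hx :=
  ⟨_, _, _, (exists_eq_gauge z.2).choose_spec, rfl⟩

lemma tauApp_pull {m n : ℕ} (u : Fin (m + 1) →o Fin (n + 1)) (z : (g.forms n).MC) :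
    tauApp ((g.pull u).mapMC z) = u.monotone.functor ⋙ tauApp z := by
  obtain ⟨γ, x, hx, hz, h⟩ := exists_tauApp_eq z
  rw [h, tauApp_eq ((g.pull u).mapMC z) ((g.pull u).exp γ) hx
    (by rw [← pull_gauge_const, ← hz]; rfl)]
  refine Deligne.functor_ext (fun i => ?_) fun {i j} _ => ?_
  · change gauge (gaugeAtVertex i _) x = gauge (gaugeAtVertex (u i) γ) x
    rw [gaugeAtVertex_pull]
  · change (gaugeAtVertex i _)⁻¹ * gaugeAtVertex j _ =
      (gaugeAtVertex (u i) γ)⁻¹ * gaugeAtVertex (u j) γ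
    rw [gaugeAtVertex_pull, gaugeAtVertex_pull]

variable (g) in
/-- The map from the contents to the nerve of the Deligne groupoid. -/
noncomputable def tau : g.contents ⟶ nerve (Deligne g) where
  app Δ := ↾fun z => tauApp (n := Δ.unop.len) z
  naturality Δ Δ' u := by
    ext z
    exact tauApp_pull (n := Δ.unop.len) u.unop.toOrderHom z

lemma tau_app {n : ℕ} (z : (g.forms n).MC) : (tau g).app (op ⦋n⦌) z = tauApp z := rfl

lemma tau_isTau : IsTau g (tau g) := by
  intro n z γ x hx hz
  have := tauApp_eq z γ hx hz
  rw [tau_app, this]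
  exact ⟨fun i => rfl, fun i j hij => rfl⟩

/-- Every simplex has a presentation, so the defining property leaves no freedom. -/
lemma IsTau.eq {τ τ' : g.contents ⟶ nerve (Deligne g)} (hτ : IsTau g τ) (hτ' : IsTau g τ') :
    τ = τ' := by
  ext ⟨Δ⟩ z
  induction Δ using SimplexCategory.rec with
  | _ n =>
    obtain ⟨γ, x, hx, hz, -⟩ := exists_tauApp_eq (n := n) z
    refine Deligne.functor_ext (fun i => ?_) fun {i j} f => ?_
    · exact ((hτ n z γ x hx hz).1 i).trans ((hτ' n z γ x hx hz).1 i).symm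
    · exact ((hτ n z γ x hx hz).2 i j (leOfHom f)).trans ((hτ' n z γ x hx hz).2 i j (leOfHom f)).symm

lemma tauApp_map (f : Hom g h) {n : ℕ} (z : (g.forms n).MC) :
    tauApp z ⋙ Deligne.map f = tauApp ((f.forms n).mapMC z) := by
  obtain ⟨γ, x, hx, hz, e⟩ := exists_tauApp_eq z
  rw [e, tauApp_eq ((f.forms n).mapMC z) ((f.forms n).exp γ) (f.map_mem_MC hx)
    (by rw [← forms_gauge_const, ← hz]; rfl)]
  refine Deligne.functor_ext (fun i => ?_) fun {i j} _ => ?_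
  · change f.toLinearMap (gauge _ x) = gauge (gaugeAtVertex i _) _
    rw [gaugeAtVertex_forms, Hom.gauge_exp]
  · change f.exp ((gaugeAtVertex i γ)⁻¹ * gaugeAtVertex j γ) = (gaugeAtVertex i _)⁻¹ *
      gaugeAtVertex j _
    rw [gaugeAtVertex_forms, gaugeAtVertex_forms, map_mul, map_inv]

lemma tau_naturality (f : Hom g h) :
    tau g ≫ nerveMap (Deligne.map f) = contentsMap f ≫ tau h := by
  ext Δ z
  exact tauApp_map f (n := Δ.unop.len) z

end DGLie

/-! ### Lifting of Maurer-Cartan forms: boundaries, horns and the acyclic fibrations. -/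

namespace DGLie

open Simplicial Opposite

variable {k : Type u} [Field k] [CharZero k] {g h : DGLie k} [g.IsNilpotent] [h.IsNilpotent]

lemma Deligne.map_val_congr {C : Type*} [Category C] {F G : C ⥤ Deligne g} (e : F = G) {i j : C}
    (f : i ⟶ j) : (F.map f).1 = (G.map f).1 := by subst e; rfl

lemma Deligne.obj_val_congr {C : Type*} [Category C] {F G : C ⥤ Deligne g} (e : F = G) (i : C) :
    (F.obj i).val = (G.obj i).val := by subst e; rfl

lemma tauApp_obj_val {n : ℕ} (z : (g.forms n).MC) (i : Fin (n + 1)) :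
    ((tauApp z).obj i).val = (g.atVertex n i).toLinearMap z.1 := by
  obtain ⟨γ, x, hx, hz, e⟩ := exists_tauApp_eq z
  rw [e, hz, atVertex_gauge_const]
  rfl

/-- Maurer-Cartan forms on the simplex can be constructed from their restrictions to the faces, their
images under a surjective morphism, and the corresponding simplex in the Deligne groupoid. -/
theorem exists_MC_extension {f : Hom g h} (hf : Function.Surjective f.toLinearMap) {n : ℕ}
    (z : Fin (n + 2) → (g.forms n).MC) (σ : Fin (n + 2) ⥤ Deligne g) (w : (h.forms (n + 1)).MC)
    (compat : ∀ i j (l : ℕ) (u v : Fin (l + 1) →o Fin (n + 1)),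
      i.succAbove ∘ u = j.succAbove ∘ v →
        (g.pull u).toLinearMap (z i).1 = (g.pull v).toLinearMap (z j).1)
    (hσ : ∀ i : Fin (n + 2), tauApp (z i) = i.strictMono_succAbove.monotone.functor ⋙ σ)
    (hw : ∀ i : Fin (n + 2), (f.forms n).toLinearMap (z i).1 =
      (h.pull i.succAbove).toLinearMap w.1)
    (hσw : σ ⋙ Deligne.map f = tauApp w) :
    ∃ Z : (g.forms (n + 1)).MC, (∀ i : Fin (n + 2),
      (g.pull i.succAbove).toLinearMap Z.1 = (z i).1) ∧
        (f.forms (n + 1)).toLinearMap Z.1 = w.1 ∧ tauApp Z = σ := by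
  set x := (σ.obj 0).val with hxdef
  have hx : x ∈ g.MC := (σ.obj 0).mem
  -- With base point the vertex `0` of `σ`, the edges issuing from it are the values at the vertices
  -- that the gauge transformation must take.
  set ρ : Fin (n + 2) → ExpGroup k g.Zero := fun j => (σ.map (homOfLE (Fin.zero_le j))).1 with hρ
  have hρx : ∀ j, gauge (ρ j) x = (σ.obj j).val := fun j => (σ.map (homOfLE (Fin.zero_le j))).2
  have hρm : ∀ {i j : Fin (n + 2)} (e : i ⟶ j), ρ i * (σ.map e).1 = ρ j := by
    intro i j e
    have := σ.map_comp (homOfLE (Fin.zero_le i)) e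
    exact (congrArg Subtype.val this).symm
  -- Prescribing the value at the first vertex of the face suffices; the others follow because `τ`
  -- of the face is the corresponding face of `σ`.
  have h1 : ∀ i : Fin (n + 2), ∃ α : ExpGroup k (g.forms n).Zero,
      (∀ j, gaugeAtVertex j α = ρ (i.succAbove j)) ∧
        (z i).1 = gauge α ((g.constForms n).toLinearMap x) := by
    intro i
    obtain ⟨α, hα0, hα⟩ := exists_eq_gauge_const (z i).2 0 (x := x) (ρ := ρ (i.succAbove 0)) (by
      rw [← tauApp_obj_val, hσ, hρx]
      rfl)
    refine ⟨α, fun j => ?_, hα⟩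
    have e := (tauApp_eq (z i) α hx hα).symm.trans (hσ i)
    have e1 := Deligne.map_val_congr e (homOfLE (Fin.zero_le j))
    change (gaugeAtVertex 0 α)⁻¹ * gaugeAtVertex j α = (σ.map _).1 at e1
    rw [inv_mul_eq_iff_eq_mul, hα0] at e1
    rw [e1]
    exact hρm _
  choose α hαv hα using h1
  obtain ⟨δ, hδ0, hδ⟩ := exists_eq_gauge_const w.2 0 (x := f.toLinearMap x) (ρ := 1) (by
    rw [gauge_one, ← tauApp_obj_val, ← hσw]
    rfl)
  have hδv : ∀ j, gaugeAtVertex j δ = f.exp (ρ j) := by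
    intro j
    have e := (tauApp_eq w δ (f.map_mem_MC hx) hδ).symm.trans hσw.symm
    have e1 := Deligne.map_val_congr e (homOfLE (Fin.zero_le j))
    change (gaugeAtVertex 0 δ)⁻¹ * gaugeAtVertex j δ = f.exp (ρ j) at e1
    rwa [hδ0, inv_one, one_mul] at e1
  -- Compatibility on overlaps, and with `δ`, is not assumed but follows from uniqueness: both
  -- transformations have the same effect on a constant form and the same value at a vertex.
  obtain ⟨γ, hγ, hγf⟩ := exists_exp_extension hf α (fun i j l u v huv => by
    refine eq_of_gauge_const_eq hx.1 ?_ 0 ?_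
    · rw [← pull_gauge_const, ← pull_gauge_const, ← hα, ← hα]
      exact compat_of_monotone (M := fun n => (g.forms n).carrier)
        (fun u => (g.pull u).toLinearMap) (fun u v x => pull_pull u v x) (fun _ => True)
        (fun i => (z i).1) (fun i j _ _ => compat i j) trivial trivial huv
    · rw [gaugeAtVertex_pull, gaugeAtVertex_pull, hαv, hαv]
      exact congrArg ρ (congrFun huv 0)) δ (fun i => by
    refine eq_of_gauge_const_eq (f.map_deg hx.1) ?_ 0 ?_
    · rw [← forms_gauge_const, ← pull_gauge_const, ← hα, ← hδ, hw]
    · rw [gaugeAtVertex_forms, gaugeAtVertex_pull, hαv, hδv])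
  have hγv : ∀ j, gaugeAtVertex j γ = ρ j := by
    intro j
    -- Every vertex lies on some face, where its value is known.
    obtain ⟨i, hi⟩ := exists_ne j
    obtain ⟨l, rfl⟩ := Fin.exists_succAbove_eq hi.symm
    rw [← hαv, ← hγ, gaugeAtVertex_pull]
  refine ⟨⟨gauge γ ((g.constForms (n + 1)).toLinearMap x),
    gauge_mem_MC γ ((g.constForms _).map_mem_MC hx)⟩, fun i => ?_, ?_, ?_⟩
  · rw [pull_gauge_const, hγ, hα]
  · rw [forms_gauge_const, hγf, hδ]
  · rw [tauApp_eq _ γ hx rfl]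
    refine Deligne.functor_ext (fun i => ?_) fun {i j} e => ?_
    · change gauge (gaugeAtVertex i γ) x = _
      rw [hγv, hρx]
    · change (gaugeAtVertex i γ)⁻¹ * gaugeAtVertex j γ = _
      rw [hγv, hγv, ← hρm e, inv_mul_cancel_left]

/-- The zero-dimensional lifting problem, where the boundary is empty: a vertex is lifted by the
constant form. -/
lemma tauApp_zero (σ : Fin 1 ⥤ Deligne g) : tauApp ((g.constForms 0).mapMC ⟨(σ.obj 0).val,
    (σ.obj 0).mem⟩) = σ := by
  rw [tauApp_eq ((g.constForms 0).mapMC ⟨(σ.obj 0).val, (σ.obj 0).mem⟩) 1 (σ.obj 0).mem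
    (gauge_one _).symm]
  refine Deligne.functor_ext (fun i => ?_) fun {i j} e => ?_
  · obtain rfl := Fin.fin_one_eq_zero i
    change gauge (gaugeAtVertex 0 1) _ = _
    rw [map_one, gauge_one]
  · obtain rfl := Fin.fin_one_eq_zero i
    obtain rfl := Fin.fin_one_eq_zero j
    obtain rfl : e = 𝟙 _ := Subsingleton.elim _ _
    rw [CategoryTheory.Functor.map_id, CategoryTheory.Functor.map_id]
    rfl

/-- The horn filling property of Maurer-Cartan forms. -/
theorem exists_MC_horn_extension {n : ℕ} (c : Fin (n + 2)) (z : Fin (n + 2) → (g.forms n).MC)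
    (compat : ∀ i j, i ≠ c → j ≠ c → ∀ (l : ℕ) (u v : Fin (l + 1) →o Fin (n + 1)),
      i.succAbove ∘ u = j.succAbove ∘ v →
        (g.pull u).toLinearMap (z i).1 = (g.pull v).toLinearMap (z j).1) :
    ∃ Z : (g.forms (n + 1)).MC, ∀ i : Fin (n + 2), i ≠ c →
      (g.pull i.succAbove).toLinearMap Z.1 = (z i).1 := by
  classical
  have compat' : ∀ {i j}, i ≠ c → j ≠ c → ∀ {l : ℕ} {u v : Fin (l + 1) → Fin (n + 1)},
      i.succAbove ∘ u = j.succAbove ∘ v →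
        (g.pull u).toLinearMap (z i).1 = (g.pull v).toLinearMap (z j).1 := fun hi hj _ _ _ huv =>
    compat_of_monotone (M := fun n => (g.forms n).carrier)
        (fun u => (g.pull u).toLinearMap) (fun u v x => pull_pull u v x) (fun i => i ≠ c)
        (fun i => (z i).1) compat hi hj huv
  -- The vertex `c` lies on every face of the horn, and `q i` is its position there. It serves as
  -- base point, so the gauges can be normalized to `1` at `c` without any nerve simplex.
  have hv : ∀ i : Fin (n + 2), ∃ j, i ≠ c → i.succAbove j = c := by
    intro i
    by_cases hi : i = c
    · exact ⟨0, fun h => absurd hi h⟩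
    · obtain ⟨j, hj⟩ := Fin.exists_succAbove_eq (Ne.symm hi)
      exact ⟨j, fun _ => hj⟩
  choose q hq using hv
  obtain ⟨d, hd⟩ := exists_ne c
  set x := (g.atVertex n (q d)).toLinearMap (z d).1 with hxdef
  have hx : x ∈ g.MC := (g.atVertex n (q d)).map_mem_MC (z d).2
  have hzx : ∀ i, i ≠ c → (g.atVertex n (q i)).toLinearMap (z i).1 = x := by
    intro i hi
    have := compat' hi hd (u := fun _ : Fin 1 => q i) (v := fun _ => q d) (funext fun _ =>
      (hq i hi).trans (hq d hd).symm)
    have := congrArg (g.atVertex 0 0).toLinearMap this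
    rwa [atVertex_pull_apply, atVertex_pull_apply] at this
  have h1 : ∀ i, ∃ α : ExpGroup k (g.forms n).Zero, i ≠ c → gaugeAtVertex (q i) α = 1 ∧
      (z i).1 = gauge α ((g.constForms n).toLinearMap x) := by
    intro i
    by_cases hi : i = c
    · exact ⟨1, fun h => absurd hi h⟩
    · obtain ⟨α, h⟩ := exists_eq_gauge_const (z i).2 (q i) (x := x) (ρ := 1)
        ((hzx i hi).trans (gauge_one _).symm)
      exact ⟨α, fun _ => h⟩
  choose α hα using h1
  obtain ⟨γ, hγ⟩ := exists_exp_extension_of_mem_faces c (Finset.univ.erase c) (by simp) α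
    (fun i hi j hj l u v huv => by
      have hi := Finset.ne_of_mem_erase hi
      have hj := Finset.ne_of_mem_erase hj
      -- Uniqueness requires a vertex where the values agree, but a subsimplex of the overlap need
      -- not contain `c`. So `c` is adjoined as an extra first vertex, equality is proved there, and
      -- the result is restricted again.
      have key : (g.pull (Fin.cons (q i) u : Fin (l + 2) → Fin (n + 1))).exp (α i) =
          (g.pull (Fin.cons (q j) v : Fin (l + 2) → Fin (n + 1))).exp (α j) := by
        refine eq_of_gauge_const_eq hx.1 ?_ 0 ?_
        · rw [← pull_gauge_const, ← pull_gauge_const, ← (hα i hi).2, ← (hα j hj).2]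
          refine compat' hi hj (funext fun a => ?_)
          refine Fin.cases ?_ (fun a => ?_) a
          · exact (hq i hi).trans (hq j hj).symm
          · exact congrFun huv a
        · rw [gaugeAtVertex_pull, gaugeAtVertex_pull]
          exact (hα i hi).1.trans (hα j hj).1.symm
      have := congrArg (g.pull (Fin.succ : Fin (l + 1) → Fin (l + 2))).exp key
      rwa [exp_pull_pull, exp_pull_pull] at this)
  refine ⟨⟨gauge γ ((g.constForms (n + 1)).toLinearMap x),
    gauge_mem_MC γ ((g.constForms _).map_mem_MC hx)⟩, fun i hi => ?_⟩
  rw [pull_gauge_const, hγ i (by simp [hi]), (hα i hi).2]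

lemma contents_compat {n : ℕ} {p : Fin (n + 2) → Prop} {z : Fin (n + 2) → g.contents.obj (op ⦋n⦌)}
    (hz : ∀ i j, p i → p j → ∀ (l : ℕ) (u v : ⦋l⦌ ⟶ ⦋n⦌),
      u ≫ SimplexCategory.δ i = v ≫ SimplexCategory.δ j →
        g.contents.map u.op (z i) = g.contents.map v.op (z j))
    (i j : Fin (n + 2)) (hi : p i) (hj : p j) (l : ℕ) (u v : Fin (l + 1) →o Fin (n + 1))
    (huv : i.succAbove ∘ u = j.succAbove ∘ v) :
    (g.pull u).toLinearMap (z i).1 = (g.pull v).toLinearMap (z j).1 :=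
  congrArg Subtype.val (hz i j hi hj l (SimplexCategory.mkHom u) (SimplexCategory.mkHom v)
    (SimplexCategory.Hom.ext _ _ (OrderHom.ext _ _ huv)))

theorem contents_kanComplex : SSet.KanComplex g.contents :=
  SSet.kanComplex_of_exists fun n c z hz => by
    obtain ⟨Z, hZ⟩ := exists_MC_horn_extension c z (contents_compat (p := fun i => i ≠ c) hz)
    exact ⟨Z, fun i hi => Subtype.ext (hZ i hi)⟩

section

open Limits

/-- A simplex of the fibre product is a pair consisting of a simplex of the nerve and a
Maurer-Cartan form with values in `h` over the same simplex of the nerve for `h`, which is the input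
of `exists_MC_extension`. -/
theorem acyclicFibration_pullback_lift {f : Hom g h} (hf : Function.Surjective f.toLinearMap)
    (comm : tau g ≫ nerveMap (Deligne.map f) = contentsMap f ≫ tau h) :
    SSet.AcyclicFibration (pullback.lift (tau g) (contentsMap f) comm) := by
  have hfst : ∀ (n : ℕ) (z : g.contents.obj (op ⦋n⦌)), (pullback.fst (nerveMap (Deligne.map f)) (tau h)).app _
      ((pullback.lift (tau g) (contentsMap f) comm).app _ z) = (tau g).app _ z := fun n z =>
    ConcreteCategory.congr_hom (congr_app (pullback.lift_fst (tau g) (contentsMap f) comm) _) z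
  have hsnd : ∀ (n : ℕ) (z : g.contents.obj (op ⦋n⦌)), (pullback.snd (nerveMap (Deligne.map f)) (tau h)).app _
      ((pullback.lift (tau g) (contentsMap f) comm).app _ z) = (contentsMap f).app _ z := fun n z =>
    ConcreteCategory.congr_hom (congr_app (pullback.lift_snd (tau g) (contentsMap f) comm) _) z
  have hcond : ∀ (n : ℕ) (y : (pullback (nerveMap (Deligne.map f)) (tau h)).obj (op ⦋n⦌)),
      (nerveMap (Deligne.map f)).app _ ((pullback.fst (nerveMap (Deligne.map f)) (tau h)).app _ y) =
        (tau h).app _ ((pullback.snd (nerveMap (Deligne.map f)) (tau h)).app _ y) := fun n y =>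
    ConcreteCategory.congr_hom 
      (congr_app (pullback.condition (f := nerveMap (Deligne.map f)) (g := tau h)) _) y
  refine SSet.acyclicFibration_of_exists _ (fun y => ?_) (fun n z y hz hy => ?_)
  · let σ : Fin 1 ⥤ Deligne g :=
      (pullback.fst (nerveMap (Deligne.map f)) (tau h)).app _ y
    let w : (h.forms 0).MC :=
      (pullback.snd (nerveMap (Deligne.map f)) (tau h)).app _ y
    have hc : σ ⋙ Deligne.map f = tauApp w := hcond 0 y
    refine ⟨(g.constForms 0).mapMC ⟨(σ.obj 0).val, (σ.obj 0).mem⟩, SSet.pullback_simplex_ext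
      ((hfst _ _).trans (tauApp_zero σ)) ((hsnd _ _).trans (Subtype.ext ?_))⟩
    change (f.forms 0).toLinearMap ((g.constForms 0).toLinearMap _) = w.1
    have := Deligne.obj_val_congr hc 0
    rw [tauApp_obj_val] at this
    rw [forms_const_apply, ← const_atVertex_zero_apply w.1, ← this]
    rfl
  · obtain ⟨Z, hZ1, hZ2, hZ3⟩ := exists_MC_extension hf z ((pullback.fst (nerveMap (Deligne.map f)) (tau h)).app _ y)
      ((pullback.snd (nerveMap (Deligne.map f)) (tau h)).app _ y)
      (fun i j => contents_compat (p := fun _ => True) (fun i j _ _ => hz i j) i j trivial trivial)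
      (fun i => by
        have h1 := congrArg ((pullback.fst (nerveMap (Deligne.map f)) (tau h)).app _) (hy i)
        rw [hfst, NatTrans.naturality_apply] at h1
        exact h1.symm)
      (fun i => by
        have h1 := congrArg ((pullback.snd (nerveMap (Deligne.map f)) (tau h)).app _) (hy i)
        rw [hsnd, NatTrans.naturality_apply] at h1
        exact (congrArg Subtype.val h1).symm)
      (hcond _ y)
    exact ⟨Z, fun i => Subtype.ext (hZ1 i), SSet.pullback_simplex_ext
      ((hfst _ _).trans hZ3) ((hsnd _ _).trans (Subtype.ext hZ2))⟩

end

section Trivial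

lemma isInternal_of_subsingleton {V : Type*} [AddCommGroup V] [Module k V] [Subsingleton V]
    (deg : ℕ → Submodule k V) : DirectSum.IsInternal deg :=
  ⟨fun _ _ _ => DFinsupp.ext fun _ => Subsingleton.elim _ _, fun _ => ⟨0, Subsingleton.elim _ _⟩⟩

variable (k) in
/-- The zero dg Lie algebra. -/
noncomputable def trivial : DGLie k where
  carrier := PUnit
  deg _ := ⊥
  isInternal := isInternal_of_subsingleton _
  br := 0
  br_mem _ _ := rfl
  br_skew _ _ := rfl
  jacobi _ _ _ := rfl
  d := 0
  d_mem _ := rfl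
  d_d _ := rfl
  d_br _ _ := rfl

instance : Subsingleton (trivial k).carrier := inferInstanceAs (Subsingleton PUnit)

instance : (trivial k).IsNilpotent := ⟨0, Subsingleton.elim _ _⟩

instance (n : ℕ) : Subsingleton ((trivial k).forms n).carrier :=
  inferInstanceAs (Subsingleton (SimplexForms k n ⊗[k] PUnit.{u + 1}))

lemma trivial_functor_ext {C : Type*} [Category C] (F G : C ⥤ Deligne (trivial k)) : F = G :=
  Deligne.functor_ext (fun _ => Subsingleton.elim _ _) fun _ =>
    ExpGroup.ext (Zero.incl_injective (Subsingleton.elim _ _))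

/-- The morphism to zero. -/
noncomputable def toTrivial (g : DGLie k) : Hom g (trivial k) where
  toLinearMap := 0
  map_deg _ := Subsingleton.elim _ _
  map_br _ _ := Subsingleton.elim _ _
  map_d _ := Subsingleton.elim _ _

/-- The relative extension theorem for the surjection `g → 0`, where every condition on the target
is void. -/
theorem acyclicFibration_tau : SSet.AcyclicFibration (tau g) := by
  refine SSet.acyclicFibration_of_exists _ (fun y => ⟨_, tauApp_zero y⟩) (fun n z y hz hy => ?_)
  obtain ⟨Z, hZ1, -, hZ3⟩ := exists_MC_extension (f := toTrivial g)
    (fun y => ⟨0, Subsingleton.elim _ _⟩) z y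
    ⟨0, zero_mem _, Subsingleton.elim _ _⟩
    (fun i j => contents_compat (p := fun _ => True) (fun i j _ _ => hz i j) i j ⟨⟩ ⟨⟩)
    (fun i => (hy i).symm) (fun i => Subsingleton.elim _ _) (trivial_functor_ext _ _)
  exact ⟨Z, fun i => Subtype.ext (hZ1 i), hZ3⟩

end Trivial

end DGLie

/-! ### The Poincaré groupoid and acyclic fibrations onto nerves of groupoids. -/

namespace SSet

open Simplicial Opposite Limits

/-- Maps to the nerve of a category are determined by their values on edges. -/
lemma hom_nerve_ext {X : SSet.{u}} {D : Type u} [Category.{u} D] {f g : X ⟶ nerve D}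
    (h : ∀ e : X.obj (op ⦋1⦌), f.app _ e = g.app _ e) : f = g := by
  have h0 : ∀ x : X.obj (op ⦋0⦌), f.app _ x = g.app _ x := by
    intro x
    -- A vertex is a face of its degenerate edge, so agreement on edges covers dimension zero.
    have h1 := congrArg ((nerve D).δ (0 : Fin 2)) (h (X.σ (0 : Fin 1) x))
    have h2 : ∀ f : X ⟶ nerve D, (nerve D).δ (0 : Fin 2) (f.app _ (X.σ (0 : Fin 1) x)) =
        f.app _ x := by
      intro f
      have := NatTrans.naturality_apply f (SimplexCategory.δ (0 : Fin 2)).op (X.σ (0 : Fin 1) x)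
      refine this.symm.trans ?_
      congr 1
      exact SSet.δ_comp_σ_self_apply 0 x
    rwa [h2, h2] at h1
  ext ⟨Δ⟩ z
  induction Δ using SimplexCategory.rec with
  | _ n =>
    cases n with
    | zero => exact h0 z
    | succ n =>
      -- A simplex of a nerve is determined by its chain of consecutive edges.
      apply (Nerve.strictSegal D).spineInjective
      refine Path.ext' fun i => ?_
      have h2 := h (X.map (SimplexCategory.mkOfSucc i).op z)
      rw [NatTrans.naturality_apply, NatTrans.naturality_apply] at h2
      exact h2

/-- The face `δ 1` is the composite of `δ 2` with `δ 0`, and `δ 0` is an identity. In terms of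
simplices, `t` is the degeneration of its face `δ 2`, having the same spine. -/
lemma nerve_δ_one_eq_δ_two {D : Type u} [Category.{u} D] (t : (nerve D).obj (op ⦋2⦌))
    (y : (nerve D).obj (op ⦋0⦌)) (h : (nerve D).δ (0 : Fin 3) t = (nerve D).σ (0 : Fin 1) y) :
    (nerve D).δ (1 : Fin 3) t = (nerve D).δ (2 : Fin 3) t := by
  have h0 : (nerve D).δ (0 : Fin 2) ((nerve D).δ (2 : Fin 3) t) = y := by
    refine (SSet.δ_comp_δ_apply (i := 0) (j := (1 : Fin 2)) (Fin.zero_le _) t).trans ?_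
    exact (congrArg ((nerve D).δ (1 : Fin 2)) h).trans (SSet.δ_comp_σ_succ_apply 0 y)
  have ht : t = (nerve D).σ (1 : Fin 2) ((nerve D).δ (2 : Fin 3) t) := by
    apply (Nerve.strictSegal D).spineInjective
    refine Path.ext' fun i => ?_
    have e0 : (SimplexCategory.mkOfSucc (0 : Fin 2)) = SimplexCategory.δ (2 : Fin 3) :=
      SimplexCategory.mkOfSucc_zero_eq_δ
    have e1 : (SimplexCategory.mkOfSucc (1 : Fin 2)) = SimplexCategory.δ (0 : Fin 3) :=
      SimplexCategory.mkOfSucc_one_eq_δ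
    fin_cases i
    · change (nerve D).map (SimplexCategory.mkOfSucc (0 : Fin 2)).op _ =
        (nerve D).map (SimplexCategory.mkOfSucc (0 : Fin 2)).op _
      rw [e0]
      exact (SSet.δ_comp_σ_succ_apply (1 : Fin 2) ((nerve D).δ (2 : Fin 3) t)).symm
    · change (nerve D).map (SimplexCategory.mkOfSucc (1 : Fin 2)).op _ =
        (nerve D).map (SimplexCategory.mkOfSucc (1 : Fin 2)).op _
      rw [e1]
      refine h.trans ?_
      rw [← h0]
      exact (SSet.δ_comp_σ_of_le_apply (i := (0 : Fin 2)) (j := (0 : Fin 1)) (Fin.zero_le _)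
        ((nerve D).δ (2 : Fin 3) t)).symm
  conv_lhs => rw [ht]
  exact SSet.δ_comp_σ_self_apply (1 : Fin 2) _

/-- Acyclic fibrations lift against all monomorphisms, in particular against the inclusion of the
empty simplicial set in `Y`. -/
lemma exists_section {X Y : SSet.{u}} {p : X ⟶ Y} (hp : AcyclicFibration p) :
    ∃ s : Y ⟶ X, s ≫ p = 𝟙 Y := by
  have hp' : (MorphismProperty.monomorphisms SSet.{u}).rlp p := by
    rw [rlp_monomorphisms]; exact hp
  have hl := hp' (⊥ : Y.Subcomplex).ι (MorphismProperty.monomorphisms.infer_property _)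
  have sq : CommSq (Subcomplex.isInitialBot.to X) (⊥ : Y.Subcomplex).ι p (𝟙 Y) :=
    ⟨Subcomplex.isInitialBot.hom_ext _ _⟩
  exact ⟨sq.lift, sq.fac_right⟩

namespace FundamentalGroupoid

/-- The unit of the adjunction. -/
noncomputable def unit (X : SSet.{u}) : X ⟶ nerve (FundamentalGroupoid X) :=
  nerveAdjunction.homEquiv X (Cat.of (FundamentalGroupoid X))
    (FreeGroupoid.of (hoFunctor.obj X)).toCatHom

lemma unit_nerveMap {X : SSet.{u}} {C : Type u} [Groupoid.{u} C]
    (F : FundamentalGroupoid X ⥤ C) : unit X ≫ nerveMap F =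
      nerveAdjunction.homEquiv X (Cat.of C)
        (FreeGroupoid.of (hoFunctor.obj X) ⋙ F).toCatHom :=
  (nerveAdjunction.homEquiv_naturality_right _ F.toCatHom).symm

lemma unit_desc {X : SSet.{u}} {C : Type u} [Groupoid.{u} C] (τ : X ⟶ nerve C) :
    unit X ≫ nerveMap (desc τ) = τ := by
  have h : FreeGroupoid.of (hoFunctor.obj X) ⋙ desc τ =
      ((nerveAdjunction.homEquiv X (Cat.of C)).symm τ).toFunctor := FreeGroupoid.lift_spec _
  refine (unit_nerveMap _).trans ((congrArg (fun F : (hoFunctor.obj X : Type u) ⥤ C =>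
    nerveAdjunction.homEquiv X (Cat.of C) F.toCatHom) h).trans ?_)
  exact Equiv.apply_symm_apply _ _

lemma functor_ext {X : SSet.{u}} {C : Type u} [Groupoid.{u} C] {F G : FundamentalGroupoid X ⥤ C}
    (h : unit X ≫ nerveMap F = unit X ≫ nerveMap G) : F = G := by
  rw [unit_nerveMap, unit_nerveMap] at h
  have h1 := (nerveAdjunction.homEquiv X (Cat.of C)).injective h
  have h2 : FreeGroupoid.of (hoFunctor.obj X) ⋙ F = FreeGroupoid.of (hoFunctor.obj X) ⋙ G :=
    congrArg Cat.Hom.toFunctor h1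
  exact (FreeGroupoid.lift_unique _ F h2).trans (FreeGroupoid.lift_unique _ G rfl).symm

lemma nerveMap_injective {C D : Type u} [Category.{u} C] [Category.{u} D] {F G : C ⥤ D}
    (h : nerveMap F = nerveMap G) : F = G :=
  congrArg Cat.Hom.toFunctor (nerveFunctor.map_injective (X := Cat.of C) (Y := Cat.of D)
    (a₁ := F.toCatHom) (a₂ := G.toCatHom) h)

/-- An acyclic fibration to the nerve of a groupoid induces an isomorphism from the fundamental
groupoid as soon as edges with the same image are identified. -/
theorem exists_inverse_desc {X : SSet.{u}} {C : Type u} [Groupoid.{u} C] {τ : X ⟶ nerve C}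
    (hτ : AcyclicFibration τ)
    (h : ∀ e e' : X.obj (op ⦋1⦌), τ.app _ e = τ.app _ e' → ∃ (t : X.obj (op ⦋2⦌))
      (y : X.obj (op ⦋0⦌)), X.δ (0 : Fin 3) t = X.σ (0 : Fin 1) y ∧ X.δ (1 : Fin 3) t = e' ∧
        X.δ (2 : Fin 3) t = e) :
    ∃ G : C ⥤ FundamentalGroupoid X, desc τ ⋙ G = 𝟭 _ ∧ G ⋙ desc τ = 𝟭 _ := by
  obtain ⟨s, hs⟩ := exists_section hτ
  -- The nerve functor is full, so the section followed by the unit comes from a functor; the choice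
  -- of `s` is immaterial once `G` is shown to be inverse to `desc τ`.
  obtain ⟨G, hG⟩ : ∃ G : C ⥤ FundamentalGroupoid X, nerveMap G = s ≫ unit X :=
    ⟨(nerveFunctor.preimage (X := Cat.of C) (Y := Cat.of (FundamentalGroupoid X))
      (s ≫ unit X)).toFunctor, nerveFunctor.map_preimage (X := Cat.of C)
        (Y := Cat.of (FundamentalGroupoid X)) (s ≫ unit X)⟩
  refine ⟨G, functor_ext ?_, nerveMap_injective ?_⟩
  · have h1 : nerveMap (desc τ ⋙ G) = nerveMap (desc τ) ≫ nerveMap G := rfl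
    have h2 : nerveMap (𝟭 (FundamentalGroupoid X)) = 𝟙 _ := rfl
    rw [h1, h2, hG, ← Category.assoc, unit_desc, Category.comp_id]
    refine hom_nerve_ext fun e => ?_
    -- The edges `s(τ(e))` and `e` have the same image under `τ`, so a triangle with degenerate
    -- third side joins them, and it forces their classes to agree.
    obtain ⟨t, y, ht0, ht1, ht2⟩ := h (s.app _ (τ.app _ e)) e
      (ConcreteCategory.congr_hom (congr_app hs _) (τ.app _ e))
    have hδ : ∀ i : Fin 3, (nerve (FundamentalGroupoid X)).δ i ((unit X).app _ t) =
        (unit X).app _ (X.δ i t) := fun i =>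
      (NatTrans.naturality_apply (unit X) (SimplexCategory.δ i).op t).symm
    have := nerve_δ_one_eq_δ_two ((unit X).app _ t) ((unit X).app _ y) (by
      rw [hδ, ht0]
      exact NatTrans.naturality_apply (unit X) (SimplexCategory.σ (0 : Fin 1)).op y)
    rw [hδ, hδ, ht1, ht2] at this
    exact this.symm
  · have h1 : nerveMap (G ⋙ desc τ) = nerveMap G ≫ nerveMap (desc τ) := rfl
    have h2 : nerveMap (𝟭 C) = 𝟙 _ := rfl
    rw [h1, h2, hG, Category.assoc, unit_desc, hs]

end FundamentalGroupoid

end SSet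

/-! ### Edges with the same transport are homotopic. -/

namespace DGLie

open Simplicial Opposite

variable {k : Type u} [Field k] [CharZero k] {g : DGLie k} [g.IsNilpotent]

lemma pull_eq_of_constant {m n : ℕ} {u : Fin (m + 1) → Fin (n + 1)} {a : Fin (n + 1)}
    (hu : ∀ x, u x = a) (z : (g.forms n).carrier) : (g.pull u).toLinearMap z =
      (g.constForms m).toLinearMap ((g.atVertex n a).toLinearMap z) := by
  have h1 : u = (fun _ : Fin 1 => a) ∘ (fun _ => 0) := funext hu
  rw [h1, ← pull_pull, ← const_atVertex_zero_apply ((g.pull _).toLinearMap z),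
    atVertex_pull_apply, pull_const_apply]

/-- Edges of the contents with the same image in the nerve of the Deligne groupoid are
homotopic. -/
lemma exists_triangle {e e' : (g.forms 1).MC} (he : tauApp e = tauApp e') :
    ∃ Z : (g.forms 2).MC, (g.pull (Fin.succAbove (0 : Fin 3))).toLinearMap Z.1 =
        (g.constForms 1).toLinearMap ((g.atVertex 1 1).toLinearMap e.1) ∧
      (g.pull (Fin.succAbove (1 : Fin 3))).toLinearMap Z.1 = e'.1 ∧
      (g.pull (Fin.succAbove (2 : Fin 3))).toLinearMap Z.1 = e.1 := by
  -- The triangle to be filled is the degeneration of `e` along `s`, with the face `1` replaced by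
  -- `e'`.
  let s : Fin 3 →o Fin 2 := ⟨![0, 1, 1], by decide⟩
  let v : Fin 3 → (Fin 2 →o Fin 2) := fun i => s.comp ⟨i.succAbove, i.strictMono_succAbove.monotone⟩
  have hv1 : ⇑(v 1) = id := by decide
  have hv2 : ⇑(v 2) = id := by decide
  have hv0 : ∀ x, v 0 x = 1 := by decide
  have hdec : ∀ (j : Fin 3) (a b : Fin 2), j ≠ 1 → (1 : Fin 3).succAbove a ≠ j →
    (1 : Fin 3).succAbove b ≠ j → a = b := by decide
  have hval : ∀ a, (g.atVertex 1 a).toLinearMap e.1 = (g.atVertex 1 a).toLinearMap e'.1 := by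
    intro a
    rw [← tauApp_obj_val, ← tauApp_obj_val, he]
  let z : Fin 3 → (g.forms 1).MC := fun i => if i = 1 then e' else (g.pull (v i)).mapMC e
  -- The replaced face agrees with the degeneration of `e` at its endpoints. This is enough, since
  -- two distinct faces of a triangle meet in a single vertex, so on overlaps the maps into the face
  -- `1` are constant.
  have hz : ∀ (i : Fin 3) (l : ℕ) (u : Fin (l + 1) → Fin 2), (i = 1 → ∀ x, u x = u 0) →
      (g.pull u).toLinearMap (z i).1 = (g.pull (s ∘ i.succAbove ∘ u)).toLinearMap e.1 := by
    intro i l u hi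
    by_cases h : i = 1
    · subst h
      have h1 : (s ∘ (1 : Fin 3).succAbove ∘ u) = u := congrArg (· ∘ u) hv1
      rw [h1, pull_eq_of_constant (hi rfl), pull_eq_of_constant (hi rfl), hval]
      rfl
    · rw [show z i = (g.pull (v i)).mapMC e from if_neg h]
      exact pull_pull _ _ _
  have compat : ∀ i j (l : ℕ) (u v : Fin (l + 1) →o Fin (1 + 1)),
      i.succAbove ∘ u = j.succAbove ∘ v →
        (g.pull u).toLinearMap (z i).1 = (g.pull v).toLinearMap (z j).1 := by
    intro i j l u w huw
    by_cases hij : i = j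
    · subst hij
      have : (u : Fin (l + 1) → Fin 2) = w :=
        funext fun x => Fin.succAbove_right_injective (congrFun huw x)
      rw [this]
    · rw [hz i l u, hz j l w, huw]
      · rintro rfl x
        refine hdec i _ _ hij ?_ ?_
        · exact fun hh => Fin.succAbove_ne i (u x) ((congrFun huw x).trans hh)
        · exact fun hh => Fin.succAbove_ne i (u 0) ((congrFun huw 0).trans hh)
      · rintro rfl x
        refine hdec j _ _ (Ne.symm hij) ?_ ?_
        · exact fun hh => Fin.succAbove_ne j (w x) ((congrFun huw x).symm.trans hh)
        · exact fun hh => Fin.succAbove_ne j (w 0) ((congrFun huw 0).symm.trans hh)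
  -- Since `e` and `e'` have the same image under `τ`, the modified boundary still lies over the
  -- degenerate simplex of the nerve defined by `e`, and the lifting property of `τ` fills it.
  obtain ⟨Z, hZ, -, -⟩ := exists_MC_extension (f := toTrivial g)
    (fun y => ⟨0, Subsingleton.elim _ _⟩) z (s.monotone.functor ⋙ tauApp e)
    ⟨0, zero_mem _, Subsingleton.elim _ _⟩ compat
    (fun i => by
      by_cases h : i = 1
      · subst h
        rw [show z 1 = e' from if_pos rfl, ← he]
        have h1 := tauApp_pull (v 1) e
        rw [show (g.pull (v 1)).mapMC e = e from Subtype.ext (by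
          change (g.pull (v 1)).toLinearMap e.1 = e.1
          rw [hv1, pull_id_apply])] at h1
        exact h1
      · rw [show z i = (g.pull (v i)).mapMC e from if_neg h]
        exact tauApp_pull (v i) e)
    (fun i => Subsingleton.elim _ _) (trivial_functor_ext _ _)
  refine ⟨Z, ?_, ?_, ?_⟩
  · rw [hZ, show z 0 = (g.pull (v 0)).mapMC e from if_neg (by decide)]
    exact pull_eq_of_constant hv0 e.1
  · rw [hZ, show z 1 = e' from if_pos rfl]
  · rw [hZ, show z 2 = (g.pull (v 2)).mapMC e from if_neg (by decide)]
    change (g.pull (v 2)).toLinearMap e.1 = e.1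
    rw [hv2, pull_id_apply]

theorem exists_inverse_desc_tau : ∃ G : g.Deligne ⥤ SSet.FundamentalGroupoid g.contents,
    SSet.FundamentalGroupoid.desc (tau g) ⋙ G = 𝟭 _ ∧
      G ⋙ SSet.FundamentalGroupoid.desc (tau g) = 𝟭 _ := by
  refine SSet.FundamentalGroupoid.exists_inverse_desc acyclicFibration_tau fun e e' he => ?_
  obtain ⟨Z, h0, h1, h2⟩ := exists_triangle (e := e) (e' := e') he
  refine ⟨Z, (g.constForms 0).mapMC ((g.atVertex 1 1).mapMC e), Subtype.ext ?_, Subtype.ext h1,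
    Subtype.ext h2⟩
  refine h0.trans (pull_const_apply _ _).symm

end DGLie

theorem mainTheorem5 {k : Type u} [Field k] [CharZero k] :
    (∀ (g : DGLie.{u} k) [g.IsNilpotent],
      SSet.KanComplex g.contents ∧
      ∃ τ : g.contents ⟶ nerve g.Deligne,
        g.IsTau τ ∧ (∀ τ', g.IsTau τ' → τ' = τ) ∧
        SSet.AcyclicFibration τ ∧
        -- the functor from the Poincaré groupoid of `Σ(g)` to `C(g)` is an isomorphism
        ∃ G : g.Deligne ⥤ SSet.FundamentalGroupoid g.contents,
          SSet.FundamentalGroupoid.desc τ ⋙ G = 𝟭 _ ∧ G ⋙ SSet.FundamentalGroupoid.desc τ = 𝟭 _) ∧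
    (∀ (g h : DGLie.{u} k) [g.IsNilpotent] [h.IsNilpotent] (f : DGLie.Hom g h),
      Function.Surjective f.toLinearMap →
      ∀ (τg : g.contents ⟶ nerve g.Deligne) (τh : h.contents ⟶ nerve h.Deligne),
        g.IsTau τg → h.IsTau τh →
        ∃ comm : τg ≫ nerveMap (DGLie.Deligne.map f) = DGLie.contentsMap f ≫ τh,
          SSet.AcyclicFibration (Limits.pullback.lift τg (DGLie.contentsMap f) comm)) := by
  refine ⟨fun g _ => ⟨DGLie.contents_kanComplex, DGLie.tau g, DGLie.tau_isTau,
    fun τ' hτ' => hτ'.eq DGLie.tau_isTau, DGLie.acyclicFibration_tau,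
    DGLie.exists_inverse_desc_tau⟩, fun g h _ _ f hf τg τh hg hh => ?_⟩
  -- By uniqueness the given maps are the constructed ones.
  obtain rfl := hg.eq DGLie.tau_isTau
  obtain rfl := hh.eq DGLie.tau_isTau
  exact ⟨DGLie.tau_naturality f, DGLie.acyclicFibration_pullback_lift hf _⟩
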